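/- **Modularity of a graph.** For a finite simple graph $G$ with at least one edge and a partition $\mathcal A$ of $V(G)$ let $$q_{\mathcal A}(G)=\sum_{A\in\mathcal A}\left(\frac{e(A)}{|E(G)|}-\frac{\big(\sum_{v\in A}\deg(v)\big)^2}{4|E(G)|^2}\right),$$ where $e(A)$ is the number of edges with both endpoints in $A$. The modularity is $q^*(G)=\max_{\mathcal A}q_{\mathcal A}(G)$, the maximum over all partitions of $V(G)$. **The Spatial Preferential Attachment model.** Let $m\ge 1$ be an integer and let $S=[0,1]^m$ carry the torus metric $d(x,y)=\min\{\|x-y+u\|_q : u\in\{-1,0,1\}^m\}$ derived from an $L_q$ norm, $1\le q\le\infty$. Let $p\in(0,1]$ and $A_1,A_2>0$. Random directed graphs $G_t=(V_t,E_t)$, $t\ge 0$, $V_t=\{v_1,\dots,v_t\}\subseteq S$, are generated as follows. $G_0$ is the null graph. For $t\ge1$ and $v\in V_t$, the sphere of influence $S(v,t)$ is the ball in $(S,d)$ centred at $v$ with volume $\min\{(A_1\deg^-(v,t)+A_2)/t,\,1\}$, where $\deg^-(v,t)$ is the in-degree of $v$ in $G_t$. At step $t\ge 1$ a new vertex $v_t$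 is chosen uniformly at random from $S$, independently of the past; then, independently for each $u\in V_{t-1}$ with $v_t\in S(u,t-1)$, a directed link $(v_t,u)$ is created with probability $p$. Let $\hat G_n$ be the simple undirected graph on $V_n$ obtained from $G_n$ by replacing each directed edge $(u,v)$ by the undirected edge $uv$. An event holds asymptotically almost surely (a.a.s.) if its probability tends to $1$ as $n\to\infty$. **Theorem.** Let $m\ge1$, $1\le q\le\infty$, $p\in(0,1]$, $A_1,A_2>0$, and suppose that $pA_1<1$. Then a.a.s. $$q^*(\hat G_n)=1-O\!\left(n^{\max\{-1/m,\,-1+pA_1\}/2}\,(\log n)^{9/2}\right)=1-o(1).$$ That is, there is a constant $C$, depending only on $m,q,p,A_1,A_2$, such that a.a.s. $|1-q^*(\hat G_n)|\le C\,n^{\max\{-1/m,\,-1+pA_1\}/2}(\log n)^{9/2}$; and for every $\varepsilon>0$, a.a.s. $|1-q^*(\hat G_n)|\le\varepsilon$. -/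

import Mathlib

open MeasureTheory Filter Topology
open scoped ENNReal unitInterval

noncomputable section

/-! ### Modularity of a finite simple graph -/

open Classical in
/-- `e(A)`: the number of edges of `G` with both endpoints in `A`. -/
def edgesInside {V : Type*} [Fintype V] (G : SimpleGraph V) (A : Finset V) : ℕ :=
  (G.edgeFinset.filter (fun e => ∀ v ∈ e, v ∈ A)).card

open Classical in
/-- The modularity `q_𝒜(G)` of a partition `𝒜` of the vertex set:
`∑_{A ∈ 𝒜} (e(A) / |E(G)| - (∑_{v ∈ A} deg v)² / (4 |E(G)|²))`. -/
def partitionModularity {V : Type*} [Fintype V] [DecidableEq V] (G : SimpleGraph V)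
    (P : Finpartition (Finset.univ : Finset V)) : ℝ :=
  ∑ A ∈ P.parts, ((edgesInside G A : ℝ) / (G.edgeFinset.card : ℝ)
    - ((∑ v ∈ A, G.degree v : ℕ) : ℝ) ^ 2 / (4 * (G.edgeFinset.card : ℝ) ^ 2))

/-- The modularity `q*(G)`: the maximum of `q_𝒜(G)` over the (finitely many) partitions `𝒜` of the
vertex set. -/
def modularity {V : Type*} [Fintype V] [DecidableEq V] (G : SimpleGraph V) : ℝ :=
  ⨆ P : Finpartition (Finset.univ : Finset V), partitionModularity G P

/-! ### The cube `[0,1]^m` with the torus metric -/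

/-- The `L_q` norm on `ℝ^m`, for `1 ≤ q ≤ ∞`. -/
def lqNorm {m : ℕ} (q : ℝ≥0∞) (z : Fin m → ℝ) : ℝ :=
  ‖(WithLp.toLp q z : PiLp q (fun _ : Fin m => ℝ))‖

/-- The torus metric on `S = [0,1]^m` derived from the `L_q` norm:
`d(x,y) = min {‖x - y + u‖_q : u ∈ {-1,0,1}^m}` (`SignType` is the three-element type
`{-1,0,1}`). -/
def torusDist {m : ℕ} (q : ℝ≥0∞) (x y : Fin m → I) : ℝ :=
  ⨅ u : Fin m → SignType, lqNorm q (fun i => (x i : ℝ) - (y i : ℝ) + ((u i : SignType) : ℝ))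

/-- The closed ball of radius `r` around `c` in the torus metric. -/
def torusBall {m : ℕ} (q : ℝ≥0∞) (c : Fin m → I) (r : ℝ) : Set (Fin m → I) :=
  {x | torusDist q c x ≤ r}

/-- The ball centred at `c` with volume `V`: the closed ball whose radius is the least `r ≥ 0` for
which the volume is at least `V`. For `0 ≤ V ≤ 1` its volume is exactly `V`,
see `volume_ballOfVolume`. -/
def ballOfVolume {m : ℕ} (q : ℝ≥0∞) (c : Fin m → I) (V : ℝ) : Set (Fin m → I) :=
  torusBall q c (sInf {r : ℝ | 0 ≤ r ∧ V ≤ volume.real (torusBall q c r)})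

theorem lqNorm_nonneg {m : ℕ} {q : ℝ≥0∞} (hq : 1 ≤ q) (z : Fin m → ℝ) : 0 ≤ lqNorm q z := by
  have : Fact (1 ≤ q) := ⟨hq⟩
  exact norm_nonneg (WithLp.toLp q z : PiLp q (fun _ : Fin m => ℝ))

theorem continuous_lqNorm {m : ℕ} {q : ℝ≥0∞} (hq : 1 ≤ q) :
    Continuous (lqNorm q : (Fin m → ℝ) → ℝ) := by
  have : Fact (1 ≤ q) := ⟨hq⟩
  have h : Continuous (fun z : PiLp q (fun _ : Fin m => ℝ) => ‖z‖) := continuous_norm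
  exact h.comp (PiLp.continuous_toLp q (fun _ : Fin m => ℝ))

theorem volume_lqSphere {m : ℕ} (hm : 1 ≤ m) {q : ℝ≥0∞} (hq : 1 ≤ q)
    (a : Fin m → ℝ) (r : ℝ) :
    (volume : Measure (Fin m → ℝ)) {z | lqNorm q (a - z) = r} = 0 := by
  have : Fact (1 ≤ q) := ⟨hq⟩
  have : Nonempty (Fin m) := ⟨⟨0, hm⟩⟩
  let e := PiLp.continuousLinearEquiv q ℝ (fun _ : Fin m => ℝ)
  let μ : Measure (PiLp q (fun _ : Fin m => ℝ)) := (volume : Measure (Fin m → ℝ)).map e.symm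
  have : μ.IsAddHaarMeasure := ContinuousLinearEquiv.isAddHaarMeasure_map e.symm _
  have h1 : μ (Metric.sphere (WithLp.toLp q a) r) = 0 := Measure.addHaar_sphere μ _ r
  rw [Measure.map_apply e.symm.continuous.measurable Metric.isClosed_sphere.measurableSet] at h1
  refine measure_mono_null ?_ h1
  intro z hz
  change dist (e.symm z) (WithLp.toLp q a) = r
  rw [dist_comm]
  exact (dist_eq_norm _ _).trans hz

theorem volume_torusSphere {m : ℕ} (hm : 1 ≤ m) {q : ℝ≥0∞} (hq : 1 ≤ q)
    (c : Fin m → I) (r : ℝ) :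
    volume {x | torusDist q c x = r} = 0 := by
  have key : ∀ u : Fin m → SignType, volume {x : Fin m → I |
      lqNorm q (fun i => (c i : ℝ) - (x i : ℝ) + ((u i : SignType) : ℝ)) = r} = 0 := by
    intro u
    have h2 := volume_lqSphere hm hq (fun i => (c i : ℝ) + ((u i : SignType) : ℝ)) r
    have h3 : MeasurePreserving (fun (x : Fin m → I) i => (x i : ℝ)) volume
        (Measure.pi fun _ => (volume : Measure ℝ).restrict I) :=
      measurePreserving_pi _ _ (fun _ => unitInterval.measurePreserving_coe)
    rw [← Measure.restrict_pi_pi] at h3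
    have h5 := h3.quasiMeasurePreserving.preimage_null
      (Measure.restrict_le_self.absolutelyContinuous h2)
    refine measure_mono_null ?_ h5
    intro x hx
    change lqNorm q _ = r at hx
    change lqNorm q _ = r
    rw [← hx]
    congr 1
    ext i
    simp only [Pi.sub_apply]
    ring
  refine measure_mono_null ?_ (measure_iUnion_null key)
  intro x hx
  obtain ⟨u, hu⟩ := exists_eq_ciInf_of_finite
    (f := fun u : Fin m → SignType =>
      lqNorm q (fun i => (c i : ℝ) - (x i : ℝ) + ((u i : SignType) : ℝ)))
  exact Set.mem_iUnion.2 ⟨u, hu.trans hx⟩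

theorem measurable_torusDist {m : ℕ} {q : ℝ≥0∞} (hq : 1 ≤ q) (c : Fin m → I) :
    Measurable (torusDist q c) := by
  refine Measurable.iInf (fun u => ?_)
  refine ((continuous_lqNorm hq).comp ?_).measurable
  fun_prop

/-- The ball of volume `V ∈ [0,1]` has volume `V`. -/
theorem volume_ballOfVolume {m : ℕ} (hm : 1 ≤ m) {q : ℝ≥0∞} (hq : 1 ≤ q)
    (c : Fin m → I) {V : ℝ} (hV0 : 0 ≤ V) (hV1 : V ≤ 1) :
    volume.real (ballOfVolume q c V) = V := by
  set T : Set ℝ := {r : ℝ | 0 ≤ r ∧ V ≤ volume.real (torusBall q c r)} with hT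
  set ρ := sInf T with hρ
  have hmeas := measurable_torusDist hq c
  let ν : Measure ℝ := (volume : Measure (Fin m → I)).map (torusDist q c)
  have : IsProbabilityMeasure ν := Measure.isProbabilityMeasure_map hmeas.aemeasurable
  have hν : ∀ r, volume.real (torusBall q c r) = ν.real (Set.Iic r) := by
    intro r
    rw [map_measureReal_apply hmeas measurableSet_Iic]
    rfl
  have hatom : ∀ r, ν {r} = 0 := by
    intro r
    rw [Measure.map_apply hmeas (measurableSet_singleton r)]
    exact volume_torusSphere hm hq c r
  have : NullSingletonClass ν := ⟨hatom⟩
  have hcont : Continuous (fun r => ν.real (Set.Iic r)) := by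
    have h : (fun r => ν.real (Set.Iic r)) = ProbabilityTheory.cdf ν := by
      ext r; rw [ProbabilityTheory.cdf_eq_real]
    rw [h, continuous_iff_continuousAt]
    intro r
    rw [(ProbabilityTheory.monotone_cdf ν).continuousAt_iff_leftLim_eq_rightLim,
      StieltjesFunction.rightLim_eq]
    have h1 := (ProbabilityTheory.cdf ν).measure_singleton r
    rw [ProbabilityTheory.measure_cdf, hatom, eq_comm, ENNReal.ofReal_eq_zero] at h1
    exact le_antisymm ((ProbabilityTheory.monotone_cdf ν).leftLim_le le_rfl) (by linarith)
  have hneg : ∀ r < 0, ν.real (Set.Iic r) = 0 := by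
    intro r hr
    rw [← hν]
    have hempty : torusBall q c r = ∅ := by
      ext x
      refine iff_of_false (not_le.2 (hr.trans_le ?_)) (Set.notMem_empty x)
      exact Real.iInf_nonneg fun u => lqNorm_nonneg hq _
    simp [hempty]
  obtain ⟨R, hR0, hR⟩ : ∃ R : ℝ, 0 ≤ R ∧ ∀ x, torusDist q c x ≤ R := by
    let g : (Fin m → I) → ℝ := fun x =>
      lqNorm q (fun i => (c i : ℝ) - (x i : ℝ) + ((0 : SignType) : ℝ))
    have hg : Continuous g := by
      refine (continuous_lqNorm hq).comp ?_
      fun_prop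
    obtain ⟨R, hR⟩ := (isCompact_range hg).bddAbove
    have hgR : ∀ x, g x ≤ R := fun x => hR ⟨x, rfl⟩
    refine ⟨R, (lqNorm_nonneg hq _).trans (hgR c), fun x => le_trans ?_ (hgR x)⟩
    exact ciInf_le (f := fun u : Fin m → SignType =>
      lqNorm q (fun i => (c i : ℝ) - (x i : ℝ) + ((u i : SignType) : ℝ)))
      (Set.finite_range _).bddBelow (fun _ => 0)
  have hRT : R ∈ T := by
    refine ⟨hR0, ?_⟩
    have huniv : torusBall q c R = Set.univ := Set.eq_univ_of_forall hR
    rw [huniv]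
    simpa using hV1
  have hclosed : IsClosed T := by
    have : T = Set.Ici 0 ∩ (fun r => ν.real (Set.Iic r)) ⁻¹' Set.Ici V := by
      ext r
      simp [hT, hν]
    rw [this]
    exact isClosed_Ici.inter (isClosed_Ici.preimage hcont)
  have hbdd : BddBelow T := ⟨0, fun r hr => hr.1⟩
  have hρT : ρ ∈ T := hclosed.csInf_mem ⟨R, hRT⟩ hbdd
  refine le_antisymm ?_ hρT.2
  have hlow : ∀ r < ρ, ν.real (Set.Iic r) ≤ V := by
    intro r hr
    rcases lt_or_ge r 0 with h0 | h0
    · rw [hneg r h0]; exact hV0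
    · by_contra hcon
      refine notMem_of_lt_csInf hr hbdd ⟨h0, ?_⟩
      rw [hν]
      exact (not_le.1 hcon).le
  change volume.real (torusBall q c ρ) ≤ V
  rw [hν]
  exact le_of_tendsto (hcont.continuousAt.continuousWithinAt (s := Set.Iio ρ))
    (eventually_nhdsWithin_of_forall hlow)

/-! ### The Spatial Preferential Attachment model

Vertices are named by their time of arrival `1, 2, 3, …`; the vertex `v_t` sits at the point
`x t` of the cube. A directed graph is a finite set of pairs `(source, target)`. -/

/-- The in-degree of the vertex `v` in the digraph with edge set `E`. -/
def inDegree (E : Finset (ℕ × ℕ)) (v : ℕ) : ℕ :=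
  (E.filter (fun e => e.2 = v)).card

/-- The volume `min {(A₁ deg⁻(v,t) + A₂) / t, 1}` of the sphere of influence of `v` at time
`t ≥ 1`, when the digraph at time `t` has edge set `E`. -/
def influenceVolume (A₁ A₂ : ℝ) (E : Finset (ℕ × ℕ)) (t v : ℕ) : ℝ :=
  min ((A₁ * (inDegree E v : ℝ) + A₂) / (t : ℝ)) 1

/-- The sphere of influence `S(v,t)`: the ball centred at `v` with the prescribed volume. -/
def influenceSphere {m : ℕ} (q : ℝ≥0∞) (A₁ A₂ : ℝ) (x : ℕ → Fin m → I)
    (E : Finset (ℕ × ℕ)) (t v : ℕ) : Set (Fin m → I) :=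
  ballOfVolume q (x v) (influenceVolume A₁ A₂ E t v)

open Classical in
/-- The edge set of the directed graph `G_t` of the model, as a function of the positions `x` of the
vertices and of the outcomes `coin` of the link trials. At the step from time `t` to time `t + 1`
the vertex `t + 1` arrives, and a link `(t + 1, u)` is created for each vertex `u ∈ {1, …, t}` such
that `x (t + 1) ∈ S(u,t)` and the trial `coin (t + 1, u)` succeeds. -/
def spaEdges {m : ℕ} (q : ℝ≥0∞) (A₁ A₂ : ℝ) (x : ℕ → Fin m → I) (coin : ℕ × ℕ → Bool) :
    ℕ → Finset (ℕ × ℕ)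
  | 0 => ∅
  | t + 1 =>
    spaEdges q A₁ A₂ x coin t ∪
      ((Finset.Icc 1 t).filter (fun u =>
        x (t + 1) ∈ influenceSphere q A₁ A₂ x (spaEdges q A₁ A₂ x coin t) t u ∧
          coin (t + 1, u) = true)).image (fun u => (t + 1, u))

/-- The sample space of the model: the positions of the vertices and the outcomes of the link
trials. -/
abbrev SPASpace (m : ℕ) : Type := (ℕ → Fin m → I) × (ℕ × ℕ → Bool)

/-- The probability measure of the model: the positions are independent and uniform on `[0,1]^m`,
the link trials succeed with probability `p` independently of each other and of the positions. -/
def spaMeasure (m : ℕ) (p : I) : Measure (SPASpace m) :=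
  (Measure.infinitePi (fun _ : ℕ => (volume : Measure (Fin m → I)))).prod
    (Measure.infinitePi (fun _ : ℕ × ℕ => ProbabilityTheory.bernoulliMeasure true false p))

/-- The undirected graph `Ĝ_n` on the vertices `v_1, …, v_n`: each directed edge `(u,v)` of `G_n` is
replaced by the undirected edge `uv`. -/
def spaGraph {m : ℕ} (q : ℝ≥0∞) (A₁ A₂ : ℝ) (ω : SPASpace m) (n : ℕ) :
    SimpleGraph (Finset.Icc 1 n) :=
  SimpleGraph.fromRel (fun u v => ((u : ℕ), (v : ℕ)) ∈ spaEdges q A₁ A₂ ω.1 ω.2 n)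

/-- A sequence of events holds asymptotically almost surely if their probabilities tend to `1`. -/
def AsymptoticallyAlmostSurely {Ω : Type*} [MeasurableSpace Ω] (μ : Measure Ω)
    (event : ℕ → Set Ω) : Prop :=
  Tendsto (fun n => μ (event n)) atTop (𝓝 1)

end

noncomputable section

/-! ### Geometry of the torus -/

/-! Write `α = p A₁` and `β = min (1/m) (1 - α)`. The graph is geometric: most links are short, so
slicing the torus along one coordinate into about `n^(β/2)` parallel stripes gives a partition that
cuts few edges, while no stripe carries much of the total degree.

Cut edges. A link into a sphere of volume `V` has coordinate length at most `m V^(1/m)`. For a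
uniformly random offset, an arc of length `δ` crosses on average `k δ` boundaries of `k` stripes, so
some offset cuts at most `k` times the total length (`exists_stripes`). Moment bounds for the
in-degrees show that the total length has expectation `O(n^(1-β))` (`integral_totalLength_le`).

Degree tax. Up to the cut arcs, the sum of squared degree sums is governed by in-degree products
over pairs in a common stripe (`sum_degree_sq_le`). Two different vertices are within `1/k` in the
chosen coordinate with probability `O(1/k)`, nearly independently of how their in-degrees grow,
while equal pairs contribute `O(n^(1+α))`. The total is `O(n^(1+α) + n²/k)` in expectation
(`integral_closePairs_le`).

Number of edges. Every sphere at a time `t < n` contains the ball of volume `A₂/n` (when this is at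
most 1). Links through these smaller balls carry no feedback, their centred count is a martingale,
and Chebyshev's inequality gives at least `c n` edges (`measureReal_card_spaEdges_lt_le`).

With `k = ⌈n^(β/2)⌉` the cut fraction `k n^(-β)` and the tax `1/k` balance at `n^(-β/2)`. Markov's
inequality at level `log n` costs at most `(log n)²`, within the allowed `(log n)^(9/2)`.

Conditional expectations are replaced by integrals against functions of the history: resampling the
new vertex and one coin preserves the measure (`integral_step`). -/

/-- Two points of the circle `ℝ / ℤ`, given by representatives in `[0,1]`, are within `δ`. -/
def Nearby (δ : ℝ) (a b : I) : Prop :=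
  -- The range up to 2 leaves room for the difference of two shifts from `{-1,0,1}`, which arises
  -- when two points are compared through a third.
  ∃ w ∈ Finset.Icc (-2 : ℤ) 2, |(a : ℝ) - b + w| ≤ δ

theorem abs_le_lqNorm {m : ℕ} {q : ℝ≥0∞} (hq : 1 ≤ q) (z : Fin m → ℝ) (i : Fin m) :
    |z i| ≤ lqNorm q z := by
  have : Fact (1 ≤ q) := ⟨hq⟩
  exact PiLp.norm_apply_le (WithLp.toLp q z : PiLp q (fun _ : Fin m => ℝ)) i

theorem lqNorm_le_sum_abs {m : ℕ} {q : ℝ≥0∞} (hq : 1 ≤ q) (z : Fin m → ℝ) :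
    lqNorm q z ≤ ∑ i, |z i| := by
  have : Fact (1 ≤ q) := ⟨hq⟩
  have h : (WithLp.toLp q z : PiLp q (fun _ : Fin m => ℝ))
      = ∑ i, PiLp.single q i (z i) := by
    ext j
    simp [WithLp.ofLp_sum, Finset.sum_apply]
  calc lqNorm q z = ‖∑ i, (PiLp.single q i (z i) : PiLp q (fun _ : Fin m => ℝ))‖ := by
        rw [← h]; rfl
    _ ≤ ∑ i, ‖(PiLp.single q i (z i) : PiLp q (fun _ : Fin m => ℝ))‖ := norm_sum_le _ _
    _ = ∑ i, |z i| := by simp [PiLp.norm_single]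

theorem exists_torusDist_eq {m : ℕ} (q : ℝ≥0∞) (x y : Fin m → I) :
    ∃ u : Fin m → SignType,
      lqNorm q (fun i => (x i : ℝ) - (y i : ℝ) + ((u i : SignType) : ℝ)) = torusDist q x y :=
  exists_eq_ciInf_of_finite
    (f := fun u : Fin m → SignType =>
      lqNorm q (fun i => (x i : ℝ) - (y i : ℝ) + ((u i : SignType) : ℝ)))

theorem torusDist_le {m : ℕ} (q : ℝ≥0∞) (x y : Fin m → I) (u : Fin m → SignType) :
    torusDist q x y ≤ lqNorm q (fun i => (x i : ℝ) - (y i : ℝ) + ((u i : SignType) : ℝ)) :=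
  ciInf_le (f := fun u : Fin m → SignType =>
      lqNorm q (fun i => (x i : ℝ) - (y i : ℝ) + ((u i : SignType) : ℝ)))
      (Set.finite_range _).bddBelow u

theorem measurable_torusDist_prod {m : ℕ} {q : ℝ≥0∞} (hq : 1 ≤ q) :
    Measurable (fun z : (Fin m → I) × (Fin m → I) => torusDist q z.1 z.2) := by
  refine Measurable.iInf (fun u => ?_)
  refine ((continuous_lqNorm hq).comp ?_).measurable
  fun_prop

/-- The interval of radius `ρ ≤ 1` around a point of `[0,1]` has length at least `ρ`. -/
theorem le_volume_abs_sub_le (a : I) {ρ : ℝ} (h0 : 0 ≤ ρ) (h1 : ρ ≤ 1) :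
    ENNReal.ofReal ρ ≤ volume {b : I | |(a : ℝ) - b| ≤ ρ} := by
  -- One side of `a` suffices: take `[a - ρ, a]` if it stays in the unit interval, and `[0, ρ]`
  -- otherwise.
  obtain ⟨s, hs0, hs1, hs⟩ : ∃ s : ℝ, 0 ≤ s ∧ s + ρ ≤ 1 ∧ ∀ b, s ≤ b → b ≤ s + ρ →
      |(a : ℝ) - b| ≤ ρ := by
    have ha0 := a.2.1
    have ha1 := a.2.2
    rcases le_total ρ (a : ℝ) with h | h
    · refine ⟨a - ρ, by linarith, by linarith, fun b hb1 hb2 => ?_⟩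
      rw [abs_le]; constructor <;> linarith
    · refine ⟨0, le_rfl, by linarith, fun b hb1 hb2 => ?_⟩
      rw [abs_le]; constructor <;> linarith
  have h2 : MeasurePreserving (fun x : I => (x : ℝ)) volume ((volume : Measure ℝ).restrict I) :=
    unitInterval.measurePreserving_coe
  calc ENNReal.ofReal ρ = volume (Set.Icc s (s + ρ)) := by simp
    _ = ((volume : Measure ℝ).restrict I) (Set.Icc s (s + ρ)) := by
        rw [Measure.restrict_apply measurableSet_Icc, Set.inter_eq_left.2]
        intro b hb
        exact ⟨hs0.trans hb.1, hb.2.trans hs1⟩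
    _ = volume ((fun x : I => (x : ℝ)) ⁻¹' (Set.Icc s (s + ρ))) :=
        (h2.measure_preimage measurableSet_Icc.nullMeasurableSet).symm
    _ ≤ _ := measure_mono fun b hb => hs b hb.1 hb.2

/-- The factor 10 is five shifts times intervals of length `2δ`. -/
theorem volume_nearby_le (a : I) (δ : ℝ) :
    volume {b : I | Nearby δ a b} ≤ ENNReal.ofReal (10 * δ) := by
  have h2 : MeasurePreserving (fun x : I => (x : ℝ)) volume ((volume : Measure ℝ).restrict I) :=
    unitInterval.measurePreserving_coe
  have hsub : {b : I | Nearby δ a b} ⊆ ⋃ w ∈ Finset.Icc (-2 : ℤ) 2,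
      (fun x : I => (x : ℝ)) ⁻¹' (Metric.closedBall ((a : ℝ) + w) δ) := by
    rintro b ⟨w, hw, hb⟩
    simp only [Set.mem_iUnion, Set.mem_preimage, Metric.mem_closedBall, Real.dist_eq]
    refine ⟨w, hw, ?_⟩
    rw [abs_sub_comm]
    convert hb using 2
    ring
  refine (measure_mono hsub).trans ((measure_biUnion_finset_le _ _).trans ?_)
  have h3 : ∀ w ∈ Finset.Icc (-2 : ℤ) 2, volume ((fun x : I => (x : ℝ)) ⁻¹'
      (Metric.closedBall ((a : ℝ) + w) δ)) ≤ ENNReal.ofReal (2 * δ) := by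
    intro w _
    rw [h2.measure_preimage measurableSet_closedBall.nullMeasurableSet]
    refine (Measure.restrict_apply_le _ _).trans ?_
    rw [Real.volume_closedBall]
  refine (Finset.sum_le_sum h3).trans ?_
  rw [Finset.sum_const, show (Finset.Icc (-2 : ℤ) 2).card = 5 from rfl, ← ENNReal.ofReal_nsmul]
  refine ENNReal.ofReal_le_ofReal (le_of_eq ?_)
  rw [nsmul_eq_mul]
  push_cast
  ring

theorem measurableSet_nearby (δ : ℝ) : MeasurableSet {z : I × I | Nearby δ z.1 z.2} := by
  have : {z : I × I | Nearby δ z.1 z.2} = ⋃ w ∈ Finset.Icc (-2 : ℤ) 2,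
      {z : I × I | |(z.1 : ℝ) - z.2 + w| ≤ δ} := by
    ext z; simp [Nearby]
  rw [this]
  refine Finset.measurableSet_biUnion _ fun w _ => ?_
  refine (isClosed_le ?_ continuous_const).measurableSet
  fun_prop

/-- The set of points all of whose coordinates are near those of `c` has small volume. -/
theorem volume_forall_nearby_le {m : ℕ} (c : Fin m → I) {δ : ℝ} (hδ : 0 ≤ δ) :
    volume {y : Fin m → I | ∀ i, Nearby δ (c i) (y i)} ≤ ENNReal.ofReal ((10 * δ) ^ m) := by
  have : {y : Fin m → I | ∀ i, Nearby δ (c i) (y i)}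
      = Set.univ.pi (fun i => {b : I | Nearby δ (c i) b}) := by
    ext y; simp
  rw [this, volume_pi, Measure.pi_pi]
  refine (Finset.prod_le_prod' fun i _ => volume_nearby_le (c i) δ).trans ?_
  rw [Finset.prod_const, ENNReal.ofReal_pow (by positivity)]
  simp

/-- The `L_q` norm is at most the `L_1` norm, so the ball contains a box of half-width `ρ`; near the
boundary of the cube only half of each side is guaranteed. -/
theorem le_volume_torusBall {m : ℕ} {q : ℝ≥0∞} (hq : 1 ≤ q) (c : Fin m → I)
    {ρ : ℝ} (h0 : 0 ≤ ρ) (h1 : ρ ≤ 1) :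
    ρ ^ m ≤ volume.real (torusBall q c (m * ρ)) := by
  have hsub : Set.univ.pi (fun i => {b : I | |(c i : ℝ) - b| ≤ ρ}) ⊆ torusBall q c (m * ρ) := by
    intro y hy
    refine (torusDist_le q c y (fun _ => 0)).trans ((lqNorm_le_sum_abs hq _).trans ?_)
    refine (Finset.sum_le_card_nsmul _ _ ρ fun i _ => ?_).trans (by simp)
    simpa using hy i (Set.mem_univ _)
  refine (ENNReal.ofReal_le_iff_le_toReal (measure_ne_top _ _)).1 ?_
  refine le_trans ?_ (measure_mono hsub)
  rw [volume_pi, Measure.pi_pi, ENNReal.ofReal_pow h0]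
  calc ENNReal.ofReal ρ ^ m = ∏ _i : Fin m, ENNReal.ofReal ρ := by simp
    _ ≤ _ := Finset.prod_le_prod' fun i _ => le_volume_abs_sub_le (c i) h0 h1

/-- The radius of the ball of volume `V` is at most `m V^{1/m}`. -/
theorem radius_mem {m : ℕ} (hm : 1 ≤ m) {q : ℝ≥0∞} (hq : 1 ≤ q) (c : Fin m → I) {V : ℝ}
    (hV0 : 0 ≤ V) (hV1 : V ≤ 1) :
    m * V ^ (1 / (m : ℝ)) ∈ {r : ℝ | 0 ≤ r ∧ V ≤ volume.real (torusBall q c r)} := by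
  refine ⟨by positivity, ?_⟩
  have h := le_volume_torusBall hq c (Real.rpow_nonneg hV0 (1 / (m : ℝ)))
    (Real.rpow_le_one hV0 hV1 (by positivity))
  rwa [one_div, Real.rpow_inv_natCast_pow hV0 (by omega), ← one_div] at h

/-- Since a coordinate is bounded by the norm, this turns a link into a short arc of the circle in
every coordinate, which is all that the stripes use. -/
theorem nearby_of_mem_ballOfVolume {m : ℕ} (hm : 1 ≤ m) {q : ℝ≥0∞} (hq : 1 ≤ q)
    {c y : Fin m → I} {V : ℝ} (hV0 : 0 ≤ V) (hV1 : V ≤ 1) (hy : y ∈ ballOfVolume q c V)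
    (i : Fin m) : ∃ w : SignType, |(c i : ℝ) - y i + (w : ℝ)| ≤ m * V ^ (1 / (m : ℝ)) := by
  have h1 : torusDist q c y ≤ m * V ^ (1 / (m : ℝ)) :=
    le_trans hy (csInf_le ⟨0, fun r hr => hr.1⟩ (radius_mem hm hq c hV0 hV1))
  obtain ⟨u, hu⟩ := exists_torusDist_eq q c y
  exact ⟨u i, (abs_le_lqNorm hq _ i).trans (hu.le.trans h1)⟩

theorem ballOfVolume_mono {m : ℕ} (hm : 1 ≤ m) {q : ℝ≥0∞} (hq : 1 ≤ q) (c : Fin m → I)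
    {V V' : ℝ} (hV0 : 0 ≤ V') (h : V ≤ V') (hV1 : V' ≤ 1) :
    ballOfVolume q c V ⊆ ballOfVolume q c V' := by
  intro y hy
  refine le_trans hy (csInf_le_csInf ⟨0, fun r hr => hr.1⟩ ⟨_, radius_mem hm hq c hV0 hV1⟩ ?_)
  exact fun r hr => ⟨hr.1, h.trans hr.2⟩

theorem measurableSet_mem_ballOfVolume {m : ℕ} (hm : 1 ≤ m) {q : ℝ≥0∞} (hq : 1 ≤ q) {V : ℝ}
    (hV0 : 0 ≤ V) (hV1 : V ≤ 1) :
    MeasurableSet {z : (Fin m → I) × (Fin m → I) | z.2 ∈ ballOfVolume q z.1 V} := by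
  have hvol : ∀ r : ℝ, Measurable (fun c : Fin m → I => volume.real (torusBall q c r)) := by
    intro r
    have h1 : MeasurableSet {z : (Fin m → I) × (Fin m → I) | torusDist q z.1 z.2 ≤ r} :=
      measurableSet_le (measurable_torusDist_prod hq) measurable_const
    exact (measurable_measure_prodMk_left (ν := (volume : Measure (Fin m → I))) h1).ennreal_toReal
  have hρ : Measurable (fun c : Fin m → I =>
      sInf {r : ℝ | 0 ≤ r ∧ V ≤ volume.real (torusBall q c r)}) := by
    refine measurable_of_Iio fun s => ?_
    -- Volumes of balls increase with the radius, so the infimum is below `s` exactly when some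
    -- rational radius below `s` is admissible; this makes the radius measurable in the centre.
    have : (fun c : Fin m → I => sInf {r : ℝ | 0 ≤ r ∧ V ≤ volume.real (torusBall q c r)}) ⁻¹'
        Set.Iio s = ⋃ r : {r : ℚ // 0 ≤ r ∧ (r : ℝ) < s},
          {c | V ≤ volume.real (torusBall q c (r : ℝ))} := by
      ext c
      simp only [Set.mem_preimage, Set.mem_Iio, Set.mem_iUnion, Set.mem_ofPred_eq]
      rw [csInf_lt_iff ⟨0, fun r hr => hr.1⟩ ⟨_, radius_mem hm hq c hV0 hV1⟩]
      constructor
      · rintro ⟨r, ⟨hr0, hr⟩, hrs⟩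
        obtain ⟨r', hr1, hr2⟩ := exists_rat_btwn hrs
        refine ⟨⟨r', by exact_mod_cast (hr0.trans hr1.le), hr2⟩, hr.trans ?_⟩
        exact measureReal_mono fun x hx => le_trans hx hr1.le
      · rintro ⟨r, hr⟩
        exact ⟨r, ⟨by exact_mod_cast r.2.1, hr⟩, r.2.2⟩
    rw [this]
    exact MeasurableSet.iUnion fun r => measurableSet_le measurable_const (hvol _)
  exact measurableSet_le (measurable_torusDist_prod hq) (hρ.comp measurable_fst)

/-! ### Modularity and colourings -/

theorem edgesInside_eq {V : Type*} [Fintype V] (G : SimpleGraph V) (A : Finset V)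
    [Fintype G.edgeSet] [DecidablePred fun e : Sym2 V => ∀ v ∈ e, v ∈ A] :
    edgesInside G A = (G.edgeFinset.filter (fun e => ∀ v ∈ e, v ∈ A)).card := by
  unfold edgesInside
  congr!

theorem partitionModularity_eq {V : Type*} [Fintype V] [DecidableEq V] (G : SimpleGraph V)
    (P : Finpartition (Finset.univ : Finset V)) [Fintype G.edgeSet]
    [∀ v, Fintype (G.neighborSet v)] :
    partitionModularity G P = ∑ A ∈ P.parts, ((edgesInside G A : ℝ) / (G.edgeFinset.card : ℝ)
      - ((∑ v ∈ A, G.degree v : ℕ) : ℝ) ^ 2 / (4 * (G.edgeFinset.card : ℝ) ^ 2)) := by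
  unfold partitionModularity
  congr!

theorem sum_edgesInside_le {V : Type*} [Fintype V] [DecidableEq V] (G : SimpleGraph V)
    (P : Finpartition (Finset.univ : Finset V)) [Fintype G.edgeSet] :
    ∑ A ∈ P.parts, edgesInside G A ≤ G.edgeFinset.card := by
  classical
  simp_rw [edgesInside_eq]
  rw [← Finset.card_biUnion]
  · exact Finset.card_le_card (Finset.biUnion_subset.2 fun A _ => Finset.filter_subset _ _)
  · intro A hA B hB hAB
    change Disjoint _ _
    rw [Finset.disjoint_left]
    intro e he he'
    refine hAB ?_
    induction e with
    | _ x y =>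
      have h1 := (Finset.mem_filter.1 he).2 x (Sym2.mem_mk_left x y)
      have h2 := (Finset.mem_filter.1 he').2 x (Sym2.mem_mk_left x y)
      exact P.eq_of_mem_parts hA hB h1 h2

theorem partitionModularity_le_one {V : Type*} [Fintype V] [DecidableEq V] (G : SimpleGraph V)
    (P : Finpartition (Finset.univ : Finset V)) : partitionModularity G P ≤ 1 := by
  classical
  rw [partitionModularity_eq]
  refine (Finset.sum_le_sum fun A _ => sub_le_self _ (by positivity)).trans ?_
  rw [← Finset.sum_div]
  refine div_le_one_of_le₀ ?_ (by positivity)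
  exact_mod_cast sum_edgesInside_le G P

theorem modularity_le_one {V : Type*} [Fintype V] [DecidableEq V] (G : SimpleGraph V) :
    modularity G ≤ 1 :=
  ciSup_le fun P => partitionModularity_le_one G P

theorem partitionModularity_le_modularity {V : Type*} [Fintype V] [DecidableEq V]
    (G : SimpleGraph V) (P : Finpartition (Finset.univ : Finset V)) :
    partitionModularity G P ≤ modularity G :=
  le_ciSup (f := fun P => partitionModularity G P)
    ⟨1, by rintro _ ⟨P, rfl⟩; exact partitionModularity_le_one G P⟩ P

/-! ### The modularity deficit of the partition into colour classes. -/

section Colouring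

variable {V ι : Type*} [DecidableEq V] [DecidableEq ι]

/-- The number of arcs whose ends have different colours. -/
def cutCount (E : Finset (V × V)) (c : V → ι) : ℕ :=
  (E.filter (fun e => c e.1 ≠ c e.2)).card

/-- The number of arcs ending at `v`. -/
def arcsInto (E : Finset (V × V)) (v : V) : ℕ :=
  (E.filter (fun e => e.2 = v)).card

theorem degree_fromRel_le [Fintype V] (E : Finset (V × V)) (v : V)
    [Fintype ((SimpleGraph.fromRel (fun u v => (u, v) ∈ E)).neighborSet v)] :
    (SimpleGraph.fromRel (fun u v => (u, v) ∈ E)).degree v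
      ≤ (E.filter (fun e => e.1 = v)).card + (E.filter (fun e => e.2 = v)).card := by
  rw [← SimpleGraph.card_neighborFinset_eq_degree]
  have hsub : (SimpleGraph.fromRel (fun u v => (u, v) ∈ E)).neighborFinset v
      ⊆ (E.filter (fun e => e.1 = v)).image Prod.snd
        ∪ (E.filter (fun e => e.2 = v)).image Prod.fst := by
    intro w hw
    rw [SimpleGraph.mem_neighborFinset, SimpleGraph.fromRel_adj] at hw
    rw [Finset.mem_union, Finset.mem_image, Finset.mem_image]
    rcases hw.2 with h | h
    · exact Or.inl ⟨(v, w), by simp [h], rfl⟩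
    · exact Or.inr ⟨(w, v), by simp [h], rfl⟩
  exact (Finset.card_le_card hsub).trans ((Finset.card_union_le _ _).trans
    (add_le_add Finset.card_image_le Finset.card_image_le))

/-- No arc occurs with its reverse, in particular there are no loops, so forgetting orientations is
injective. -/
theorem card_le_card_edgeFinset_fromRel {V : Type*} [Fintype V] (E : Finset (V × V))
    (hE : ∀ u v, (u, v) ∈ E → (v, u) ∉ E)
    [Fintype (SimpleGraph.fromRel (fun u v => (u, v) ∈ E)).edgeSet] :
    E.card ≤ (SimpleGraph.fromRel (fun u v => (u, v) ∈ E)).edgeFinset.card := by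
  refine Finset.card_le_card_of_injOn (fun e => s(e.1, e.2)) ?_ ?_
  · rintro ⟨u, v⟩ h
    have h' : (u, v) ∈ E := h
    simp only [Finset.mem_coe, SimpleGraph.mem_edgeFinset, SimpleGraph.mem_edgeSet,
      SimpleGraph.fromRel_adj]
    refine ⟨?_, Or.inl h'⟩
    rintro rfl
    exact hE _ _ h' h'
  · rintro ⟨u, v⟩ h ⟨u', v'⟩ h' heq
    have h1 : (u, v) ∈ E := h
    have h2 : (u', v') ∈ E := h'
    rcases Sym2.eq_iff.1 heq with ⟨h3, h4⟩ | ⟨h3, h4⟩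
    · simp only at h3 h4
      rw [h3, h4]
    · simp only at h3 h4
      subst h3 h4
      exact absurd h2 (hE _ _ h1)

theorem card_edgeFinset_le_cutCount_add [Fintype V] (E : Finset (V × V)) (c : V → ι)
    (P : Finpartition (Finset.univ : Finset V))
    (hP : ∀ u v, c u = c v → ∃ A ∈ P.parts, u ∈ A ∧ v ∈ A)
    [Fintype (SimpleGraph.fromRel (fun u v => (u, v) ∈ E)).edgeSet] :
    (SimpleGraph.fromRel (fun u v => (u, v) ∈ E)).edgeFinset.card ≤ cutCount E c
      + ∑ A ∈ P.parts, edgesInside (SimpleGraph.fromRel (fun u v => (u, v) ∈ E)) A := by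
  classical
  simp_rw [edgesInside_eq]
  have hsub : (SimpleGraph.fromRel (fun u v => (u, v) ∈ E)).edgeFinset
      ⊆ (E.filter (fun e => c e.1 ≠ c e.2)).image (fun e => s(e.1, e.2))
      ∪ P.parts.biUnion (fun A =>
        (SimpleGraph.fromRel (fun u v => (u, v) ∈ E)).edgeFinset.filter (fun e => ∀ v ∈ e, v ∈ A)) := by
    intro e he
    induction e with
    | _ x y =>
      rw [Finset.mem_union, Finset.mem_image, Finset.mem_biUnion]
      by_cases hc : c x = c y
      · obtain ⟨A, hA, hx, hy⟩ := hP x y hc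
        refine Or.inr ⟨A, hA, Finset.mem_filter.2 ⟨he, fun v hv => ?_⟩⟩
        rcases Sym2.mem_iff.1 hv with rfl | rfl <;> assumption
      · left
        rw [SimpleGraph.mem_edgeFinset, SimpleGraph.mem_edgeSet,
          SimpleGraph.fromRel_adj] at he
        rcases he.2 with h | h
        · exact ⟨(x, y), by simp [h, hc], rfl⟩
        · exact ⟨(y, x), by simp [h, Ne.symm hc], Sym2.eq_swap⟩
  have h1 := (Finset.card_le_card hsub).trans (Finset.card_union_le _ _)
  exact h1.trans (add_le_add Finset.card_image_le Finset.card_biUnion_le)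

/-- An arc that leaves a vertex of `A` either ends in `A` or is cut. The degree sum of `A` is thus
at most twice its in-degree sum plus its cut arcs, and only in-degrees, whose moments are
accessible, remain to be estimated. -/
theorem sum_degree_sq_le [Fintype V] (E : Finset (V × V)) (c : V → ι)
    (P : Finpartition (Finset.univ : Finset V))
    (hP : ∀ A ∈ P.parts, ∀ u ∈ A, ∀ v ∈ A, c u = c v)
    (hP' : ∀ u v, c u = c v → ∃ A ∈ P.parts, u ∈ A ∧ v ∈ A)
    (d : V → ℕ) (hd : ∀ v, d v ≤ (E.filter (fun e => e.1 = v)).card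
      + (E.filter (fun e => e.2 = v)).card) :
    ∑ A ∈ P.parts, (∑ v ∈ A, d v) ^ 2
      ≤ 8 * (∑ u, ∑ v, if c u = c v then arcsInto E u * arcsInto E v else 0)
        + 2 * cutCount E c ^ 2 := by
  classical
  let inn : Finset V → ℕ := fun A => (E.filter (fun e => e.2 ∈ A)).card
  let cut : Finset V → ℕ := fun A =>
    ((E.filter (fun e => c e.1 ≠ c e.2)).filter (fun e => e.1 ∈ A)).card
  have hinn : ∀ A, inn A = ∑ v ∈ A, arcsInto E v := by
    intro A
    have := Finset.card_eq_sum_card_fiberwise (f := Prod.snd)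
      (s := E.filter (fun e => e.2 ∈ A)) (t := A) (fun e he => (Finset.mem_filter.1 he).2)
    refine this.trans (Finset.sum_congr rfl fun v hv => ?_)
    unfold arcsInto
    congr 1
    ext e
    simp only [Finset.mem_filter]
    constructor
    · rintro ⟨⟨h1, _⟩, h2⟩; exact ⟨h1, h2⟩
    · rintro ⟨h1, h2⟩; exact ⟨⟨h1, h2 ▸ hv⟩, h2⟩
  have hout : ∀ A ∈ P.parts, ∑ v ∈ A, (E.filter (fun e => e.1 = v)).card ≤ inn A + cut A := by
    intro A hA
    have h0 : ∑ v ∈ A, (E.filter (fun e => e.1 = v)).card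
        = (E.filter (fun e => e.1 ∈ A)).card := by
      have := Finset.card_eq_sum_card_fiberwise (f := Prod.fst)
        (s := E.filter (fun e => e.1 ∈ A)) (t := A) (fun e he => (Finset.mem_filter.1 he).2)
      rw [this]
      refine Finset.sum_congr rfl fun v hv => ?_
      congr 1
      ext e
      simp only [Finset.mem_filter]
      constructor
      · rintro ⟨h1, h2⟩; exact ⟨⟨h1, h2 ▸ hv⟩, h2⟩
      · rintro ⟨⟨h1, _⟩, h2⟩; exact ⟨h1, h2⟩
    rw [h0]
    refine (Finset.card_le_card ?_).trans (Finset.card_union_le _ _)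
    intro e he
    rw [Finset.mem_filter] at he
    rw [Finset.mem_union, Finset.mem_filter, Finset.mem_filter, Finset.mem_filter]
    by_cases hc : c e.1 = c e.2
    · left
      obtain ⟨B, hB, h1, h2⟩ := hP' _ _ hc
      rw [P.eq_of_mem_parts hA hB he.2 h1]
      exact ⟨he.1, h2⟩
    · exact Or.inr ⟨⟨he.1, hc⟩, he.2⟩
  have hcut : ∑ A ∈ P.parts, cut A ≤ cutCount E c := by
    unfold cutCount
    rw [← Finset.card_biUnion]
    · exact Finset.card_le_card (Finset.biUnion_subset.2 fun A _ => Finset.filter_subset _ _)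
    · intro A hA B hB hAB
      change Disjoint _ _
      rw [Finset.disjoint_left]
      intro e he he'
      exact hAB (P.eq_of_mem_parts hA hB (Finset.mem_filter.1 he).2 (Finset.mem_filter.1 he').2)
  have hcut2 : ∑ A ∈ P.parts, cut A ^ 2 ≤ cutCount E c ^ 2 := by
    refine le_trans ?_ (Nat.pow_le_pow_left hcut 2)
    -- Each cut arc is charged to the single part containing its source, so the squares sum to at
    -- most the square of the total.
    exact Finset.sum_sq_le_sq_sum_of_nonneg fun A _ => Nat.zero_le _
  have hQ : ∑ A ∈ P.parts, inn A ^ 2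
      = ∑ u, ∑ v, if c u = c v then arcsInto E u * arcsInto E v else 0 := by
    have h1 : ∀ A ∈ P.parts, inn A ^ 2
        = ∑ u ∈ A, ∑ v, if c u = c v then arcsInto E u * arcsInto E v else 0 := by
      intro A hA
      rw [hinn, sq, Finset.sum_mul_sum]
      refine Finset.sum_congr rfl fun u hu => ?_
      rw [← Finset.sum_filter]
      refine Finset.sum_congr ?_ fun _ _ => rfl
      ext v
      simp only [Finset.mem_filter, Finset.mem_univ, true_and]
      constructor
      · exact fun hv => hP A hA u hu v hv
      · intro hc
        obtain ⟨B, hB, hu', hv⟩ := hP' _ _ hc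
        rwa [P.eq_of_mem_parts hA hB hu hu']
    rw [Finset.sum_congr rfl h1, ← Finset.sum_biUnion]
    · refine Finset.sum_congr ?_ fun _ _ => rfl
      exact P.biUnion_parts
    · exact P.disjoint
  calc ∑ A ∈ P.parts, (∑ v ∈ A, d v) ^ 2
      ≤ ∑ A ∈ P.parts, (8 * inn A ^ 2 + 2 * cut A ^ 2) := by
        refine Finset.sum_le_sum fun A hA => ?_
        have h1 : ∑ v ∈ A, d v ≤ 2 * inn A + cut A := by
          refine (Finset.sum_le_sum fun v _ => hd v).trans ?_
          rw [Finset.sum_add_distrib]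
          have := hout A hA
          have h2 : ∑ v ∈ A, (E.filter (fun e => e.2 = v)).card = inn A := (hinn A).symm
          omega
        refine (Nat.pow_le_pow_left h1 2).trans ?_
        zify
        -- This is `(2a + b)² ≤ 8a² + 2b²`.
        nlinarith [sq_nonneg (2 * (inn A : ℤ) - cut A)]
    _ ≤ _ := by
        rw [Finset.sum_add_distrib, ← Finset.mul_sum, ← Finset.mul_sum, hQ]
        omega

/-- A colouring of the vertices bounds the modularity from below. -/
theorem one_sub_modularity_le [Fintype V] (E : Finset (V × V))
    (hE : ∀ u v, (u, v) ∈ E → (v, u) ∉ E) (hpos : 0 < E.card) (c : V → ι) :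
    1 - modularity (SimpleGraph.fromRel (fun u v => (u, v) ∈ E))
      ≤ cutCount E c / E.card
        + (8 * (∑ u, ∑ v, if c u = c v then (arcsInto E u : ℝ) * arcsInto E v else 0)
          + 2 * (cutCount E c : ℝ) ^ 2) / (4 * (E.card : ℝ) ^ 2) := by
  classical
  set G := SimpleGraph.fromRel (fun u v => (u, v) ∈ E) with hG
  let P : Finpartition (Finset.univ : Finset V) := Finpartition.ofSetoid (Setoid.ker c)
  have hP' : ∀ u v, c u = c v → ∃ A ∈ P.parts, u ∈ A ∧ v ∈ A := by
    intro u v h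
    refine ⟨P.part u, P.part_mem.2 (Finset.mem_univ u), P.mem_part (Finset.mem_univ u), ?_⟩
    exact Finpartition.mem_part_ofSetoid_iff_rel.2 h
  have hP : ∀ A ∈ P.parts, ∀ u ∈ A, ∀ v ∈ A, c u = c v := by
    intro A hA u hu v hv
    have h1 : P.part u = A := P.part_eq_of_mem hA hu
    rw [← h1] at hv
    exact Finpartition.mem_part_ofSetoid_iff_rel.1 hv
  have hM : E.card ≤ G.edgeFinset.card := card_le_card_edgeFinset_fromRel E hE
  have h1 : G.edgeFinset.card ≤ cutCount E c + ∑ A ∈ P.parts, edgesInside G A :=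
    card_edgeFinset_le_cutCount_add E c P hP'
  have h2 := sum_degree_sq_le E c P hP hP' (fun v => G.degree v) (fun v => degree_fromRel_le E v)
  have hM0 : 0 < G.edgeFinset.card := hpos.trans_le hM
  have hMR : (0 : ℝ) < G.edgeFinset.card := by exact_mod_cast hM0
  have hER : (0 : ℝ) < E.card := by exact_mod_cast hpos
  have hle : (E.card : ℝ) ≤ G.edgeFinset.card := by exact_mod_cast hM
  have hq : 1 - partitionModularity G P ≤ cutCount E c / (G.edgeFinset.card : ℝ)
      + (8 * (∑ u, ∑ v, if c u = c v then (arcsInto E u : ℝ) * arcsInto E v else 0)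
          + 2 * (cutCount E c : ℝ) ^ 2) / (4 * (G.edgeFinset.card : ℝ) ^ 2) := by
    have h1' : (G.edgeFinset.card : ℝ) ≤ cutCount E c + ∑ A ∈ P.parts, (edgesInside G A : ℝ) := by
      exact_mod_cast h1
    have h2' : ∑ A ∈ P.parts, ((∑ v ∈ A, G.degree v : ℕ) : ℝ) ^ 2
        ≤ 8 * (∑ u, ∑ v, if c u = c v then (arcsInto E u : ℝ) * arcsInto E v else 0)
          + 2 * (cutCount E c : ℝ) ^ 2 := by
      exact_mod_cast h2
    rw [partitionModularity_eq, Finset.sum_sub_distrib, ← Finset.sum_div, ← Finset.sum_div]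
    have h3 : 1 - (∑ A ∈ P.parts, (edgesInside G A : ℝ)) / (G.edgeFinset.card : ℝ)
        ≤ cutCount E c / (G.edgeFinset.card : ℝ) := by
      rw [sub_le_iff_le_add, ← add_div, one_le_div hMR]
      exact h1'
    have h4 := div_le_div_of_nonneg_right h2'
      (by positivity : (0:ℝ) ≤ 4 * (G.edgeFinset.card : ℝ) ^ 2)
    have h5 : ∀ a b x y : ℝ, 1 - a ≤ x → b ≤ y → 1 - (a - b) ≤ x + y := by
      intros; linarith
    exact h5 _ _ _ _ h3 h4
  have hmod := partitionModularity_le_modularity G P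
  refine le_trans (by linarith) (hq.trans ?_)
  have hQ0 : (0 : ℝ) ≤ ∑ u, ∑ v, if c u = c v then (arcsInto E u : ℝ) * arcsInto E v else 0 := by
    positivity
  -- The numerators are nonnegative, so the number of edges in the denominators may be lowered to
  -- the number of arcs.
  gcongr

end Colouring

/-! ### Random stripes -/

theorem intervalIntegrable_floor_add (x : ℝ) :
    IntervalIntegrable (fun h : ℝ => (⌊x + h⌋ : ℝ)) volume 0 1 := by
  refine Monotone.intervalIntegrable fun a b hab => ?_
  exact_mod_cast Int.floor_mono (by linarith)

/-- Write the floor as the identity minus the fractional part; the latter is periodic, so its mean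
over a period ignores the shift. -/
theorem integral_floor_add (x : ℝ) :
    ∫ h in (0 : ℝ)..1, (⌊x + h⌋ : ℝ) = x + ∫ h in (0 : ℝ)..1, (⌊h⌋ : ℝ) := by
  have hfr : ∀ y : ℝ, ∫ h in (0 : ℝ)..1, (⌊y + h⌋ : ℝ)
      = y + 1 / 2 - ∫ h in (0 : ℝ)..1, Int.fract h := by
    intro y
    have h1 : ∫ h in (0 : ℝ)..1, Int.fract (y + h) = ∫ h in (0 : ℝ)..1, Int.fract h := by
      rw [intervalIntegral.integral_comp_add_left (fun h => Int.fract h)]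
      have hp : Function.Periodic (Int.fract : ℝ → ℝ) 1 := fun a => Int.fract_add_one a
      have := hp.intervalIntegral_add_eq y 0
      simpa using this
    have h2 : ∀ h : ℝ, (⌊y + h⌋ : ℝ) = (y + h) - Int.fract (y + h) := fun h => by
      rw [Int.fract]; ring
    have h3 : IntervalIntegrable (fun h : ℝ => y + h) volume 0 1 :=
      (by fun_prop : Continuous fun h : ℝ => y + h).intervalIntegrable _ _
    have h4 : IntervalIntegrable (fun h : ℝ => Int.fract (y + h)) volume 0 1 := by
      have := h3.sub (intervalIntegrable_floor_add y)
      exact this.congr fun h _ => rfl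
    simp_rw [h2]
    rw [intervalIntegral.integral_sub h3 h4, h1]
    rw [intervalIntegral.integral_add (by simp) (by simp)]
    simp
  have h0 := hfr 0
  simp only [zero_add] at h0
  rw [hfr x, h0]
  ring

/-- A randomly shifted integer grid has on average `|x - y|` points between `x` and `y`. -/
theorem integral_abs_floor_sub (x y : ℝ) :
    ∫ h in (0 : ℝ)..1, |(⌊x + h⌋ : ℝ) - ⌊y + h⌋| = |x - y| := by
  wlog hxy : y ≤ x generalizing x y
  · rw [abs_sub_comm x y, ← this y x (le_of_not_ge hxy)]
    simp_rw [abs_sub_comm]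
  have h1 : ∀ h : ℝ, |(⌊x + h⌋ : ℝ) - ⌊y + h⌋| = (⌊x + h⌋ : ℝ) - ⌊y + h⌋ := fun h => by
    rw [abs_of_nonneg]
    have : ⌊y + h⌋ ≤ ⌊x + h⌋ := Int.floor_mono (by linarith)
    have : (⌊y + h⌋ : ℝ) ≤ ⌊x + h⌋ := by exact_mod_cast this
    linarith
  simp_rw [h1]
  rw [intervalIntegral.integral_sub (intervalIntegrable_floor_add x)
    (intervalIntegrable_floor_add y), integral_floor_add x, integral_floor_add y,
    abs_of_nonneg (by linarith)]
  ring

/-- Cutting the circle into `k` stripes at a suitable offset, few arcs run between different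
stripes if the arcs are short. -/
theorem exists_stripes {V : Type*} [DecidableEq V] (E : Finset (V × V)) (a : V → I)
    (δ : V × V → ℝ)
    (hδ : ∀ e ∈ E, ∃ w : SignType, |(a e.2 : ℝ) - a e.1 + (w : ℝ)| ≤ δ e) {k : ℕ} (hk : 1 ≤ k) :
    ∃ c : V → ℤ, (cutCount E c : ℝ) ≤ k * ∑ e ∈ E, δ e ∧
      ∀ u v, c u = c v → Nearby (1 / k) (a u) (a v) := by
  have hkR : (0 : ℝ) < k := by exact_mod_cast hk
  choose! w hw using hδ
  -- Ends of the arc in units of the stripe width, the second one lifted to the line by `w e` so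
  -- that a short arc stays short across the seam.
  let x : V × V → ℝ := fun e => k * a e.1
  let y : V × V → ℝ := fun e => k * (a e.2 + (w e : ℝ))
  -- Boundaries crossed by all arcs at offset `h`; some offset does no worse than the mean.
  let g : ℝ → ℝ := fun h => ∑ e ∈ E, |(⌊x e + h⌋ : ℝ) - ⌊y e + h⌋|
  have hint : ∀ e, IntervalIntegrable (fun h => |(⌊x e + h⌋ : ℝ) - ⌊y e + h⌋|) volume 0 1 :=
    fun e => ((intervalIntegrable_floor_add _).sub (intervalIntegrable_floor_add _)).abs
  have hg : ∫ h in (0 : ℝ)..1, g h ≤ k * ∑ e ∈ E, δ e := by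
    rw [intervalIntegral.integral_finsetSum fun e _ => hint e, Finset.mul_sum]
    refine Finset.sum_le_sum fun e he => ?_
    rw [integral_abs_floor_sub]
    have : x e - y e = -(k * ((a e.2 : ℝ) - a e.1 + (w e : ℝ))) := by simp only [x, y]; ring
    rw [this, abs_neg, abs_mul, abs_of_pos hkR]
    exact mul_le_mul_of_nonneg_left (hw e he) hkR.le
  obtain ⟨h, hh⟩ : ∃ h, g h ≤ k * ∑ e ∈ E, δ e := by
    have : IsProbabilityMeasure ((volume : Measure ℝ).restrict (Set.Ioc 0 1)) := ⟨by simp⟩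
    have hgi : IntervalIntegrable g volume 0 1 := by
      have h1 := IntervalIntegrable.sum E fun e _ => hint e
      have h2 : g = ∑ e ∈ E, fun h => |(⌊x e + h⌋ : ℝ) - ⌊y e + h⌋| := by
        ext h
        simp [g, Finset.sum_apply]
      rwa [h2]
    obtain ⟨h, hh⟩ := exists_le_integral ((intervalIntegrable_iff_integrableOn_Ioc_of_le
      zero_le_one).1 hgi)
    exact ⟨h, hh.trans (by rwa [intervalIntegral.integral_of_le zero_le_one] at hg)⟩
  -- Going once around the circle changes the floor by `k`, so reduction modulo `k` makes the colour
  -- independent of the lift.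
  refine ⟨fun v => ⌊k * (a v : ℝ) + h⌋ % k, le_trans ?_ hh, ?_⟩
  · unfold cutCount
    rw [Finset.card_filter]
    push_cast
    refine Finset.sum_le_sum fun e _ => ?_
    split_ifs with hc
    · have hne : ⌊x e + h⌋ - ⌊y e + h⌋ ≠ 0 := by
        intro h0
        refine hc ?_
        have h2 : y e + h = k * (a e.2 : ℝ) + h + ((k * (w e : ℤ) : ℤ) : ℝ) := by
          simp only [y]
          push_cast
          ring
        rw [h2, Int.floor_add_intCast] at h0
        have h3 : ⌊k * (a e.1 : ℝ) + h⌋ = ⌊k * (a e.2 : ℝ) + h⌋ + k * (w e : ℤ) := by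
          simp only [x] at h0
          linarith
        rw [h3, Int.add_mul_emod_self_left]
      have := Int.one_le_abs hne
      exact_mod_cast this
    · positivity
  · intro u v huv
    obtain ⟨z, hz⟩ := Int.ModEq.dvd (show _ ≡ _ [ZMOD (k : ℤ)] from huv.symm)
    have h1 := Int.floor_le (k * (a u : ℝ) + h)
    have h2 := Int.lt_floor_add_one (k * (a u : ℝ) + h)
    have h3 := Int.floor_le (k * (a v : ℝ) + h)
    have h4 := Int.lt_floor_add_one (k * (a v : ℝ) + h)
    have hzR : (⌊k * (a u : ℝ) + h⌋ : ℝ) - ⌊k * (a v : ℝ) + h⌋ = k * z := by exact_mod_cast hz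
    -- Equal colours mean that the floors differ by `k z`; removing this lap leaves two numbers with
    -- the same floor.
    have h5 : |k * ((a u : ℝ) - a v + ((-z : ℤ) : ℝ))| ≤ 1 := by
      push_cast
      rw [abs_le]
      constructor <;> nlinarith
    rw [abs_mul, abs_of_pos hkR] at h5
    have h6 : |(a u : ℝ) - a v + ((-z : ℤ) : ℝ)| ≤ 1 / k := by
      rw [le_div_iff₀ hkR]; linarith
    refine ⟨-z, ?_, h6⟩
    have h7 : |(a u : ℝ) - a v + ((-z : ℤ) : ℝ)| ≤ 1 := by
      refine h6.trans ?_
      rw [div_le_one hkR]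
      exact_mod_cast hk
    rw [abs_le] at h7
    have hu := (a u).2
    have hv := (a v).2
    rw [Finset.mem_Icc]
    constructor
    · have : (-2 : ℝ) ≤ ((-z : ℤ) : ℝ) := by linarith [hu.1, hu.2, hv.1, hv.2]
      exact_mod_cast this
    · have : ((-z : ℤ) : ℝ) ≤ 2 := by linarith [hu.1, hu.2, hv.1, hv.2]
      exact_mod_cast this

/-! ### Resampling a coordinate of a product measure -/

/-- Checked on finite boxes: the constraint on coordinate `i` passes to the fresh sample and the
others are untouched. This is the independence of one coordinate from the rest, in a form suited to
integration. -/
theorem measurePreserving_update_infinitePi {ι : Type*} [DecidableEq ι] {X : Type*}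
    [MeasurableSpace X] (ν : Measure X) [IsProbabilityMeasure ν] (i : ι) :
    MeasurePreserving (fun z : (ι → X) × X => Function.update z.1 i z.2)
      ((Measure.infinitePi (fun _ : ι => ν)).prod ν) (Measure.infinitePi (fun _ : ι => ν)) := by
  have hmeas : Measurable (fun z : (ι → X) × X => Function.update z.1 i z.2) := by
    rw [measurable_pi_iff]
    intro j
    by_cases h : j = i
    · subst h; simpa using measurable_snd
    · simp only [Function.update_of_ne h]
      exact (measurable_pi_apply j).comp measurable_fst
  refine ⟨hmeas, Measure.eq_infinitePi _ fun s t ht => ?_⟩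
  have hpre : (fun z : (ι → X) × X => Function.update z.1 i z.2) ⁻¹' (Set.pi s t)
      = (Set.pi (s.erase i : Finset ι) t) ×ˢ (if i ∈ s then t i else Set.univ) := by
    ext z
    simp only [Set.mem_preimage, Set.mem_pi, Finset.mem_coe, Set.mem_prod, Finset.mem_erase]
    constructor
    · intro h
      refine ⟨fun j hj => ?_, ?_⟩
      · have := h j hj.2
        rwa [Function.update_of_ne hj.1] at this
      · split_ifs with hi
        · have := h i hi
          rwa [Function.update_self] at this
        · trivial
    · rintro ⟨h1, h2⟩ j hj
      by_cases hji : j = i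
      · subst hji
        rw [Function.update_self]
        rwa [if_pos hj] at h2
      · rw [Function.update_of_ne hji]
        exact h1 j ⟨hji, hj⟩
  rw [Measure.map_apply hmeas (MeasurableSet.pi s.countable_toSet fun j _ => ht j), hpre,
    Measure.prod_prod, Measure.infinitePi_pi _ fun j _ => ht j]
  split_ifs with hi
  · rw [mul_comm, Finset.mul_prod_erase s (fun j => ν (t j)) hi]
  · rw [Finset.erase_eq_of_notMem hi]; simp

theorem measurePreserving_prodProdProdComm {α β γ δ : Type*} [MeasurableSpace α]
    [MeasurableSpace β] [MeasurableSpace γ] [MeasurableSpace δ] (μ : Measure α) (ν : Measure β)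
    (κ : Measure γ) (τ : Measure δ) [SFinite μ] [SFinite ν] [SFinite κ] [SFinite τ] :
    MeasurePreserving (fun z : (α × β) × (γ × δ) => ((z.1.1, z.2.1), (z.1.2, z.2.2)))
      ((μ.prod ν).prod (κ.prod τ)) ((μ.prod κ).prod (ν.prod τ)) := by
  have h1 := measurePreserving_prodAssoc μ ν (κ.prod τ)
  have h2 := (measurePreserving_prodAssoc ν κ τ).symm
  have h3 : MeasurePreserving (Prod.map (Prod.swap : β × γ → γ × β) (id : δ → δ))
      ((ν.prod κ).prod τ) ((κ.prod ν).prod τ) :=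
    Measure.measurePreserving_swap.prod (MeasurePreserving.id τ)
  have h4 := measurePreserving_prodAssoc κ ν τ
  have h5 := (MeasurePreserving.id μ).prod (h4.comp (h3.comp h2))
  have h6 := (measurePreserving_prodAssoc μ κ (ν.prod τ)).symm
  exact h6.comp (h5.comp h1)

instance (m : ℕ) (p : I) : IsProbabilityMeasure (spaMeasure m p) := by
  unfold spaMeasure; infer_instance

theorem measurePreserving_resample (m : ℕ) (p : I) (i : ℕ) (e : ℕ × ℕ) :
    MeasurePreserving (fun z : SPASpace m × ((Fin m → I) × Bool) =>
        ((Function.update z.1.1 i z.2.1, Function.update z.1.2 e z.2.2) : SPASpace m))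
      ((spaMeasure m p).prod ((volume : Measure (Fin m → I)).prod
        (ProbabilityTheory.bernoulliMeasure true false p))) (spaMeasure m p) :=
  ((measurePreserving_update_infinitePi (volume : Measure (Fin m → I)) i).prod
    (measurePreserving_update_infinitePi (ProbabilityTheory.bernoulliMeasure true false p) e)).comp
    (measurePreserving_prodProdProdComm _ _ _ _)

/-! ### Functions of the history -/

/-- The two outcomes have the same vertices and link trials up to time `t`. -/
def AgreeUpTo {m : ℕ} (t : ℕ) (ω ω' : SPASpace m) : Prop :=
  (∀ i ≤ t, ω.1 i = ω'.1 i) ∧ ∀ e : ℕ × ℕ, e.1 ≤ t → ω.2 e = ω'.2 e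

/-- A bounded measurable function of the history of the process up to time `t`. -/
structure HistoryFun {m : ℕ} (t : ℕ) (f : SPASpace m → ℝ) : Prop where
  meas : Measurable f
  bdd : ∃ C, ∀ ω, |f ω| ≤ C
  congr : ∀ ω ω', AgreeUpTo t ω ω' → f ω = f ω'

namespace HistoryFun

variable {m : ℕ} {t : ℕ} {f g : SPASpace m → ℝ}

theorem mono {s : ℕ} (hf : HistoryFun s f) (h : s ≤ t) : HistoryFun t f :=
  ⟨hf.meas, hf.bdd, fun ω ω' hω =>
    hf.congr ω ω' ⟨fun i hi => hω.1 i (hi.trans h), fun e he => hω.2 e (he.trans h)⟩⟩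

theorem const (t : ℕ) (c : ℝ) : HistoryFun t (fun _ : SPASpace m => c) :=
  ⟨measurable_const, ⟨|c|, fun _ => le_rfl⟩, fun _ _ _ => rfl⟩

theorem add (hf : HistoryFun t f) (hg : HistoryFun t g) : HistoryFun t (fun ω => f ω + g ω) := by
  obtain ⟨C, hC⟩ := hf.bdd
  obtain ⟨D, hD⟩ := hg.bdd
  refine ⟨hf.meas.add hg.meas, ⟨C + D, fun ω => ?_⟩, fun ω ω' h => ?_⟩
  · exact (abs_add_le _ _).trans (add_le_add (hC ω) (hD ω))
  · rw [hf.congr ω ω' h, hg.congr ω ω' h]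

theorem mul (hf : HistoryFun t f) (hg : HistoryFun t g) : HistoryFun t (fun ω => f ω * g ω) := by
  obtain ⟨C, hC⟩ := hf.bdd
  obtain ⟨D, hD⟩ := hg.bdd
  refine ⟨hf.meas.mul hg.meas, ⟨C * D, fun ω => ?_⟩, fun ω ω' h => ?_⟩
  · rw [abs_mul]
    exact mul_le_mul (hC ω) (hD ω) (abs_nonneg _) ((abs_nonneg _).trans (hC ω))
  · rw [hf.congr ω ω' h, hg.congr ω ω' h]

theorem sub (hf : HistoryFun t f) (hg : HistoryFun t g) : HistoryFun t (fun ω => f ω - g ω) := by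
  simpa [sub_eq_add_neg] using hf.add ((const t (-1)).mul hg)

theorem const_mul (c : ℝ) (hf : HistoryFun t f) : HistoryFun t (fun ω => c * f ω) :=
  (const t c).mul hf

theorem add_const (hf : HistoryFun t f) (c : ℝ) : HistoryFun t (fun ω => f ω + c) :=
  hf.add (const t c)

theorem sum {ι : Type*} (s : Finset ι) {F : ι → SPASpace m → ℝ} (h : ∀ i ∈ s, HistoryFun t (F i)) :
    HistoryFun t (fun ω => ∑ i ∈ s, F i ω) := by
  classical
  induction s using Finset.induction_on with
  | empty => simpa using const t 0
  | insert a s ha ih =>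
    simp_rw [Finset.sum_insert ha]
    exact (h a (Finset.mem_insert_self a s)).add
      (ih fun i hi => h i (Finset.mem_insert_of_mem hi))

theorem integrable {p : I} (hf : HistoryFun t f) : Integrable f (spaMeasure m p) := by
  obtain ⟨C, hC⟩ := hf.bdd
  exact Integrable.of_bound hf.meas.aestronglyMeasurable C (ae_of_all _ fun ω => hC ω)

theorem ite {P : SPASpace m → Prop} [DecidablePred P] (hP : MeasurableSet {ω | P ω})
    (hloc : ∀ ω ω', AgreeUpTo t ω ω' → (P ω ↔ P ω')) :
    HistoryFun t (fun ω => if P ω then (1 : ℝ) else 0) := by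
  refine ⟨Measurable.ite hP measurable_const measurable_const, ⟨1, fun ω => ?_⟩, fun ω ω' h => ?_⟩
  · split_ifs <;> simp
  · simp only [hloc ω ω' h]

end HistoryFun

/-- Integrating out the vertex and a link trial of the step after time `t`. -/
theorem integral_step {m : ℕ} {p : I} (t u : ℕ) (g : SPASpace m → (Fin m → I) → ℝ)
    (hg : Measurable (Function.uncurry g)) (hb : ∃ C, ∀ ω y, |g ω y| ≤ C)
    (hloc : ∀ ω ω' y, AgreeUpTo t ω ω' → g ω y = g ω' y) (φ : Bool → ℝ) :
    ∫ ω, g ω (ω.1 (t + 1)) * φ (ω.2 (t + 1, u)) ∂(spaMeasure m p)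
      = ((p : ℝ) * φ true + (1 - p) * φ false)
        * ∫ ω, (∫ y, g ω y) ∂(spaMeasure m p) := by
  obtain ⟨C, hC⟩ := hb
  set ber := ProbabilityTheory.bernoulliMeasure true false p
  have hbool : ∀ b, |φ b| ≤ max |φ true| |φ false| := by
    intro b; cases b
    · exact le_max_right _ _
    · exact le_max_left _ _
  have hC0 : 0 ≤ C := by
    obtain ⟨ω⟩ : Nonempty (SPASpace m) := inferInstance
    exact (abs_nonneg _).trans (hC ω (fun _ => 0))
  have hR := measurePreserving_resample m p (t + 1) (t + 1, u)
  have hmeas : Measurable fun ω : SPASpace m => g ω (ω.1 (t + 1)) * φ (ω.2 (t + 1, u)) := by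
    have h1 : Measurable fun ω : SPASpace m => (ω, ω.1 (t + 1)) := by fun_prop
    have h2 : Measurable fun ω : SPASpace m => ω.2 (t + 1, u) := by fun_prop
    exact (hg.comp h1).mul ((measurable_of_finite φ).comp h2)
  -- Replace the outcome by the one with position `t + 1` and coin `(t + 1, u)` resampled; by Fubini
  -- these integrate out separately.
  rw [← hR.map_eq, integral_map hR.measurable.aemeasurable hmeas.aestronglyMeasurable, hR.map_eq]
  have heq : ∀ z : SPASpace m × ((Fin m → I) × Bool),
      g (Function.update z.1.1 (t + 1) z.2.1, Function.update z.1.2 (t + 1, u) z.2.2)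
        (Function.update z.1.1 (t + 1) z.2.1 (t + 1))
        * φ (Function.update z.1.2 (t + 1, u) z.2.2 (t + 1, u))
      = g z.1 z.2.1 * φ z.2.2 := by
    intro z
    rw [Function.update_self, Function.update_self]
    congr 1
    -- The resampled data belong to time `t + 1`, which `g` does not see in its first argument.
    refine hloc _ _ _ ⟨fun i hi => ?_, fun e he => ?_⟩
    · exact Function.update_of_ne (by omega) _ _
    · refine Function.update_of_ne ?_ _ _
      rintro rfl
      simp at he
  simp_rw [heq]
  have hint : Integrable (fun z : SPASpace m × ((Fin m → I) × Bool) => g z.1 z.2.1 * φ z.2.2)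
      ((spaMeasure m p).prod ((volume : Measure (Fin m → I)).prod ber)) := by
    have h1 : Measurable fun z : SPASpace m × ((Fin m → I) × Bool) => (z.1, z.2.1) := by fun_prop
    have h2 : Measurable fun z : SPASpace m × ((Fin m → I) × Bool) => z.2.2 := by fun_prop
    refine Integrable.of_bound ((hg.comp h1).mul
      ((measurable_of_finite φ).comp h2)).aestronglyMeasurable (C * max |φ true| |φ false|)
      (ae_of_all _ fun z => ?_)
    rw [Real.norm_eq_abs, abs_mul]
    exact mul_le_mul (hC _ _) (hbool _) (abs_nonneg _) hC0
  rw [integral_prod _ hint]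
  have h2 : ∀ ω : SPASpace m, ∫ z : (Fin m → I) × Bool, g ω z.1 * φ z.2
      ∂((volume : Measure (Fin m → I)).prod ber)
      = (∫ y, g ω y) * ((p : ℝ) * φ true + (1 - p) * φ false) := by
    intro ω
    rw [integral_prod_mul]
    congr 1
    simp [ber, ProbabilityTheory.integral_bernoulliMeasure]
  simp_rw [h2]
  rw [integral_mul_const, mul_comm]

/-! ### The history of the process -/

theorem mem_spaEdges_succ {m : ℕ} {q : ℝ≥0∞} {A₁ A₂ : ℝ} {x : ℕ → Fin m → I}
    {c : ℕ × ℕ → Bool} {t : ℕ} {e : ℕ × ℕ} :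
    e ∈ spaEdges q A₁ A₂ x c (t + 1) ↔ e ∈ spaEdges q A₁ A₂ x c t ∨
      (e.1 = t + 1 ∧ (1 ≤ e.2 ∧ e.2 ≤ t) ∧
        x (t + 1) ∈ influenceSphere q A₁ A₂ x (spaEdges q A₁ A₂ x c t) t e.2 ∧
        c (t + 1, e.2) = true) := by
  classical
  obtain ⟨s, u⟩ := e
  rw [spaEdges, Finset.mem_union, Finset.mem_image]
  refine or_congr Iff.rfl ?_
  constructor
  · rintro ⟨v, hv, h⟩
    rw [Finset.mem_filter, Finset.mem_Icc] at hv
    obtain ⟨rfl, rfl⟩ := Prod.mk.inj h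
    exact ⟨rfl, hv.1, hv.2.1, hv.2.2⟩
  · rintro ⟨h1, h2, h3, h4⟩
    simp only at h1 h2 h3 h4
    subst h1
    exact ⟨u, Finset.mem_filter.2 ⟨Finset.mem_Icc.2 h2, h3, h4⟩, rfl⟩

theorem bounds_of_mem_spaEdges {m : ℕ} {q : ℝ≥0∞} {A₁ A₂ : ℝ} {x : ℕ → Fin m → I}
    {c : ℕ × ℕ → Bool} {t : ℕ} {e : ℕ × ℕ} (he : e ∈ spaEdges q A₁ A₂ x c t) :
    1 ≤ e.2 ∧ e.2 < e.1 ∧ e.1 ≤ t := by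
  induction t with
  | zero => simp [spaEdges] at he
  | succ t ih =>
    rcases mem_spaEdges_succ.1 he with h | ⟨h1, h2, -⟩
    · have := ih h; omega
    · omega

theorem mem_spaEdges_of_le {m : ℕ} {q : ℝ≥0∞} {A₁ A₂ : ℝ} {x : ℕ → Fin m → I}
    {c : ℕ × ℕ → Bool} {s t : ℕ} (h : s ≤ t) {e : ℕ × ℕ} (hes : e.1 ≤ s) :
    e ∈ spaEdges q A₁ A₂ x c t ↔ e ∈ spaEdges q A₁ A₂ x c s := by
  induction t, h using Nat.le_induction with
  | base => rfl
  | succ t hst ih =>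
    rw [mem_spaEdges_succ, ih, or_iff_left]
    rintro ⟨h1, -⟩
    omega

theorem mem_spaEdges_succ_self {m : ℕ} {q : ℝ≥0∞} {A₁ A₂ : ℝ} {x : ℕ → Fin m → I}
    {c : ℕ × ℕ → Bool} {t u : ℕ} (hu1 : 1 ≤ u) (hut : u ≤ t) :
    (t + 1, u) ∈ spaEdges q A₁ A₂ x c (t + 1) ↔
      x (t + 1) ∈ influenceSphere q A₁ A₂ x (spaEdges q A₁ A₂ x c t) t u ∧
        c (t + 1, u) = true := by
  rw [mem_spaEdges_succ, or_iff_right]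
  · simp [hu1, hut]
  · intro h
    have := bounds_of_mem_spaEdges h
    simp at this

theorem spaEdges_congr {m : ℕ} {q : ℝ≥0∞} {A₁ A₂ : ℝ} {t : ℕ} {ω ω' : SPASpace m}
    (h : AgreeUpTo t ω ω') :
    spaEdges q A₁ A₂ ω.1 ω.2 t = spaEdges q A₁ A₂ ω'.1 ω'.2 t := by
  induction t with
  | zero => rfl
  | succ t ih =>
    have h' : AgreeUpTo t ω ω' := ⟨fun i hi => h.1 i (by omega), fun e he => h.2 e (by omega)⟩
    ext e
    rw [mem_spaEdges_succ, mem_spaEdges_succ, ih h']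
    refine or_congr Iff.rfl (and_congr_right fun _ => and_congr_right fun h2 => ?_)
    rw [h.1 (t + 1) le_rfl, h.2 (t + 1, e.2) le_rfl]
    unfold influenceSphere
    rw [h.1 e.2 (by omega)]

theorem inDegree_succ {m : ℕ} {q : ℝ≥0∞} {A₁ A₂ : ℝ} {x : ℕ → Fin m → I}
    {c : ℕ × ℕ → Bool} {t u : ℕ} :
    inDegree (spaEdges q A₁ A₂ x c (t + 1)) u = inDegree (spaEdges q A₁ A₂ x c t) u
      + if (t + 1, u) ∈ spaEdges q A₁ A₂ x c (t + 1) then 1 else 0 := by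
  classical
  unfold inDegree
  have hnot : (t + 1, u) ∉ spaEdges q A₁ A₂ x c t := fun h => by
    have := bounds_of_mem_spaEdges h
    simp at this
  have hset : (spaEdges q A₁ A₂ x c (t + 1)).filter (fun e => e.2 = u)
      = (spaEdges q A₁ A₂ x c t).filter (fun e => e.2 = u)
        ∪ (if (t + 1, u) ∈ spaEdges q A₁ A₂ x c (t + 1) then {(t + 1, u)} else ∅) := by
    ext ⟨s, v⟩
    rw [Finset.mem_union, Finset.mem_filter, Finset.mem_filter]
    rcases Nat.lt_or_ge t s with hs | hs
    · have hn : (s, v) ∉ spaEdges q A₁ A₂ x c t := fun h => by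
        have := bounds_of_mem_spaEdges h
        simp at this
        omega
      constructor
      · rintro ⟨h1, h2⟩
        simp only at h2
        subst h2
        have := bounds_of_mem_spaEdges h1
        simp only at this
        obtain rfl : s = t + 1 := by omega
        right
        rw [if_pos h1]
        exact Finset.mem_singleton_self _
      · rintro (⟨h1, -⟩ | h1)
        · exact absurd h1 hn
        · split_ifs at h1 with h2
          · rw [Finset.mem_singleton] at h1
            rw [h1]
            exact ⟨h2, rfl⟩
          · simp at h1
    · rw [mem_spaEdges_of_le (Nat.le_succ t) (e := (s, v)) hs, or_iff_left]
      split_ifs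
      · rw [Finset.mem_singleton]
        intro h
        have := (Prod.mk.inj h).1
        omega
      · simp
  rw [hset, Finset.card_union_of_disjoint]
  · split_ifs <;> simp
  · split_ifs
    · rw [Finset.disjoint_singleton_right, Finset.mem_filter]
      exact fun h => hnot h.1
    · simp

theorem inDegree_eq_zero {m : ℕ} {q : ℝ≥0∞} {A₁ A₂ : ℝ} {x : ℕ → Fin m → I}
    {c : ℕ × ℕ → Bool} {t u : ℕ} (h : t ≤ u) : inDegree (spaEdges q A₁ A₂ x c t) u = 0 := by
  rw [inDegree, Finset.card_eq_zero, Finset.filter_eq_empty_iff]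
  rintro e he rfl
  have := bounds_of_mem_spaEdges he
  omega

theorem inDegree_le {m : ℕ} {q : ℝ≥0∞} {A₁ A₂ : ℝ} {x : ℕ → Fin m → I}
    {c : ℕ × ℕ → Bool} (t u : ℕ) : inDegree (spaEdges q A₁ A₂ x c t) u ≤ t := by
  induction t with
  | zero => simp [spaEdges, inDegree]
  | succ t ih =>
    rw [inDegree_succ]
    split_ifs <;> omega

theorem influenceVolume_nonneg {A₁ A₂ : ℝ} (hA₁ : 0 ≤ A₁) (hA₂ : 0 ≤ A₂) (E : Finset (ℕ × ℕ))
    (t v : ℕ) : 0 ≤ influenceVolume A₁ A₂ E t v :=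
  le_min (by positivity) zero_le_one

theorem influenceVolume_le_one (A₁ A₂ : ℝ) (E : Finset (ℕ × ℕ)) (t v : ℕ) :
    influenceVolume A₁ A₂ E t v ≤ 1 := min_le_right _ _

/-- The random graph takes countably many values, so measurability may be checked with the graph
frozen. -/
theorem measurableSet_mem_of_countable {Ω α β : Type*} [MeasurableSpace Ω] [MeasurableSpace α]
    [Countable β] (T : Ω → β) (hT : ∀ E, MeasurableSet {ω | T ω = E})
    (S : β → Set (Ω × α)) (hS : ∀ E, MeasurableSet (S E)) :
    MeasurableSet {z : Ω × α | z ∈ S (T z.1)} := by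
  have h1 : {z : Ω × α | z ∈ S (T z.1)} = ⋃ E, (Prod.fst ⁻¹' {ω | T ω = E}) ∩ S E := by
    ext z
    simp
  rw [h1]
  exact MeasurableSet.iUnion fun E => (measurable_fst (hT E)).inter (hS E)

/-! ### Measurability of the graph process. -/

section Measurability

variable {m : ℕ} (hm : 1 ≤ m) {q : ℝ≥0∞} (hq : 1 ≤ q) {A₁ A₂ : ℝ} (hA₁ : 0 ≤ A₁) (hA₂ : 0 ≤ A₂)
include hm hq hA₁ hA₂

theorem measurableSet_spaEdges_eq (t : ℕ) (E : Finset (ℕ × ℕ)) :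
    MeasurableSet {ω : SPASpace m | spaEdges q A₁ A₂ ω.1 ω.2 t = E} := by
  induction t generalizing E with
  | zero => simp [spaEdges]
  | succ t ih =>
    have hmem : ∀ (E' : Finset (ℕ × ℕ)) (e : ℕ × ℕ), MeasurableSet {ω : SPASpace m |
        e ∈ E' ∨ (e.1 = t + 1 ∧ (1 ≤ e.2 ∧ e.2 ≤ t) ∧
          ω.1 (t + 1) ∈ influenceSphere q A₁ A₂ ω.1 E' t e.2 ∧ ω.2 (t + 1, e.2) = true)} := by
      intro E' e
      have h1 : MeasurableSet {ω : SPASpace m |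
          ω.1 (t + 1) ∈ influenceSphere q A₁ A₂ ω.1 E' t e.2} := by
        have h2 := measurableSet_mem_ballOfVolume hm hq
          (influenceVolume_nonneg hA₁ hA₂ E' t e.2) (influenceVolume_le_one A₁ A₂ E' t e.2)
        have h3 : Measurable fun ω : SPASpace m => (ω.1 e.2, ω.1 (t + 1)) := by fun_prop
        exact h3 h2
      have h4 : MeasurableSet {ω : SPASpace m | ω.2 (t + 1, e.2) = true} := by
        have h5 : Measurable fun ω : SPASpace m => ω.2 (t + 1, e.2) := by fun_prop
        exact h5 (measurableSet_singleton true)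
      exact (MeasurableSet.const _).union ((MeasurableSet.const _).inter
        ((MeasurableSet.const _).inter (h1.inter h4)))
    -- With the previous graph fixed as `E'`, each possible arc is a condition on two positions and
    -- one coin, with a ball of constant volume.
    have hset : {ω : SPASpace m | spaEdges q A₁ A₂ ω.1 ω.2 (t + 1) = E}
        = ⋃ E' : Finset (ℕ × ℕ), {ω : SPASpace m | spaEdges q A₁ A₂ ω.1 ω.2 t = E'} ∩
          ⋂ e : ℕ × ℕ, {ω : SPASpace m | (e ∈ E' ∨ (e.1 = t + 1 ∧ (1 ≤ e.2 ∧ e.2 ≤ t) ∧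
            ω.1 (t + 1) ∈ influenceSphere q A₁ A₂ ω.1 E' t e.2 ∧ ω.2 (t + 1, e.2) = true))
              ↔ e ∈ E} := by
      ext ω
      simp only [Set.mem_iUnion, Set.mem_inter_iff, Set.mem_iInter, Set.mem_ofPred_eq]
      constructor
      · intro h
        refine ⟨_, rfl, fun e => ?_⟩
        rw [← mem_spaEdges_succ, h]
      · rintro ⟨E', rfl, h⟩
        ext e
        rw [mem_spaEdges_succ, h]
    rw [hset]
    refine MeasurableSet.iUnion fun E' => (ih E').inter (MeasurableSet.iInter fun e => ?_)
    by_cases he : e ∈ E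
    · simp only [he, iff_true]
      exact hmem E' e
    · simp only [he, iff_false]
      exact (hmem E' e).compl

theorem measurableSet_spaEdges {α : Type*} [MeasurableSpace α] (t : ℕ)
    (S : Finset (ℕ × ℕ) → Set (SPASpace m × α)) (hS : ∀ E, MeasurableSet (S E)) :
    MeasurableSet {z : SPASpace m × α | z ∈ S (spaEdges q A₁ A₂ z.1.1 z.1.2 t)} :=
  measurableSet_mem_of_countable (fun ω : SPASpace m => spaEdges q A₁ A₂ ω.1 ω.2 t)
    (measurableSet_spaEdges_eq hm hq hA₁ hA₂ t) S hS

theorem measurable_comp_spaEdges {β : Type*} [MeasurableSpace β] (t : ℕ)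
    (F : Finset (ℕ × ℕ) → β) :
    Measurable (fun ω : SPASpace m => F (spaEdges q A₁ A₂ ω.1 ω.2 t)) := by
  intro S _
  have : (fun ω : SPASpace m => F (spaEdges q A₁ A₂ ω.1 ω.2 t)) ⁻¹' S
      = ⋃ E ∈ F ⁻¹' S, {ω : SPASpace m | spaEdges q A₁ A₂ ω.1 ω.2 t = E} := by
    ext ω
    simp
  rw [this]
  exact MeasurableSet.biUnion (Set.to_countable _) fun E _ =>
    measurableSet_spaEdges_eq hm hq hA₁ hA₂ t E

theorem historyFun_comp_spaEdges (t : ℕ) (F : Finset (ℕ × ℕ) → ℝ)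
    (hF : ∃ C, ∀ ω : SPASpace m, |F (spaEdges q A₁ A₂ ω.1 ω.2 t)| ≤ C) :
    HistoryFun t (fun ω : SPASpace m => F (spaEdges q A₁ A₂ ω.1 ω.2 t)) :=
  ⟨measurable_comp_spaEdges hm hq hA₁ hA₂ t F, hF, fun ω ω' h => by rw [spaEdges_congr h]⟩

end Measurability

open Classical in
/-- One step of the process: the new vertex falls into a region determined by the past, and a link
trial is made. -/
theorem integral_region_step {m : ℕ} {p : I} {t u : ℕ} {f : SPASpace m → ℝ} (hf : HistoryFun t f)
    (S : SPASpace m → Set (Fin m → I))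
    (hS : MeasurableSet {z : SPASpace m × (Fin m → I) | z.2 ∈ S z.1})
    (hloc : ∀ ω ω', AgreeUpTo t ω ω' → S ω = S ω') (φ : Bool → ℝ) :
    ∫ ω, f ω * (if ω.1 (t + 1) ∈ S ω then 1 else 0) * φ (ω.2 (t + 1, u)) ∂(spaMeasure m p)
      = ((p : ℝ) * φ true + (1 - p) * φ false)
        * ∫ ω, f ω * volume.real (S ω) ∂(spaMeasure m p) := by
  obtain ⟨C, hC⟩ := hf.bdd
  rw [integral_step t u (fun ω y => f ω * (if y ∈ S ω then 1 else 0))]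
  · congr 2
    ext ω
    rw [integral_const_mul]
    congr 1
    have hSω : MeasurableSet (S ω) := measurable_prodMk_left hS
    rw [← integral_indicator_one hSω]
    refine integral_congr_ae (ae_of_all _ fun y => ?_)
    simp [Set.indicator]
  · exact (hf.meas.comp measurable_fst).mul (Measurable.ite hS measurable_const measurable_const)
  · refine ⟨C, fun ω y => ?_⟩
    rw [abs_mul]
    refine (mul_le_of_le_one_right (abs_nonneg _) ?_).trans (hC ω)
    split_ifs <;> simp
  · intro ω ω' y h
    simp only [hf.congr ω ω' h, hloc ω ω' h]

open Classical in
/-- The new vertex is unlikely to be in a small neighbourhood of an old one. -/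
theorem integral_mul_near_le {m : ℕ} {p : I} {t u : ℕ} (hu : u ≤ t) {f : SPASpace m → ℝ}
    (hf : HistoryFun t f) (hf0 : ∀ ω, 0 ≤ f ω) {R : (Fin m → I) → (Fin m → I) → Prop}
    (hR : MeasurableSet {z : (Fin m → I) × (Fin m → I) | R z.1 z.2}) {b : ℝ}
    (hb : ∀ c, volume.real {y | R c y} ≤ b) :
    ∫ ω, f ω * (if R (ω.1 u) (ω.1 (t + 1)) then 1 else 0) ∂(spaMeasure m p)
      ≤ b * ∫ ω, f ω ∂(spaMeasure m p) := by
  have h := integral_region_step (p := p) (u := u) hf (fun ω => {y | R (ω.1 u) y}) (by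
    have h3 : Measurable fun z : SPASpace m × (Fin m → I) => (z.1.1 u, z.2) := by fun_prop
    exact h3 hR) (fun ω ω' h => by simp only [h.1 u hu]) (fun _ => 1)
  simp only [mul_one, Set.mem_ofPred_eq, add_sub_cancel, one_mul] at h
  rw [h, ← integral_const_mul]
  refine integral_mono_of_nonneg (ae_of_all _ fun ω => by have := hf0 ω; positivity)
    (hf.integrable.const_mul b) (ae_of_all _ fun ω => ?_)
  simp only
  rw [mul_comm b]
  exact mul_le_mul_of_nonneg_left (hb _) (hf0 ω)

/-! ### Moments of the in-degrees -/

/-- The product `∏_{1 ≤ j < t} (1 + α / j)`, which is of order `t ^ α`. -/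
def growth (α : ℝ) (t : ℕ) : ℝ := ∏ j ∈ Finset.range t, (1 + α / (j : ℝ))

theorem growth_succ (α : ℝ) (t : ℕ) : growth α (t + 1) = growth α t * (1 + α / t) :=
  Finset.prod_range_succ _ _

theorem growth_pos {α : ℝ} (hα : 0 ≤ α) (t : ℕ) : 0 < growth α t :=
  Finset.prod_pos fun j _ => by positivity

theorem growth_mono {α : ℝ} (hα : 0 ≤ α) : Monotone (growth α) := by
  refine monotone_nat_of_le_succ fun t => ?_
  rw [growth_succ]
  refine le_mul_of_one_le_right (growth_pos hα t).le ?_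
  have : 0 ≤ α / t := by positivity
  linarith

/-- Bernoulli's inequality factor by factor: `(1 + 1/t)^α ≤ 1 + α/t`. -/
theorem rpow_le_growth {α : ℝ} (h0 : 0 ≤ α) (h1 : α ≤ 1) {t : ℕ} (ht : 1 ≤ t) :
    (t : ℝ) ^ α ≤ growth α t := by
  induction t, ht using Nat.le_induction with
  -- The factor `j = 0` is 1, since division by zero gives zero.
  | base => simp [growth]
  | succ t ht ih =>
    have htR : (0 : ℝ) < t := by exact_mod_cast ht
    rw [growth_succ]
    have h2 : ((t + 1 : ℕ) : ℝ) = t * (1 + 1 / t) := by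
      push_cast
      field_simp
    rw [h2, Real.mul_rpow htR.le (by positivity)]
    refine mul_le_mul ih ?_ (by positivity) (growth_pos h0 t).le
    have h3 := rpow_one_add_le_one_add_mul_self (s := 1 / (t : ℝ))
      (by have : (0:ℝ) ≤ 1 / (t : ℝ) := by positivity
          linarith) h0 h1
    refine h3.trans (le_of_eq ?_)
    ring

theorem growth_le {α : ℝ} (h0 : 0 ≤ α) (h1 : α ≤ 1) {t : ℕ} (ht : 1 ≤ t) :
    growth α t ≤ 2 * (t : ℝ) ^ α := by
  -- Shifting the index makes the new factor `1 + α/(t+1)`, which is at most `(1 + 1/t)^α` because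
  -- `1/(t+1) ≤ log (1 + 1/t)`. The first factor `1 + α ≤ 2` becomes the constant.
  have key : growth α (t + 1) ≤ (1 + α) * (t : ℝ) ^ α := by
    induction t, ht using Nat.le_induction with
    | base => simp [growth, Finset.prod_range_succ]
    | succ t ht ih =>
      have htR : (0 : ℝ) < t := by exact_mod_cast ht
      rw [growth_succ]
      have h2 : ((t + 1 : ℕ) : ℝ) ^ α = (t : ℝ) ^ α * (1 + 1 / t) ^ α := by
        rw [← Real.mul_rpow htR.le (by positivity)]
        congr 1
        push_cast
        field_simp
      rw [h2, ← mul_assoc]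
      refine mul_le_mul ih ?_ (by positivity) (by positivity)
      have h3 : α / ((t + 1 : ℕ) : ℝ) ≤ Real.log (1 + 1 / t) * α := by
        have h4 := Real.one_sub_inv_le_log_of_pos (show (0 : ℝ) < 1 + 1 / t by positivity)
        have h5 : 1 - (1 + 1 / (t : ℝ))⁻¹ = 1 / ((t + 1 : ℕ) : ℝ) := by
          push_cast
          field_simp
          ring
        rw [h5] at h4
        calc α / ((t + 1 : ℕ) : ℝ) = 1 / ((t + 1 : ℕ) : ℝ) * α := by ring
          _ ≤ _ := mul_le_mul_of_nonneg_right h4 h0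
      rw [Real.rpow_def_of_pos (by positivity)]
      have := Real.add_one_le_exp (Real.log (1 + 1 / (t : ℝ)) * α)
      linarith
  refine (growth_mono h0 (Nat.le_succ t)).trans (key.trans ?_)
  exact mul_le_mul_of_nonneg_right (by linarith) (by positivity)

theorem growth_div_growth_le {α : ℝ} (h0 : 0 ≤ α) (h1 : α ≤ 1) {s t : ℕ} (hs : 1 ≤ s)
    (ht : 1 ≤ t) : growth α t / growth α s ≤ 2 * ((t : ℝ) / s) ^ α := by
  have hsR : (0 : ℝ) < s := by exact_mod_cast hs
  rw [Real.div_rpow (by positivity) (by positivity), ← mul_div_assoc]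
  exact div_le_div₀ (by positivity) (growth_le h0 h1 ht) (by positivity) (rpow_le_growth h0 h1 hs)

/-- The indicator of the link from `t + 1` to `u`. -/
def link {m : ℕ} (q : ℝ≥0∞) (A₁ A₂ : ℝ) (t u : ℕ) (ω : SPASpace m) : ℝ :=
  if (t + 1, u) ∈ spaEdges q A₁ A₂ ω.1 ω.2 (t + 1) then 1 else 0

/-- The quantity `A₁ deg⁻(u,t) + A₂`. -/
def strength {m : ℕ} (q : ℝ≥0∞) (A₁ A₂ : ℝ) (t u : ℕ) (ω : SPASpace m) : ℝ :=
  A₁ * (inDegree (spaEdges q A₁ A₂ ω.1 ω.2 t) u : ℝ) + A₂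

/-- The volume of the sphere of influence of `u` at time `t`. -/
def sphereVolume {m : ℕ} (q : ℝ≥0∞) (A₁ A₂ : ℝ) (t u : ℕ) (ω : SPASpace m) : ℝ :=
  influenceVolume A₁ A₂ (spaEdges q A₁ A₂ ω.1 ω.2 t) t u

section Basic

variable {m : ℕ} {q : ℝ≥0∞} {A₁ A₂ : ℝ} {t u : ℕ} {ω : SPASpace m}

theorem link_nonneg : 0 ≤ link q A₁ A₂ t u ω := by unfold link; split_ifs <;> simp

theorem link_le_one : link q A₁ A₂ t u ω ≤ 1 := by unfold link; split_ifs <;> simp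

theorem strength_succ :
    strength q A₁ A₂ (t + 1) u ω = strength q A₁ A₂ t u ω + A₁ * link q A₁ A₂ t u ω := by
  unfold strength link
  rw [inDegree_succ]
  push_cast
  ring

theorem strength_eq (h : t ≤ u) : strength q A₁ A₂ t u ω = A₂ := by
  rw [strength, inDegree_eq_zero h]
  simp

theorem le_strength (hA₁ : 0 ≤ A₁) : A₂ ≤ strength q A₁ A₂ t u ω := by
  unfold strength
  have : 0 ≤ A₁ * (inDegree (spaEdges q A₁ A₂ ω.1 ω.2 t) u : ℝ) := by positivity
  linarith

theorem sphereVolume_le : sphereVolume q A₁ A₂ t u ω ≤ strength q A₁ A₂ t u ω / t :=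
  min_le_left _ _

theorem sphereVolume_nonneg (hA₁ : 0 ≤ A₁) (hA₂ : 0 ≤ A₂) : 0 ≤ sphereVolume q A₁ A₂ t u ω :=
  influenceVolume_nonneg hA₁ hA₂ _ _ _

theorem sphereVolume_le_one : sphereVolume q A₁ A₂ t u ω ≤ 1 := min_le_right _ _

end Basic

section Moments

variable {m : ℕ} (hm : 1 ≤ m) {q : ℝ≥0∞} (hq : 1 ≤ q) {A₁ A₂ : ℝ} (hA₁ : 0 ≤ A₁) (hA₂ : 0 ≤ A₂)
include hm hq hA₁ hA₂

theorem historyFun_strength (t u : ℕ) :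
    HistoryFun t (strength q A₁ A₂ t u : SPASpace m → ℝ) := by
  refine historyFun_comp_spaEdges hm hq hA₁ hA₂ t (fun E => A₁ * (inDegree E u : ℝ) + A₂)
    ⟨A₁ * t + A₂, fun ω => ?_⟩
  rw [abs_of_nonneg (by positivity)]
  have : (inDegree (spaEdges q A₁ A₂ ω.1 ω.2 t) u : ℝ) ≤ t := by exact_mod_cast inDegree_le t u
  gcongr

theorem historyFun_sphereVolume (t u : ℕ) :
    HistoryFun t (sphereVolume q A₁ A₂ t u : SPASpace m → ℝ) := by
  refine historyFun_comp_spaEdges hm hq hA₁ hA₂ t (fun E => influenceVolume A₁ A₂ E t u)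
    ⟨1, fun ω => ?_⟩
  rw [abs_of_nonneg (influenceVolume_nonneg hA₁ hA₂ _ _ _)]
  exact influenceVolume_le_one _ _ _ _ _

theorem historyFun_link (t u : ℕ) : HistoryFun (t + 1) (link q A₁ A₂ t u : SPASpace m → ℝ) := by
  refine historyFun_comp_spaEdges hm hq hA₁ hA₂ (t + 1) (fun E => if (t + 1, u) ∈ E then 1 else 0)
    ⟨1, fun ω => ?_⟩
  split_ifs <;> simp

theorem measurableSet_influenceSphere (t u : ℕ) :
    MeasurableSet {z : SPASpace m × (Fin m → I) |
      z.2 ∈ influenceSphere q A₁ A₂ z.1.1 (spaEdges q A₁ A₂ z.1.1 z.1.2 t) t u} := by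
  refine measurableSet_spaEdges hm hq hA₁ hA₂ t
    (fun E => {z : SPASpace m × (Fin m → I) | z.2 ∈ influenceSphere q A₁ A₂ z.1.1 E t u})
    fun E => ?_
  have h2 := measurableSet_mem_ballOfVolume hm hq
    (influenceVolume_nonneg hA₁ hA₂ E t u) (influenceVolume_le_one A₁ A₂ E t u)
  have h3 : Measurable fun z : SPASpace m × (Fin m → I) => (z.1.1 u, z.2) := by fun_prop
  exact h3 h2

/-- Given the history, the link appears with probability exactly `p` times the volume of the sphere.
-/
theorem integral_mul_link {p : I} {t u : ℕ} (hu1 : 1 ≤ u) (hut : u ≤ t) {f : SPASpace m → ℝ}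
    (hf : HistoryFun t f) :
    ∫ ω, f ω * link q A₁ A₂ t u ω ∂(spaMeasure m p)
      = p * ∫ ω, f ω * sphereVolume q A₁ A₂ t u ω ∂(spaMeasure m p) := by
  classical
  have h := integral_region_step (p := p) (u := u) hf
    (fun ω => influenceSphere q A₁ A₂ ω.1 (spaEdges q A₁ A₂ ω.1 ω.2 t) t u)
    (measurableSet_influenceSphere hm hq hA₁ hA₂ t u)
    (fun ω ω' h => by
      rw [spaEdges_congr h]
      unfold influenceSphere
      rw [h.1 u hut]) (fun b => if b = true then 1 else 0)
  simp only [if_true, mul_one, Bool.false_eq_true, if_false, mul_zero, add_zero] at h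
  have hvol : ∀ ω : SPASpace m, volume.real
      (influenceSphere q A₁ A₂ ω.1 (spaEdges q A₁ A₂ ω.1 ω.2 t) t u)
        = sphereVolume q A₁ A₂ t u ω := fun ω =>
    volume_ballOfVolume hm hq _ (influenceVolume_nonneg hA₁ hA₂ _ _ _)
      (influenceVolume_le_one _ _ _ _ _)
  simp_rw [hvol] at h
  rw [← h]
  refine integral_congr_ae (ae_of_all _ fun ω => ?_)
  simp only [link, mem_spaEdges_succ_self hu1 hut, ite_and]
  split_ifs <;> simp

theorem integral_mul_link_le {p : I} {t u : ℕ} (hu1 : 1 ≤ u) (hut : u ≤ t) {f : SPASpace m → ℝ}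
    (hf : HistoryFun t f) (hf0 : ∀ ω, 0 ≤ f ω) :
    ∫ ω, f ω * link q A₁ A₂ t u ω ∂(spaMeasure m p)
      ≤ p / t * ∫ ω, f ω * strength q A₁ A₂ t u ω ∂(spaMeasure m p) := by
  rw [integral_mul_link hm hq hA₁ hA₂ hu1 hut hf, div_mul_eq_mul_div, mul_div_assoc,
    ← integral_div]
  refine mul_le_mul_of_nonneg_left ?_ p.2.1
  refine integral_mono (hf.mul (historyFun_sphereVolume hm hq hA₁ hA₂ t u)).integrable
    ((hf.mul (historyFun_strength hm hq hA₁ hA₂ t u)).integrable.div_const _) fun ω => ?_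
  simp only
  rw [mul_div_assoc]
  exact mul_le_mul_of_nonneg_left sphereVolume_le (hf0 ω)

/-- Growth of the first moment. -/
theorem integral_mul_strength_le {p : I} {s t u : ℕ} (hu1 : 1 ≤ u) (hus : u ≤ s) (hst : s ≤ t)
    {f : SPASpace m → ℝ} (hf : HistoryFun s f) (hf0 : ∀ ω, 0 ≤ f ω) :
    ∫ ω, f ω * strength q A₁ A₂ t u ω ∂(spaMeasure m p)
      ≤ growth (p * A₁) t / growth (p * A₁) s
        * ∫ ω, f ω * strength q A₁ A₂ s u ω ∂(spaMeasure m p) := by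
  have hα : 0 ≤ (p : ℝ) * A₁ := mul_nonneg p.2.1 hA₁
  induction t, hst using Nat.le_induction with
  | base => rw [div_self (growth_pos hα s).ne', one_mul]
  | succ t hst ih =>
    have hft := hf.mono hst
    have h1 : ∫ ω, f ω * strength q A₁ A₂ (t + 1) u ω ∂(spaMeasure m p)
        = ∫ ω, f ω * strength q A₁ A₂ t u ω ∂(spaMeasure m p)
          + A₁ * ∫ ω, f ω * link q A₁ A₂ t u ω ∂(spaMeasure m p) := by
      rw [← integral_const_mul, ← integral_add
        (hft.mul (historyFun_strength hm hq hA₁ hA₂ t u)).integrable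
        (((hft.mono (Nat.le_succ t)).mul
          (historyFun_link hm hq hA₁ hA₂ t u)).integrable.const_mul A₁)]
      refine integral_congr_ae (ae_of_all _ fun ω => ?_)
      simp only [strength_succ]
      ring
    have h2 := integral_mul_link_le (p := p) hm hq hA₁ hA₂ hu1 (hus.trans hst) hft hf0
    rw [h1, growth_succ]
    calc _ ≤ ∫ ω, f ω * strength q A₁ A₂ t u ω ∂(spaMeasure m p)
          + A₁ * (p / t * ∫ ω, f ω * strength q A₁ A₂ t u ω ∂(spaMeasure m p)) := by gcongr
      _ = (1 + p * A₁ / t) * ∫ ω, f ω * strength q A₁ A₂ t u ω ∂(spaMeasure m p) := by ring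
      _ ≤ (1 + p * A₁ / t) * (growth (p * A₁) t / growth (p * A₁) s
        * ∫ ω, f ω * strength q A₁ A₂ s u ω ∂(spaMeasure m p)) := by gcongr
      _ = _ := by ring

/-- Growth of the second and mixed moments. -/
theorem integral_mul_strength_mul_strength_le {p : I} {s t u v : ℕ} (hu1 : 1 ≤ u) (hv1 : 1 ≤ v)
    (hus : u ≤ s) (hvs : v ≤ s) (hst : s ≤ t)
    {f : SPASpace m → ℝ} (hf : HistoryFun s f) (hf0 : ∀ ω, 0 ≤ f ω) :
    ∫ ω, f ω * ((strength q A₁ A₂ t u ω + A₁) * strength q A₁ A₂ t v ω) ∂(spaMeasure m p)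
      ≤ (growth (p * A₁) t / growth (p * A₁) s) ^ 2
        * ∫ ω, f ω * ((strength q A₁ A₂ s u ω + A₁) * strength q A₁ A₂ s v ω)
          ∂(spaMeasure m p) := by
  have hα : 0 ≤ (p : ℝ) * A₁ := mul_nonneg p.2.1 hA₁
  induction t, hst using Nat.le_induction with
  | base => rw [div_self (growth_pos hα s).ne', one_pow, one_mul]
  | succ t hst ih =>
    set Φ := ∫ ω, f ω * ((strength q A₁ A₂ t u ω + A₁) * strength q A₁ A₂ t v ω)
      ∂(spaMeasure m p) with hΦ
    have hft := hf.mono hst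
    have hWu := historyFun_strength hm hq hA₁ hA₂ (m := m) (q := q) t u
    have hWv := historyFun_strength hm hq hA₁ hA₂ (m := m) (q := q) t v
    have hLu := historyFun_link hm hq hA₁ hA₂ (m := m) (q := q) t u
    have hLv := historyFun_link hm hq hA₁ hA₂ (m := m) (q := q) t v
    have hft' := hft.mono (Nat.le_succ t)
    have hW0 : ∀ w ω, 0 ≤ strength q A₁ A₂ t w (ω : SPASpace m) :=
      fun w ω => hA₂.trans (le_strength hA₁)
    have hg1 := hft.mul hWv
    have hg2 := hft.mul (hWu.add_const (2 * A₁))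
    have hg0 := hft.mul ((hWu.add_const A₁).mul hWv)
    have hi1 := (hg1.mono (Nat.le_succ t)).mul hLu
    have hi2 := (hg2.mono (Nat.le_succ t)).mul hLv
    have hsum : Integrable (fun ω => f ω * ((strength q A₁ A₂ t u ω + A₁) * strength q A₁ A₂ t v ω)
        + A₁ * (f ω * strength q A₁ A₂ t v ω * link q A₁ A₂ t u ω)) (spaMeasure m p) :=
      hg0.integrable.add (hi1.integrable.const_mul A₁)
    -- The two links share the position of the new vertex and are dependent, or equal if `u = v`.
    -- Their product is bounded by the link to `v` alone, which turns the shift `A₁` into `2 A₁`.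
    have h1 : ∫ ω, f ω * ((strength q A₁ A₂ (t + 1) u ω + A₁) * strength q A₁ A₂ (t + 1) v ω)
          ∂(spaMeasure m p)
        ≤ Φ + A₁ * ∫ ω, f ω * strength q A₁ A₂ t v ω * link q A₁ A₂ t u ω ∂(spaMeasure m p)
          + A₁ * ∫ ω, f ω * (strength q A₁ A₂ t u ω + 2 * A₁) * link q A₁ A₂ t v ω
            ∂(spaMeasure m p) := by
      rw [hΦ, ← integral_const_mul, ← integral_const_mul, ← integral_add hg0.integrable
        (hi1.integrable.const_mul A₁), ← integral_add hsum (hi2.integrable.const_mul A₁)]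
      refine integral_mono (hft'.mul (((historyFun_strength hm hq hA₁ hA₂ (t + 1) u).add_const A₁).mul
        (historyFun_strength hm hq hA₁ hA₂ (t + 1) v))).integrable (hsum.add (hi2.integrable.const_mul A₁)) fun ω => ?_
      simp only [strength_succ]
      have hx0 := link_nonneg (q := q) (A₁ := A₁) (A₂ := A₂) (t := t) (u := u) (ω := ω)
      have hy0 := link_nonneg (q := q) (A₁ := A₁) (A₂ := A₂) (t := t) (u := v) (ω := ω)
      have hx1 := link_le_one (q := q) (A₁ := A₁) (A₂ := A₂) (t := t) (u := u) (ω := ω)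
      generalize link q A₁ A₂ t u ω = x at *
      generalize link q A₁ A₂ t v ω = y at *
      have h3 : f ω * (A₁ ^ 2 * (x * y)) ≤ f ω * (A₁ ^ 2 * (1 * y)) := by
        have := hf0 ω
        gcongr
      nlinarith [h3]
    have h2 := integral_mul_link_le (p := p) hm hq hA₁ hA₂ hu1 (hus.trans hst) hg1
      (fun ω => mul_nonneg (hf0 ω) (hW0 v ω))
    have h3 := integral_mul_link_le (p := p) hm hq hA₁ hA₂ hv1 (hvs.trans hst) hg2
      (fun ω => mul_nonneg (hf0 ω) (by have := hW0 u ω; positivity))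
    -- The shift by `A₁` in the statement is the one for which both drift terms add up to a multiple
    -- of the same quantity `Φ`.
    have h4 : ∫ ω, f ω * strength q A₁ A₂ t v ω * strength q A₁ A₂ t u ω ∂(spaMeasure m p)
        + ∫ ω, f ω * (strength q A₁ A₂ t u ω + 2 * A₁) * strength q A₁ A₂ t v ω ∂(spaMeasure m p)
        = 2 * Φ := by
      rw [hΦ, ← integral_const_mul, ← integral_add (hg1.mul hWu).integrable
        (hg2.mul hWv).integrable]
      refine integral_congr_ae (ae_of_all _ fun ω => ?_)
      simp only
      ring
    rw [growth_succ]
    have hΦ0 : 0 ≤ Φ := integral_nonneg fun ω => by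
      have := hf0 ω
      have := hW0 u ω
      have := hW0 v ω
      positivity
    calc _ ≤ Φ + A₁ * (p / t *
            ∫ ω, f ω * strength q A₁ A₂ t v ω * strength q A₁ A₂ t u ω ∂(spaMeasure m p))
          + A₁ * (p / t * ∫ ω, f ω * (strength q A₁ A₂ t u ω + 2 * A₁)
            * strength q A₁ A₂ t v ω ∂(spaMeasure m p)) := by
          refine h1.trans ?_
          gcongr
      _ = Φ + A₁ * (p / t) * (2 * Φ) := by rw [← h4]; ring
      _ ≤ (1 + p * A₁ / t) ^ 2 * Φ := by
          have : 0 ≤ (p * A₁ / t) ^ 2 * Φ := by positivity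
          have h5 : (1 + p * A₁ / t) ^ 2 * Φ
              = Φ + A₁ * (p / t) * (2 * Φ) + (p * A₁ / t) ^ 2 * Φ := by ring
          linarith
      _ ≤ (1 + p * A₁ / t) ^ 2 * ((growth (p * A₁) t / growth (p * A₁) s) ^ 2
        * ∫ ω, f ω * ((strength q A₁ A₂ s u ω + A₁) * strength q A₁ A₂ s v ω)
          ∂(spaMeasure m p)) := by gcongr
      _ = _ := by ring

theorem integral_strength_le {p : I} {t u : ℕ} (hu1 : 1 ≤ u) (hut : u ≤ t) :
    ∫ ω, strength q A₁ A₂ t u ω ∂(spaMeasure m p)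
      ≤ A₂ * (growth (p * A₁) t / growth (p * A₁) u) := by
  have h := integral_mul_strength_le (p := p) hm hq hA₁ hA₂ hu1 le_rfl hut
    (HistoryFun.const u 1) (fun _ => zero_le_one)
  simp only [one_mul, strength_eq le_rfl] at h
  simpa [mul_comm] using h

theorem integral_strength_sq_le {p : I} {t u : ℕ} (hu1 : 1 ≤ u) (hut : u ≤ t) :
    ∫ ω, strength q A₁ A₂ t u ω ^ 2 ∂(spaMeasure m p)
      ≤ (A₂ + A₁) * A₂ * (growth (p * A₁) t / growth (p * A₁) u) ^ 2 := by
  have h := integral_mul_strength_mul_strength_le (p := p) hm hq hA₁ hA₂ hu1 hu1 le_rfl le_rfl hut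
    (HistoryFun.const u 1) (fun _ => zero_le_one)
  simp only [one_mul, strength_eq le_rfl] at h
  have hW := historyFun_strength hm hq hA₁ hA₂ (m := m) (q := q) t u
  refine le_trans (integral_mono ?_ ((hW.add_const A₁).mul hW).integrable fun ω => ?_) (h.trans ?_)
  · simp_rw [sq]
    exact (hW.mul hW).integrable
  · have : 0 ≤ strength q A₁ A₂ t u ω := hA₂.trans (le_strength hA₁)
    simp only
    nlinarith
  · simp [mul_comm]

open Classical in
/-- The mixed second moment of the in-degrees of two vertices that are near each other. -/
theorem integral_near_mul_strength_le {p : I} {n u v : ℕ} (hu1 : 1 ≤ u) (huv : u < v) (hvn : v ≤ n)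
    {R : (Fin m → I) → (Fin m → I) → Prop}
    (hR : MeasurableSet {z : (Fin m → I) × (Fin m → I) | R z.1 z.2}) {b : ℝ}
    (hb0 : 0 ≤ b) (hb : ∀ c, volume.real {y | R c y} ≤ b) :
    ∫ ω, (if R (ω.1 u) (ω.1 v) then 1 else 0)
        * (strength q A₁ A₂ n u ω * strength q A₁ A₂ n v ω) ∂(spaMeasure m p)
      ≤ (A₂ + 2 * A₁) * A₂ * b * ((growth (p * A₁) n / growth (p * A₁) u)
        * (growth (p * A₁) n / growth (p * A₁) v)) := by
  have hα : 0 ≤ (p : ℝ) * A₁ := mul_nonneg p.2.1 hA₁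
  -- Nearness is decided at the birth of `v = t + 1`; the moment recursion takes over from that
  -- time.
  obtain ⟨t, rfl⟩ : ∃ t, v = t + 1 := ⟨v - 1, by omega⟩
  have hut : u ≤ t := by omega
  set ind : SPASpace m → ℝ := fun ω => if R (ω.1 u) (ω.1 (t + 1)) then 1 else 0 with hind
  have hadind : HistoryFun (t + 1) ind := by
    refine HistoryFun.ite ?_ fun ω ω' h => by rw [h.1 u (by omega), h.1 (t + 1) le_rfl]
    have h3 : Measurable fun ω : SPASpace m => (ω.1 u, ω.1 (t + 1)) := by fun_prop
    exact h3 hR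
  have hind0 : ∀ ω, 0 ≤ ind ω := fun ω => by
    simp only [hind]; split_ifs <;> simp
  have hW0 : ∀ s w ω, 0 ≤ strength q A₁ A₂ s w (ω : SPASpace m) :=
    fun s w ω => hA₂.trans (le_strength hA₁)
  have hWu := historyFun_strength hm hq hA₁ hA₂ (m := m) (q := q) t u
  have hWun := historyFun_strength hm hq hA₁ hA₂ (m := m) (q := q) n u
  have hWvn := historyFun_strength hm hq hA₁ hA₂ (m := m) (q := q) n (t + 1)
  have h1 := integral_mul_strength_mul_strength_le (p := p) (v := t + 1) hm hq hA₁ hA₂ hu1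
    (by omega) (by omega) le_rfl hvn hadind hind0
  have h2 : ∫ ω, ind ω * ((strength q A₁ A₂ (t + 1) u ω + A₁)
        * strength q A₁ A₂ (t + 1) (t + 1) ω) ∂(spaMeasure m p)
      ≤ A₂ * (b * (A₂ * (growth (p * A₁) t / growth (p * A₁) u) + 2 * A₁)) := by
    calc _ ≤ ∫ ω, A₂ * ((strength q A₁ A₂ t u ω + 2 * A₁) * ind ω) ∂(spaMeasure m p) := by
          refine integral_mono (hadind.mul (((historyFun_strength hm hq hA₁ hA₂ (t + 1) u).add_const
            A₁).mul (historyFun_strength hm hq hA₁ hA₂ (t + 1) (t + 1)))).integrable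
            ((((hWu.add_const (2 * A₁)).mono (Nat.le_succ t)).mul hadind).integrable.const_mul A₂)
            fun ω => ?_
          simp only
          -- At its birth `v` has strength `A₂`. Bounding the link from `v` to `u` by 1 leaves only
          -- the strength of `u` at time `t`, which does not involve the position of `v`.
          rw [strength_eq le_rfl, strength_succ]
          have h3 := mul_le_mul_of_nonneg_left (link_le_one (q := q) (A₁ := A₁) (A₂ := A₂) (t := t)
            (u := u) (ω := ω)) hA₁
          have h4 : 0 ≤ ind ω * A₂ := mul_nonneg (hind0 ω) hA₂
          nlinarith [mul_le_mul_of_nonneg_left h3 h4]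
      _ ≤ A₂ * (b * ∫ ω, (strength q A₁ A₂ t u ω + 2 * A₁) ∂(spaMeasure m p)) := by
          rw [integral_const_mul]
          refine mul_le_mul_of_nonneg_left ?_ hA₂
          exact integral_mul_near_le hut (hWu.add_const (2 * A₁))
            (fun ω => by have := hW0 t u ω; positivity) hR hb
      _ ≤ _ := by
          rw [integral_add hWu.integrable (integrable_const _)]
          simp only [integral_const, probReal_univ, smul_eq_mul, one_mul]
          have := integral_strength_le (p := p) hm hq hA₁ hA₂ hu1 hut
          gcongr
  have h5 : A₂ * (growth (p * A₁) t / growth (p * A₁) u) + 2 * A₁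
      ≤ (A₂ + 2 * A₁) * (growth (p * A₁) (t + 1) / growth (p * A₁) u) := by
    have hg := growth_pos hα u
    have h6 : growth (p * A₁) t / growth (p * A₁) u ≤ growth (p * A₁) (t + 1) / growth (p * A₁) u :=
      div_le_div_of_nonneg_right (growth_mono hα (Nat.le_succ t)) hg.le
    have h7 : 1 ≤ growth (p * A₁) (t + 1) / growth (p * A₁) u := by
      rw [le_div_iff₀ hg, one_mul]
      exact growth_mono hα (by omega)
    nlinarith [mul_le_mul_of_nonneg_left h6 hA₂, mul_le_mul_of_nonneg_left h7 hA₁]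
  calc _ ≤ ∫ ω, ind ω * ((strength q A₁ A₂ n u ω + A₁) * strength q A₁ A₂ n (t + 1) ω)
        ∂(spaMeasure m p) := by
        refine integral_mono ((hadind.mono hvn).mul (hWun.mul hWvn)).integrable
          ((hadind.mono hvn).mul ((hWun.add_const A₁).mul hWvn)).integrable fun ω => ?_
        have := hind0 ω
        have := hW0 n u ω
        have := hW0 n (t + 1) ω
        simp only
        gcongr
        linarith
    _ ≤ (growth (p * A₁) n / growth (p * A₁) (t + 1)) ^ 2 * (A₂ * (b *
        ((A₂ + 2 * A₁) * (growth (p * A₁) (t + 1) / growth (p * A₁) u)))) := by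
        refine h1.trans (mul_le_mul_of_nonneg_left (h2.trans ?_) (by positivity))
        gcongr
    _ = _ := by
        have := (growth_pos hα (t + 1)).ne'
        have := (growth_pos hα u).ne'
        field_simp

end Moments

/-! ### The number of edges -/

theorem sum_spaEdges {m : ℕ} {q : ℝ≥0∞} {A₁ A₂ : ℝ} (ω : SPASpace m) (n : ℕ) (F : ℕ × ℕ → ℝ) :
    ∑ e ∈ spaEdges q A₁ A₂ ω.1 ω.2 n, F e
      = ∑ t ∈ Finset.range n, ∑ u ∈ Finset.Icc 1 t, link q A₁ A₂ t u ω * F (t + 1, u) := by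
  classical
  induction n with
  | zero => simp [spaEdges]
  | succ n ih =>
    rw [Finset.sum_range_succ, ← ih]
    have hset : spaEdges q A₁ A₂ ω.1 ω.2 (n + 1) = spaEdges q A₁ A₂ ω.1 ω.2 n
        ∪ ((Finset.Icc 1 n).filter fun u => (n + 1, u) ∈ spaEdges q A₁ A₂ ω.1 ω.2 (n + 1)).image
          (fun u => (n + 1, u)) := by
      ext e
      rw [Finset.mem_union, Finset.mem_image]
      constructor
      · intro he
        have hb := bounds_of_mem_spaEdges he
        rcases Nat.lt_or_ge n e.1 with h | h
        · right
          obtain ⟨s, u⟩ := e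
          simp only at hb h
          obtain rfl : s = n + 1 := by omega
          exact ⟨u, Finset.mem_filter.2 ⟨Finset.mem_Icc.2 (by omega), he⟩, rfl⟩
        · exact Or.inl ((mem_spaEdges_of_le (Nat.le_succ n) h).1 he)
      · rintro (he | ⟨u, hu, rfl⟩)
        · exact (mem_spaEdges_of_le (Nat.le_succ n) (bounds_of_mem_spaEdges he).2.2).2 he
        · exact (Finset.mem_filter.1 hu).2
    rw [hset, Finset.sum_union]
    · congr 1
      rw [Finset.sum_image (fun a _ b _ h => (Prod.mk.inj h).2), Finset.sum_filter]
      refine Finset.sum_congr rfl fun u _ => ?_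
      unfold link
      split_ifs <;> simp
    · rw [Finset.disjoint_right]
      intro e he he'
      obtain ⟨u, _, rfl⟩ := Finset.mem_image.1 he
      have := bounds_of_mem_spaEdges he'
      simp at this

theorem card_spaEdges {m : ℕ} {q : ℝ≥0∞} {A₁ A₂ : ℝ} (ω : SPASpace m) (n : ℕ) :
    ((spaEdges q A₁ A₂ ω.1 ω.2 n).card : ℝ)
      = ∑ t ∈ Finset.range n, ∑ u ∈ Finset.Icc 1 t, link q A₁ A₂ t u ω := by
  have := sum_spaEdges (q := q) (A₁ := A₁) (A₂ := A₂) ω n (fun _ => 1)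
  simpa using this

open Classical in
/-- The indicator of a successful trial between `t + 1` and `u` when `t + 1` lies in the ball of
volume `V` around `u`. -/
def ballLink {m : ℕ} (q : ℝ≥0∞) (V : ℝ) (t u : ℕ) (ω : SPASpace m) : ℝ :=
  (if ω.1 (t + 1) ∈ ballOfVolume q (ω.1 u) V then 1 else 0)
    * (if ω.2 (t + 1, u) = true then 1 else 0)

/-! ### Links through balls of a fixed volume: a lower bound without feedback. -/

section BallLink

variable {m : ℕ} {q : ℝ≥0∞} {V : ℝ} {t u : ℕ} {ω : SPASpace m}

theorem ballLink_nonneg : 0 ≤ ballLink q V t u ω := by unfold ballLink; split_ifs <;> simp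

theorem ballLink_le_one : ballLink q V t u ω ≤ 1 := by unfold ballLink; split_ifs <;> simp

variable (hm : 1 ≤ m) (hq : 1 ≤ q) (hV0 : 0 ≤ V) (hV1 : V ≤ 1)
include hm hq

/-- In-degrees only enlarge a sphere beyond volume `min (A₂/t) 1`, so a ball of smaller volume lies
inside it, and both use the same coin. -/
theorem ballLink_le_link {A₁ A₂ : ℝ} (hA₁ : 0 ≤ A₁) (hA₂ : 0 ≤ A₂) (hu1 : 1 ≤ u) (hut : u ≤ t)
    (hV1 : V ≤ 1) (hVt : V ≤ A₂ / t) : ballLink q V t u ω ≤ link q A₁ A₂ t u ω := by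
  have hV : V ≤ influenceVolume A₁ A₂ (spaEdges q A₁ A₂ ω.1 ω.2 t) t u := by
    refine le_min (hVt.trans ?_) hV1
    refine div_le_div_of_nonneg_right ?_ (by positivity)
    exact le_strength (q := q) (t := t) (u := u) (ω := ω) hA₁
  have hsub := ballOfVolume_mono hm hq (ω.1 u) (influenceVolume_nonneg hA₁ hA₂ _ _ _) hV
    (influenceVolume_le_one A₁ A₂ (spaEdges q A₁ A₂ ω.1 ω.2 t) t u)
  by_cases hE : (t + 1, u) ∈ spaEdges q A₁ A₂ ω.1 ω.2 (t + 1)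
  · exact ballLink_le_one.trans_eq (if_pos hE).symm
  · refine le_trans (le_of_eq ?_) link_nonneg
    rw [mem_spaEdges_succ_self hu1 hut, not_and] at hE
    unfold ballLink
    by_cases h1 : ω.1 (t + 1) ∈ ballOfVolume q (ω.1 u) V
    · rw [if_neg (hE (hsub h1)), mul_zero]
    · rw [if_neg h1, zero_mul]

include hV0 hV1

theorem historyFun_ballLink (hut : u ≤ t) :
    HistoryFun (t + 1) (ballLink q V t u : SPASpace m → ℝ) := by
  classical
  refine HistoryFun.mul (HistoryFun.ite ?_ fun ω ω' h => ?_) (HistoryFun.ite ?_ fun ω ω' h => ?_)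
  · have h3 : Measurable fun ω : SPASpace m => (ω.1 u, ω.1 (t + 1)) := by fun_prop
    exact h3 (measurableSet_mem_ballOfVolume hm hq hV0 hV1)
  · rw [h.1 u (by omega), h.1 (t + 1) le_rfl]
  · have h5 : Measurable fun ω : SPASpace m => ω.2 (t + 1, u) := by fun_prop
    exact h5 (measurableSet_singleton true)
  · rw [h.2 (t + 1, u) le_rfl]

theorem integral_mul_ballLink {p : I} (hut : u ≤ t) {f : SPASpace m → ℝ} (hf : HistoryFun t f) :
    ∫ ω, f ω * ballLink q V t u ω ∂(spaMeasure m p) = p * V * ∫ ω, f ω ∂(spaMeasure m p) := by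
  classical
  have h := integral_region_step (p := p) (u := u) hf
    (fun ω => ballOfVolume q (ω.1 u) V) (by
      have h3 : Measurable fun z : SPASpace m × (Fin m → I) => (z.1.1 u, z.2) := by fun_prop
      exact h3 (measurableSet_mem_ballOfVolume hm hq hV0 hV1))
    (fun ω ω' h => by rw [h.1 u hut]) (fun b => if b = true then 1 else 0)
  simp only [if_true, mul_one, Bool.false_eq_true, if_false, mul_zero, add_zero,
    volume_ballOfVolume hm hq _ hV0 hV1] at h
  rw [integral_mul_const] at h
  rw [mul_assoc, mul_comm V, ← h]
  refine integral_congr_ae (ae_of_all _ fun ω => ?_)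
  simp only [ballLink, mul_assoc]

/-- If the new vertex is close to two old ones, these are close to each other. -/
theorem ballLink_mul_ballLink_le {v : ℕ} [Decidable
    (∀ i, Nearby (2 * (m * V ^ (1 / (m : ℝ)))) (ω.1 u i) (ω.1 v i))] :
    ballLink q V t u ω * ballLink q V t v ω
      ≤ (if ∀ i, Nearby (2 * (m * V ^ (1 / (m : ℝ)))) (ω.1 u i) (ω.1 v i) then 1 else 0)
        * ballLink q V t u ω := by
  split_ifs with h
  · rw [one_mul]
    exact mul_le_of_le_one_right ballLink_nonneg ballLink_le_one
  · rw [zero_mul]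
    refine le_of_eq ?_
    by_contra hne
    refine h fun i => ?_
    have h1 : ω.1 (t + 1) ∈ ballOfVolume q (ω.1 u) V := by
      by_contra h2
      exact hne (by simp [ballLink, h2])
    have h2 : ω.1 (t + 1) ∈ ballOfVolume q (ω.1 v) V := by
      by_contra h2
      exact hne (by simp [ballLink, h2])
    obtain ⟨w, hw⟩ := nearby_of_mem_ballOfVolume hm hq hV0 hV1 h1 i
    obtain ⟨w', hw'⟩ := nearby_of_mem_ballOfVolume hm hq hV0 hV1 h2 i
    refine ⟨(w : ℤ) - (w' : ℤ), ?_, ?_⟩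
    · cases w <;> cases w' <;> decide
    · have h3 : ((((w : ℤ) - (w' : ℤ) : ℤ)) : ℝ) = (w : ℝ) - (w' : ℝ) := by
        push_cast
        rfl
      rw [h3]
      rw [abs_le] at *
      constructor <;> linarith [hw.1, hw.2, hw'.1, hw'.2]

/-- Winning both trials forces `u` and `v` to be close, an event of probability `O(V)` decided
before time `t + 1`; the trial at `u` then contributes `p V`. -/
theorem integral_ballLink_mul_ballLink_le {p : I} {v : ℕ} (hu1 : 1 ≤ u) (huv : u < v)
    (hvt : v ≤ t) :
    ∫ ω, ballLink q V t u ω * ballLink q V t v ω ∂(spaMeasure m p)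
      ≤ p * V * ((20 * m) ^ m * V) := by
  classical
  set δ := 2 * (m * V ^ (1 / (m : ℝ))) with hδ
  have hδ0 : 0 ≤ δ := by positivity
  have hR : MeasurableSet {z : (Fin m → I) × (Fin m → I) | ∀ i, Nearby δ (z.1 i) (z.2 i)} := by
    have : {z : (Fin m → I) × (Fin m → I) | ∀ i, Nearby δ (z.1 i) (z.2 i)}
        = ⋂ i, (fun z : (Fin m → I) × (Fin m → I) => (z.1 i, z.2 i)) ⁻¹'
          {z : I × I | Nearby δ z.1 z.2} := by
      ext z; simp
    rw [this]
    refine MeasurableSet.iInter fun i => ?_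
    have h3 : Measurable fun z : (Fin m → I) × (Fin m → I) => (z.1 i, z.2 i) := by fun_prop
    exact h3 (measurableSet_nearby δ)
  set ind : SPASpace m → ℝ := fun ω => if ∀ i, Nearby δ (ω.1 u i) (ω.1 v i) then 1 else 0
    with hind
  have hadind : HistoryFun v ind := by
    refine HistoryFun.ite (P := fun ω : SPASpace m => ∀ i, Nearby δ (ω.1 u i) (ω.1 v i)) ?_
      fun ω ω' h => by rw [h.1 u huv.le, h.1 v le_rfl]
    have h3 : Measurable fun ω : SPASpace m => (ω.1 u, ω.1 v) := by fun_prop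
    exact h3 hR
  have hb : ∀ c : Fin m → I, volume.real {y : Fin m → I | ∀ i, Nearby δ (c i) (y i)}
      ≤ (20 * m) ^ m * V := by
    intro c
    have h1 := volume_forall_nearby_le c hδ0
    -- The radius bound scales as `V^(1/m)`, so its `m`-th power returns `V`.
    have h2 : (10 * δ) ^ m = (20 * m) ^ m * V := by
      rw [hδ]
      have : V = (V ^ (1 / (m : ℝ))) ^ m := by
        rw [one_div, Real.rpow_inv_natCast_pow hV0 (by omega)]
      conv_rhs => rw [this]
      rw [← mul_pow]
      congr 1
      ring
    rw [h2] at h1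
    exact ENNReal.toReal_le_of_le_ofReal (by positivity) h1
  have h1 : ∫ ω, ind ω ∂(spaMeasure m p) ≤ (20 * m) ^ m * V := by
    obtain ⟨s, rfl⟩ : ∃ s, v = s + 1 := ⟨v - 1, by omega⟩
    have := integral_mul_near_le (p := p) (u := u) (t := s) (by omega)
      (HistoryFun.const s 1) (fun _ => zero_le_one) hR hb
    simpa [hind] using this
  calc _ ≤ ∫ ω, ind ω * ballLink q V t u ω ∂(spaMeasure m p) := by
        refine integral_mono ((historyFun_ballLink hm hq hV0 hV1 (by omega)).mul
          (historyFun_ballLink hm hq hV0 hV1 hvt)).integrable ((hadind.mono (by omega)).mul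
          (historyFun_ballLink hm hq hV0 hV1 (by omega))).integrable fun ω => ?_
        exact ballLink_mul_ballLink_le hm hq hV0 hV1
    _ = p * V * ∫ ω, ind ω ∂(spaMeasure m p) :=
        integral_mul_ballLink hm hq hV0 hV1 (by omega) (hadind.mono hvt)
    _ ≤ _ := mul_le_mul_of_nonneg_left h1 (mul_nonneg p.2.1 hV0)

/-- The `t` diagonal terms give `t V`, and the off-diagonal ones at most `(20m)^m V²` each. -/
theorem integral_sum_ballLink_sq_le {p : I} (t : ℕ) :
    ∫ ω, (∑ u ∈ Finset.Icc 1 t, ballLink q V t u ω) ^ 2 ∂(spaMeasure m p)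
      ≤ t * V + (t * V) ^ 2 * (20 * m) ^ m := by
  classical
  have hp0 := p.2.1
  have hp1 := p.2.2
  have hh : ∀ u ∈ Finset.Icc 1 t, HistoryFun (t + 1) (ballLink q V t u : SPASpace m → ℝ) :=
    fun u hu => historyFun_ballLink hm hq hV0 hV1 (Finset.mem_Icc.1 hu).2
  have hpV : (p : ℝ) * V ≤ V := mul_le_of_le_one_left hV0 hp1
  have hpair : ∀ u ∈ Finset.Icc 1 t, ∀ v ∈ Finset.Icc 1 t,
      ∫ ω, ballLink q V t u ω * ballLink q V t v ω ∂(spaMeasure m p)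
        ≤ (if u = v then V else 0) + V * ((20 * m) ^ m * V) := by
    intro u hu v hv
    rw [Finset.mem_Icc] at hu hv
    have hK : 0 ≤ (20 * (m : ℝ)) ^ m * V := by positivity
    have h3 : (p : ℝ) * V * ((20 * m) ^ m * V) ≤ V * ((20 * m) ^ m * V) :=
      mul_le_mul_of_nonneg_right hpV hK
    rcases lt_trichotomy u v with h | h | h
    · rw [if_neg h.ne, zero_add]
      exact (integral_ballLink_mul_ballLink_le hm hq hV0 hV1 hu.1 h hv.2).trans h3
    · subst h
      rw [if_pos rfl]
      have h4 : ∫ ω, ballLink q V t u ω * ballLink q V t u ω ∂(spaMeasure m p) ≤ p * V := by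
        have h5 := integral_mul_ballLink (p := p) hm hq hV0 hV1 hu.2 (HistoryFun.const t 1)
        simp only [one_mul, integral_const, probReal_univ, smul_eq_mul, mul_one] at h5
        rw [← h5]
        have hh1 := historyFun_ballLink hm hq hV0 hV1 hu.2
        exact integral_mono (hh1.mul hh1).integrable hh1.integrable fun ω =>
          mul_le_of_le_one_right ballLink_nonneg ballLink_le_one
      have : 0 ≤ V * ((20 * m) ^ m * V) := by positivity
      linarith
    · rw [if_neg h.ne', zero_add]
      simp_rw [mul_comm (ballLink q V t u _)]
      exact (integral_ballLink_mul_ballLink_le hm hq hV0 hV1 hv.1 h hu.2).trans h3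
  calc _ = ∑ u ∈ Finset.Icc 1 t, ∑ v ∈ Finset.Icc 1 t,
        ∫ ω, ballLink q V t u ω * ballLink q V t v ω ∂(spaMeasure m p) := by
        simp_rw [sq, Finset.sum_mul_sum]
        rw [integral_finsetSum _ fun u hu => (HistoryFun.sum _ fun v hv =>
          (hh u hu).mul (hh v hv)).integrable]
        refine Finset.sum_congr rfl fun u hu => ?_
        rw [integral_finsetSum _ fun v hv => ((hh u hu).mul (hh v hv)).integrable]
    _ ≤ ∑ u ∈ Finset.Icc 1 t, ∑ v ∈ Finset.Icc 1 t,
        ((if u = v then V else 0) + V * ((20 * m) ^ m * V)) :=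
        Finset.sum_le_sum fun u hu => Finset.sum_le_sum fun v hv => hpair u hu v hv
    _ = _ := by
        simp only [Finset.sum_add_distrib, Finset.sum_ite_eq, Finset.sum_const, Nat.card_Icc,
          Nat.add_sub_cancel, nsmul_eq_mul]
        rw [Finset.sum_ite_mem, Finset.inter_self, Finset.sum_const, Nat.card_Icc,
          Nat.add_sub_cancel, nsmul_eq_mul]
        ring

/-- The centred number of trials won within balls of a fixed volume has variance of the order of the
number of steps. -/
theorem integral_sum_sub_sq_le {p : I} (n : ℕ) {B : ℝ}
    (hB : ∀ t < n, t * V + (t * V) ^ 2 * (20 * m) ^ m ≤ B) :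
    ∫ ω, (∑ t ∈ Finset.range n, (∑ u ∈ Finset.Icc 1 t, ballLink q V t u ω - p * V * t)) ^ 2
      ∂(spaMeasure m p) ≤ n * B := by
  have hS : ∀ t, HistoryFun (t + 1)
      (fun ω : SPASpace m => ∑ u ∈ Finset.Icc 1 t, ballLink q V t u ω) := fun t =>
    HistoryFun.sum _ fun u hu => historyFun_ballLink hm hq hV0 hV1 (Finset.mem_Icc.1 hu).2
  have hM : ∀ n, HistoryFun n (fun ω : SPASpace m => ∑ t ∈ Finset.range n,
      (∑ u ∈ Finset.Icc 1 t, ballLink q V t u ω - p * V * t)) := fun n =>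
    HistoryFun.sum _ fun t ht => ((hS t).sub (HistoryFun.const _ _)).mono (Finset.mem_range.1 ht)
  have hstep : ∀ t (f : SPASpace m → ℝ), HistoryFun t f →
      ∫ ω, f ω * ∑ u ∈ Finset.Icc 1 t, ballLink q V t u ω ∂(spaMeasure m p)
        = p * V * t * ∫ ω, f ω ∂(spaMeasure m p) := by
    intro t f hf
    simp_rw [Finset.mul_sum]
    rw [integral_finsetSum _ fun u hu => ((hf.mono (Nat.le_succ t)).mul
      (historyFun_ballLink hm hq hV0 hV1 (Finset.mem_Icc.1 hu).2)).integrable]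
    rw [Finset.sum_congr rfl fun u hu =>
      integral_mul_ballLink hm hq hV0 hV1 (Finset.mem_Icc.1 hu).2 hf]
    rw [Finset.sum_const, Nat.card_Icc, Nat.add_sub_cancel, nsmul_eq_mul]
    ring
  induction n with
  | zero => simp
  | succ n ih =>
    have ih' := ih fun t ht => hB t (by omega)
    have hBn := (integral_sum_ballLink_sq_le (p := p) hm hq hV0 hV1 n).trans (hB n (by omega))
    simp only [Finset.sum_range_succ]
    set M : SPASpace m → ℝ := fun ω => ∑ t ∈ Finset.range n,
      (∑ u ∈ Finset.Icc 1 t, ballLink q V t u ω - p * V * t) with hMdef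
    set S : SPASpace m → ℝ := fun ω => ∑ u ∈ Finset.Icc 1 n, ballLink q V n u ω with hSdef
    set c : ℝ := p * V * n with hc
    have hMn : HistoryFun n M := hM n
    have hMn' := hMn.mono (Nat.le_succ n)
    have hSn : HistoryFun (n + 1) S := hS n
    have hMS := hstep n M hMn
    have hS1 : ∫ ω, S ω ∂(spaMeasure m p) = c := by
      have := hstep n _ (HistoryFun.const n 1)
      simpa using this
    have e1 : Integrable (fun ω => M ω ^ 2) (spaMeasure m p) := by
      simp_rw [sq]; exact (hMn.mul hMn).integrable
    have e2 : Integrable (fun ω => S ω ^ 2) (spaMeasure m p) := by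
      simp_rw [sq]; exact (hSn.mul hSn).integrable
    have e3 : Integrable (fun ω => 2 * (M ω * S ω)) (spaMeasure m p) :=
      (hMn'.mul hSn).integrable.const_mul 2
    have e4 : Integrable (fun ω => 2 * c * M ω) (spaMeasure m p) := hMn.integrable.const_mul _
    have e5 : Integrable (fun ω => 2 * c * S ω) (spaMeasure m p) := hSn.integrable.const_mul _
    have h1 : ∫ ω, (M ω + (S ω - c)) ^ 2 ∂(spaMeasure m p)
        = ∫ ω, M ω ^ 2 ∂(spaMeasure m p) + ∫ ω, S ω ^ 2 ∂(spaMeasure m p)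
          + 2 * ∫ ω, M ω * S ω ∂(spaMeasure m p) - 2 * c * ∫ ω, M ω ∂(spaMeasure m p)
          - 2 * c * ∫ ω, S ω ∂(spaMeasure m p) + c ^ 2 := by
      have e12 : Integrable (fun ω => M ω ^ 2 + S ω ^ 2) (spaMeasure m p) := e1.add e2
      have e123 : Integrable (fun ω => M ω ^ 2 + S ω ^ 2 + 2 * (M ω * S ω)) (spaMeasure m p) :=
        e12.add e3
      have e1234 : Integrable (fun ω => M ω ^ 2 + S ω ^ 2 + 2 * (M ω * S ω) - 2 * c * M ω)
        (spaMeasure m p) := e123.sub e4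
      have e12345 : Integrable (fun ω => M ω ^ 2 + S ω ^ 2 + 2 * (M ω * S ω) - 2 * c * M ω
        - 2 * c * S ω) (spaMeasure m p) := e1234.sub e5
      rw [← integral_const_mul, ← integral_const_mul, ← integral_const_mul, ← integral_add e1 e2,
        ← integral_add e12 e3, ← integral_sub e123 e4, ← integral_sub e1234 e5]
      have hc2 : c ^ 2 = ∫ _ω : SPASpace m, c ^ 2 ∂(spaMeasure m p) := by simp
      rw [hc2, ← integral_add e12345 (integrable_const _)]
      refine integral_congr_ae (ae_of_all _ fun ω => ?_)
      simp only
      ring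
    -- The cross terms cancel, as the increment has mean `c` given the past; what is left is `∫ M² +
    -- ∫ S² - c²`.
    rw [h1, hMS, hS1]
    push_cast
    nlinarith [sq_nonneg c]

end BallLink

/-- The graph has at least linearly many edges with high probability. -/
theorem measureReal_card_spaEdges_lt_le {m : ℕ} (hm : 1 ≤ m) {q : ℝ≥0∞} (hq : 1 ≤ q) {A₁ A₂ : ℝ}
    (hA₁ : 0 ≤ A₁) (hA₂ : 0 < A₂) {p : I} (hp : 0 < (p : ℝ)) {n : ℕ} (hn : 2 ≤ n)
    (hnA : A₂ ≤ n) :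
    (spaMeasure m p).real
      {ω | ((spaEdges q A₁ A₂ ω.1 ω.2 n).card : ℝ) < p * A₂ / 8 * n}
      ≤ (A₂ + A₂ ^ 2 * (20 * m) ^ m) / (p * A₂ / 8) ^ 2 / n := by
  have hnR : (2 : ℝ) ≤ n := by exact_mod_cast hn
  have hn0 : (0 : ℝ) < n := by linarith
  -- One volume serves all steps, since `A₂/n ≤ A₂/t` for `t < n`; then `t V ≤ A₂` bounds the
  -- variance of every step.
  set V : ℝ := A₂ / n with hV
  have hV0 : 0 ≤ V := by positivity
  have hV1 : V ≤ 1 := by rw [hV, div_le_one hn0]; exact hnA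
  set M : SPASpace m → ℝ := fun ω => ∑ t ∈ Finset.range n,
      (∑ u ∈ Finset.Icc 1 t, ballLink q V t u ω - p * V * t) with hM
  have hMh : HistoryFun n M := HistoryFun.sum _ fun t ht => ((HistoryFun.sum _ fun u hu =>
    historyFun_ballLink hm hq hV0 hV1 (Finset.mem_Icc.1 hu).2).sub
      (HistoryFun.const _ _)).mono (Finset.mem_range.1 ht)
  have h1 : ∫ ω, M ω ^ 2 ∂(spaMeasure m p) ≤ n * (A₂ + A₂ ^ 2 * (20 * m) ^ m) := by
    refine integral_sum_sub_sq_le hm hq hV0 hV1 n fun t ht => ?_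
    have h2 : t * V ≤ A₂ := by
      rw [hV, mul_div_assoc', div_le_iff₀ hn0, mul_comm]
      exact mul_le_mul_of_nonneg_left (by exact_mod_cast ht.le) hA₂.le
    gcongr
  set δ := p * A₂ / 8 with hδ
  have hδ0 : 0 < δ := by positivity
  have hsub : {ω : SPASpace m | ((spaEdges q A₁ A₂ ω.1 ω.2 n).card : ℝ) < δ * n}
      ⊆ {ω | (δ * n) ^ 2 ≤ M ω ^ 2} := by
    intro ω hω
    have hω' : ((spaEdges q A₁ A₂ ω.1 ω.2 n).card : ℝ) < δ * n := hω
    have h3 : ∑ t ∈ Finset.range n, ∑ u ∈ Finset.Icc 1 t, ballLink q V t u ω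
        ≤ ((spaEdges q A₁ A₂ ω.1 ω.2 n).card : ℝ) := by
      rw [card_spaEdges]
      refine Finset.sum_le_sum fun t ht => Finset.sum_le_sum fun u hu => ?_
      rw [Finset.mem_Icc] at hu
      have ht' : t < n := Finset.mem_range.1 ht
      refine ballLink_le_link hm hq hA₁ hA₂.le hu.1 hu.2 hV1 ?_
      have ht0 : (0 : ℝ) < t := by exact_mod_cast (by omega : 0 < t)
      exact div_le_div_of_nonneg_left hA₂.le ht0 (by exact_mod_cast ht'.le)
    have h4 : ∑ t ∈ Finset.range n, p * V * (t : ℝ) = p * V * (n * (n - 1) / 2) := by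
      rw [← Finset.mul_sum]
      congr 1
      have := Finset.sum_range_id_mul_two n
      have h5 : (∑ t ∈ Finset.range n, (t : ℝ)) * 2 = n * (n - 1) := by
        have h6 : ((∑ t ∈ Finset.range n, t) * 2 : ℝ) = ((n * (n - 1) : ℕ) : ℝ) := by
          rw [← this]; push_cast; rfl
        rw [Nat.cast_mul, Nat.cast_sub (by omega)] at h6
        simpa using h6
      linarith
    have h5 : p * V * (n * (n - 1) / 2) = 4 * δ * (n - 1) := by
      rw [hV, hδ]; field_simp; ring
    -- The mean is `4δ(n - 1) ≥ 2δn` because `n ≥ 2`, so fewer than `δn` edges mean a deviation of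
    -- at least `δn`.
    have h6 : M ω ≤ -(δ * n) := by
      simp only [hM, Finset.sum_sub_distrib]
      rw [h4, h5]
      nlinarith
    have h7 : 0 ≤ δ * n := by positivity
    change (δ * n) ^ 2 ≤ M ω ^ 2
    nlinarith
  have e1 : Integrable (fun ω => M ω ^ 2) (spaMeasure m p) := by
    simp_rw [sq]; exact (hMh.mul hMh).integrable
  have h8 := mul_meas_ge_le_integral_of_nonneg (ae_of_all _ fun ω => sq_nonneg (M ω)) e1
    ((δ * n) ^ 2)
  have h9 := measureReal_mono (μ := spaMeasure m p) hsub
  have h10 : (δ * n) ^ 2 * (spaMeasure m p).real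
      {ω | ((spaEdges q A₁ A₂ ω.1 ω.2 n).card : ℝ) < δ * n}
      ≤ n * (A₂ + A₂ ^ 2 * (20 * m) ^ m) :=
    (mul_le_mul_of_nonneg_left h9 (by positivity)).trans (h8.trans h1)
  rw [div_div, le_div_iff₀ (by positivity)]
  have : n * (δ ^ 2 * n * (spaMeasure m p).real
      {ω | ((spaEdges q A₁ A₂ ω.1 ω.2 n).card : ℝ) < δ * n})
      ≤ n * (A₂ + A₂ ^ 2 * (20 * m) ^ m) := by
    refine le_trans (le_of_eq ?_) h10
    ring
  have := le_of_mul_le_mul_left this hn0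
  linarith

/-! ### Edge lengths and close pairs of vertices -/

/-- The integral comparison in discrete form: by Bernoulli, `(t+1)^(1-γ) - t^(1-γ) ≥
(1-γ)(t+1)^(-γ)`. -/
theorem sum_rpow_neg_le {γ : ℝ} (h0 : 0 ≤ γ) (h1 : γ < 1) (t : ℕ) :
    ∑ u ∈ Finset.Icc 1 t, (u : ℝ) ^ (-γ) ≤ (t : ℝ) ^ (1 - γ) / (1 - γ) := by
  have hγ : 0 < 1 - γ := by linarith
  induction t with
  | zero => simp [Real.zero_rpow hγ.ne']
  | succ t ih =>
    rw [Finset.sum_Icc_succ_top (by omega)]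
    have ht : (0 : ℝ) < ((t + 1 : ℕ) : ℝ) := by positivity
    have hs : (-1 : ℝ) ≤ -1 / ((t + 1 : ℕ) : ℝ) := by
      rw [le_div_iff₀ ht]
      push_cast
      have : (0 : ℝ) ≤ t := by positivity
      linarith
    have h2 := rpow_one_add_le_one_add_mul_self hs hγ.le (by linarith : 1 - γ ≤ 1)
    have h3 : (t : ℝ) = ((t + 1 : ℕ) : ℝ) * (1 + -1 / ((t + 1 : ℕ) : ℝ)) := by
      field_simp
      push_cast
      ring
    have h4 : (t : ℝ) ^ (1 - γ) ≤ ((t + 1 : ℕ) : ℝ) ^ (1 - γ)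
        * (1 + (1 - γ) * (-1 / ((t + 1 : ℕ) : ℝ))) := by
      conv_lhs => rw [h3]
      rw [Real.mul_rpow ht.le (by linarith)]
      exact mul_le_mul_of_nonneg_left h2 (by positivity)
    have h5 : ((t + 1 : ℕ) : ℝ) ^ (1 - γ) = ((t + 1 : ℕ) : ℝ) ^ (-γ) * ((t + 1 : ℕ) : ℝ) := by
      rw [show (1 - γ) = -γ + 1 by ring, Real.rpow_add_one ht.ne']
    rw [le_div_iff₀ hγ] at ih ⊢
    have h6 : ((t + 1 : ℕ) : ℝ) ^ (1 - γ) * (1 + (1 - γ) * (-1 / ((t + 1 : ℕ) : ℝ)))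
        = ((t + 1 : ℕ) : ℝ) ^ (1 - γ) - (1 - γ) * ((t + 1 : ℕ) : ℝ) ^ (-γ) := by
      rw [h5]
      field_simp
      ring
    rw [h6] at h4
    nlinarith

theorem sum_div_rpow_le {γ : ℝ} (h0 : 0 ≤ γ) (h1 : γ < 1) {t : ℕ} (ht : 1 ≤ t) :
    ∑ u ∈ Finset.Icc 1 t, ((t : ℝ) / u) ^ γ ≤ t / (1 - γ) := by
  have htR : (0 : ℝ) < t := by exact_mod_cast ht
  have h2 : ∀ u ∈ Finset.Icc 1 t, ((t : ℝ) / u) ^ γ = (t : ℝ) ^ γ * (u : ℝ) ^ (-γ) := by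
    intro u _
    rw [Real.div_rpow htR.le (by positivity), Real.rpow_neg (by positivity), div_eq_mul_inv]
  rw [Finset.sum_congr rfl h2, ← Finset.mul_sum]
  refine (mul_le_mul_of_nonneg_left (sum_rpow_neg_le h0 h1 t) (by positivity)).trans (le_of_eq ?_)
  rw [← mul_div_assoc, ← Real.rpow_add htR]
  simp

theorem Nearby.symm {δ : ℝ} {a b : I} (h : Nearby δ a b) : Nearby δ b a := by
  obtain ⟨w, hw, h1⟩ := h
  rw [Finset.mem_Icc] at hw
  refine ⟨-w, Finset.mem_Icc.2 ⟨by omega, by omega⟩, ?_⟩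
  rw [← abs_neg]
  convert h1 using 2
  push_cast
  ring

theorem volume_nearby_coord_le {m : ℕ} (i : Fin m) (c : Fin m → I) {δ : ℝ} (hδ : 0 ≤ δ) :
    volume.real {y : Fin m → I | Nearby δ (c i) (y i)} ≤ 10 * δ := by
  have h1 : MeasurableSet {b : I | Nearby δ (c i) b} := by
    have h3 : Measurable fun b : I => (c i, b) := by fun_prop
    exact h3 (measurableSet_nearby δ)
  have h2 : volume {y : Fin m → I | Nearby δ (c i) (y i)} = volume {b : I | Nearby δ (c i) b} :=
    (measurePreserving_eval (fun _ : Fin m => (volume : Measure I)) i).measure_preimage h1.nullMeasurableSet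
  have h3 := volume_nearby_le (c i) δ
  rw [← h2] at h3
  exact ENNReal.toReal_le_of_le_ofReal (by positivity) h3

/-- The sum of upper bounds for the lengths of the edges. -/
def totalLength {m : ℕ} (q : ℝ≥0∞) (A₁ A₂ : ℝ) (n : ℕ) (ω : SPASpace m) : ℝ :=
  ∑ t ∈ Finset.range n, ∑ u ∈ Finset.Icc 1 t,
    link q A₁ A₂ t u ω * (m * sphereVolume q A₁ A₂ t u ω ^ (1 / (m : ℝ)))

open Classical in
/-- The sum of `W_u W_v` over the pairs of vertices whose `i`-th coordinates are within `δ`. -/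
def closePairs {m : ℕ} (q : ℝ≥0∞) (A₁ A₂ : ℝ) (i : Fin m) (δ : ℝ) (n : ℕ) (ω : SPASpace m) : ℝ :=
  ∑ u ∈ Finset.Icc 1 n, ∑ v ∈ Finset.Icc 1 n,
    (if Nearby δ (ω.1 u i) (ω.1 v i) then 1 else 0)
      * (strength q A₁ A₂ n u ω * strength q A₁ A₂ n v ω)

/-- Splits at the threshold `M`: a fractional moment of order `1 + β` is reduced to the second
moment. With `M` the typical size of `w`, both terms have the right order. -/
theorem rpow_one_add_le_of_pos {β w M : ℝ} (hβ1 : β ≤ 1) (hβ0 : 0 ≤ β) (hw : 0 ≤ w) (hM : 0 < M) :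
    w ^ (1 + β) ≤ M ^ (β - 1) * w ^ 2 + M ^ (1 + β) := by
  rcases le_total w M with h | h
  · have h1 : w ^ (1 + β) ≤ M ^ (1 + β) := Real.rpow_le_rpow hw h (by linarith)
    have h2 : 0 ≤ M ^ (β - 1) * w ^ 2 := by positivity
    linarith
  · have hw0 : 0 < w := hM.trans_le h
    have h1 : w ^ (β - 1) ≤ M ^ (β - 1) := Real.rpow_le_rpow_of_nonpos hM h (by linarith)
    have h2 : w ^ (1 + β) = w ^ (β - 1) * w ^ 2 := by
      rw [← Real.rpow_natCast w 2, ← Real.rpow_add hw0]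
      congr 1
      push_cast
      ring
    rw [h2]
    have h3 : 0 ≤ M ^ (1 + β) := by positivity
    have := mul_le_mul_of_nonneg_right h1 (sq_nonneg w)
    linarith

section Expectation

variable {m : ℕ} (hm : 1 ≤ m) {q : ℝ≥0∞} (hq : 1 ≤ q) {A₁ A₂ : ℝ} (hA₁ : 0 ≤ A₁) (hA₂ : 0 ≤ A₂)
include hm hq hA₁ hA₂

theorem historyFun_sphereVolume_rpow (t u : ℕ) {a : ℝ} (ha : 0 ≤ a) :
    HistoryFun t (fun ω : SPASpace m => sphereVolume q A₁ A₂ t u ω ^ a) := by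
  refine historyFun_comp_spaEdges hm hq hA₁ hA₂ t (fun E => influenceVolume A₁ A₂ E t u ^ a)
    ⟨1, fun ω => ?_⟩
  have h0 := influenceVolume_nonneg hA₁ hA₂ (spaEdges q A₁ A₂ ω.1 ω.2 t) t u
  rw [abs_of_nonneg (by positivity)]
  exact Real.rpow_le_one h0 (influenceVolume_le_one _ _ _ _ _) ha

/-- As `V ≤ 1` and `β ≤ 1/m`, the integrand is at most `V^(1+β) ≤ (W/t)^(1+β)` with `W` the
strength. The typical size of `W` is the growth ratio `ρ`, of order `(t/u)^α`, which is taken as the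
threshold. -/
theorem integral_sphereVolume_rpow_le {p : I} {t u : ℕ} (hu1 : 1 ≤ u) (hut : u ≤ t)
    (hα1 : (p : ℝ) * A₁ ≤ 1) {β : ℝ} (hβ0 : 0 ≤ β) (hβ1 : β ≤ 1) (hβm : β ≤ 1 / (m : ℝ)) :
    ∫ ω, sphereVolume q A₁ A₂ t u ω ^ (1 / (m : ℝ)) * sphereVolume q A₁ A₂ t u ω ∂(spaMeasure m p)
      ≤ 4 * ((A₂ + A₁) * A₂ + 1) * (t : ℝ) ^ (-(1 + β)) * ((t : ℝ) / u) ^ (p * A₁ * (1 + β)) := by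
  have hα : 0 ≤ (p : ℝ) * A₁ := mul_nonneg p.2.1 hA₁
  have ht1 : 1 ≤ t := hu1.trans hut
  have htR : (0 : ℝ) < t := by exact_mod_cast ht1
  have huR : (0 : ℝ) < u := by exact_mod_cast hu1
  set ρ := growth (p * A₁) t / growth (p * A₁) u with hρ
  have hρ0 : 0 < ρ := div_pos (growth_pos hα t) (growth_pos hα u)
  have hW := historyFun_strength hm hq hA₁ hA₂ (m := m) (q := q) t u
  have hWsq : Integrable (fun ω => strength q A₁ A₂ t u ω ^ 2) (spaMeasure m p) := by
    simp_rw [sq]; exact (hW.mul hW).integrable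
  have hpt : ∀ ω : SPASpace m,
      sphereVolume q A₁ A₂ t u ω ^ (1 / (m : ℝ)) * sphereVolume q A₁ A₂ t u ω
        ≤ (t : ℝ) ^ (-(1 + β)) * (ρ ^ (β - 1) * strength q A₁ A₂ t u ω ^ 2 + ρ ^ (1 + β)) := by
    intro ω
    have hV0 : 0 ≤ sphereVolume q A₁ A₂ t u ω := sphereVolume_nonneg hA₁ hA₂
    have hW0 : 0 ≤ strength q A₁ A₂ t u ω := hA₂.trans (le_strength hA₁)
    have h1 : sphereVolume q A₁ A₂ t u ω ^ (1 / (m : ℝ)) * sphereVolume q A₁ A₂ t u ω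
        ≤ sphereVolume q A₁ A₂ t u ω ^ (1 + β) := by
      rw [add_comm, Real.rpow_add_one' hV0 (by linarith)]
      exact mul_le_mul_of_nonneg_right
        (Real.rpow_le_rpow_of_exponent_ge' hV0 sphereVolume_le_one hβ0 hβm) hV0
    have h2 : sphereVolume q A₁ A₂ t u ω ^ (1 + β)
        ≤ (t : ℝ) ^ (-(1 + β)) * strength q A₁ A₂ t u ω ^ (1 + β) := by
      refine (Real.rpow_le_rpow hV0 sphereVolume_le (by linarith)).trans (le_of_eq ?_)
      rw [Real.div_rpow hW0 htR.le, Real.rpow_neg htR.le, div_eq_inv_mul]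
    exact h1.trans (h2.trans (mul_le_mul_of_nonneg_left
      (rpow_one_add_le_of_pos hβ1 hβ0 hW0 hρ0) (by positivity)))
  have hρpow : ρ ^ (1 + β) ≤ 4 * ((t : ℝ) / u) ^ (p * A₁ * (1 + β)) := by
    have h1 := Real.rpow_le_rpow hρ0.le (growth_div_growth_le hα hα1 hu1 ht1)
      (by linarith : 0 ≤ 1 + β)
    refine h1.trans ?_
    rw [Real.mul_rpow (by norm_num) (by positivity), ← Real.rpow_mul (by positivity)]
    refine mul_le_mul_of_nonneg_right ?_ (by positivity)
    calc (2 : ℝ) ^ (1 + β) ≤ 2 ^ (2 : ℝ) :=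
          Real.rpow_le_rpow_of_exponent_le (by norm_num) (by linarith)
      _ = 4 := by norm_num
  calc _ ≤ ∫ ω, (t : ℝ) ^ (-(1 + β)) * (ρ ^ (β - 1) * strength q A₁ A₂ t u ω ^ 2 + ρ ^ (1 + β))
        ∂(spaMeasure m p) := by
        refine integral_mono ((historyFun_sphereVolume_rpow hm hq hA₁ hA₂ t u (by positivity)).mul
          (historyFun_sphereVolume hm hq hA₁ hA₂ t u)).integrable ?_ hpt
        exact ((hWsq.const_mul _).add (integrable_const _)).const_mul _
    _ = (t : ℝ) ^ (-(1 + β)) * (ρ ^ (β - 1)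
        * ∫ ω, strength q A₁ A₂ t u ω ^ 2 ∂(spaMeasure m p) + ρ ^ (1 + β)) := by
        rw [integral_const_mul, integral_add (hWsq.const_mul _) (integrable_const _),
          integral_const_mul]
        simp
    _ ≤ (t : ℝ) ^ (-(1 + β)) * (ρ ^ (β - 1) * ((A₂ + A₁) * A₂ * ρ ^ 2) + ρ ^ (1 + β)) := by
        have := integral_strength_sq_le (p := p) hm hq hA₁ hA₂ hu1 hut
        gcongr
    _ = (t : ℝ) ^ (-(1 + β)) * ((A₂ + A₁) * A₂ + 1) * ρ ^ (1 + β) := by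
        have h2 : ρ ^ (1 + β) = ρ ^ (β - 1) * ρ ^ 2 := by
          rw [← Real.rpow_natCast ρ 2, ← Real.rpow_add hρ0]
          congr 1
          push_cast
          ring
        rw [h2]
        ring
    _ ≤ (t : ℝ) ^ (-(1 + β)) * ((A₂ + A₁) * A₂ + 1)
        * (4 * ((t : ℝ) / u) ^ (p * A₁ * (1 + β))) := by gcongr
    _ = _ := by ring

theorem integrable_totalLength {p : I} (n : ℕ) :
    Integrable (totalLength q A₁ A₂ n : SPASpace m → ℝ) (spaMeasure m p) :=
  (HistoryFun.sum _ fun t ht => HistoryFun.sum _ fun u _ =>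
    ((historyFun_link hm hq hA₁ hA₂ t u).mul (((historyFun_sphereVolume_rpow hm hq hA₁ hA₂ t u
      (by positivity)).const_mul _).mono (Nat.le_succ t))).mono (Finset.mem_range.1 ht) :
    HistoryFun n _).integrable

/-- The expected length of the possible link from `t + 1` to `u` is of order `t^(-1-β) (t/u)^γ` with
`γ = α(1+β)`. Since `γ < 1`, the sum over `u` is of order `t^(-β)`, and `β < 1` makes the sum over
`t` of order `n^(1-β)`. -/
theorem integral_totalLength_le {p : I} {β : ℝ} (hβ0 : 0 ≤ β) (hβ1 : β < 1)
    (hβm : β ≤ 1 / (m : ℝ)) (hα1 : (p : ℝ) * A₁ ≤ 1) (hβα : p * A₁ * (1 + β) < 1) (n : ℕ) :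
    ∫ ω, totalLength q A₁ A₂ n ω ∂(spaMeasure m p)
      ≤ m * (4 * ((A₂ + A₁) * A₂ + 1)) / (1 - p * A₁ * (1 + β)) / (1 - β)
        * (n : ℝ) ^ (1 - β) := by
  have hα : 0 ≤ (p : ℝ) * A₁ := mul_nonneg p.2.1 hA₁
  have hp1 := p.2.2
  set K := 4 * ((A₂ + A₁) * A₂ + 1) with hK
  have hK0 : 0 ≤ K := by positivity
  set γ := p * A₁ * (1 + β) with hγ
  have hγ0 : 0 ≤ γ := mul_nonneg hα (by linarith)
  have hγ1 : 0 < 1 - γ := by linarith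
  have hterm : ∀ t u, HistoryFun (t + 1) (fun ω : SPASpace m => link q A₁ A₂ t u ω
      * (m * sphereVolume q A₁ A₂ t u ω ^ (1 / (m : ℝ)))) := fun t u =>
    (historyFun_link hm hq hA₁ hA₂ t u).mul (((historyFun_sphereVolume_rpow hm hq hA₁ hA₂ t u
      (by positivity)).const_mul _).mono (Nat.le_succ t))
  have hint : ∀ t, ∀ u ∈ Finset.Icc 1 t, ∫ ω, link q A₁ A₂ t u ω
      * (m * sphereVolume q A₁ A₂ t u ω ^ (1 / (m : ℝ))) ∂(spaMeasure m p)
        ≤ m * (K * (t : ℝ) ^ (-(1 + β)) * ((t : ℝ) / u) ^ γ) := by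
    intro t u hu
    rw [Finset.mem_Icc] at hu
    have h1 := integral_mul_link (p := p) hm hq hA₁ hA₂ hu.1 hu.2
      (historyFun_sphereVolume_rpow (q := q) hm hq hA₁ hA₂ t u (a := 1 / (m : ℝ)) (by positivity))
    have h2 := integral_sphereVolume_rpow_le (p := p) hm hq hA₁ hA₂ hu.1 hu.2 hα1 hβ0 hβ1.le hβm
    have h0 : 0 ≤ ∫ ω, sphereVolume q A₁ A₂ t u ω ^ (1 / (m : ℝ)) * sphereVolume q A₁ A₂ t u ω
        ∂(spaMeasure m p) := integral_nonneg fun ω => by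
      have : 0 ≤ sphereVolume q A₁ A₂ t u ω := sphereVolume_nonneg hA₁ hA₂
      positivity
    calc _ = m * ∫ ω, sphereVolume q A₁ A₂ t u ω ^ (1 / (m : ℝ)) * link q A₁ A₂ t u ω
          ∂(spaMeasure m p) := by
          rw [← integral_const_mul]
          refine integral_congr_ae (ae_of_all _ fun ω => ?_)
          simp only
          ring
      _ ≤ _ := by
          rw [h1]
          exact mul_le_mul_of_nonneg_left ((mul_le_of_le_one_left h0 hp1).trans h2) (by positivity)
  unfold totalLength
  rw [integral_finsetSum _ fun t _ => (HistoryFun.sum (t := t + 1) _ fun u _ =>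
    hterm t u).integrable]
  -- The step `t = 0` has no candidates; it is set to 0 by hand because `0^(-β)` is 1 when `β = 0`.
  calc _ ≤ ∑ t ∈ Finset.range n, m * K / (1 - γ) * (if t = 0 then 0 else (t : ℝ) ^ (-β)) := by
        refine Finset.sum_le_sum fun t _ => ?_
        rw [integral_finsetSum _ fun u _ => (hterm t u).integrable]
        refine (Finset.sum_le_sum (hint t)).trans ?_
        split_ifs with ht0
        · subst ht0; simp
        · have ht : 1 ≤ t := by omega
          have htR : (0 : ℝ) < t := by exact_mod_cast ht
          rw [← Finset.mul_sum, ← Finset.mul_sum]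
          have h2 : (t : ℝ) ^ (-(1 + β)) * t = (t : ℝ) ^ (-β) := by
            rw [← Real.rpow_add_one htR.ne']
            congr 1
            ring
          calc _ ≤ m * (K * (t : ℝ) ^ (-(1 + β)) * (t / (1 - γ))) := by
                have := sum_div_rpow_le hγ0 hβα ht
                gcongr
            _ = m * K / (1 - γ) * ((t : ℝ) ^ (-(1 + β)) * t) := by ring
            _ = _ := by rw [h2]
    _ ≤ m * K / (1 - γ) * ∑ t ∈ Finset.Icc 1 n, (t : ℝ) ^ (-β) := by
        rw [← Finset.mul_sum]
        refine mul_le_mul_of_nonneg_left ?_ (by positivity)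
        rw [Finset.sum_congr rfl fun (t : ℕ) _ => (ite_not (t = 0) ((t : ℝ) ^ (-β)) 0).symm,
          ← Finset.sum_filter]
        refine Finset.sum_le_sum_of_subset_of_nonneg ?_ fun _ _ _ => by positivity
        intro t ht
        rw [Finset.mem_filter, Finset.mem_range] at ht
        exact Finset.mem_Icc.2 (by omega)
    _ ≤ m * K / (1 - γ) * ((n : ℝ) ^ (1 - β) / (1 - β)) :=
        mul_le_mul_of_nonneg_left (sum_rpow_neg_le hβ0 hβ1 n) (by positivity)
    _ = _ := by ring

theorem historyFun_near_mul_strength (i : Fin m) (δ : ℝ) {n u v : ℕ} (hu : u ≤ n) (hv : v ≤ n)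
    [DecidablePred fun ω : SPASpace m => Nearby δ (ω.1 u i) (ω.1 v i)] :
    HistoryFun n (fun ω : SPASpace m => (if Nearby δ (ω.1 u i) (ω.1 v i) then 1 else 0)
      * (strength q A₁ A₂ n u ω * strength q A₁ A₂ n v ω)) := by
  refine HistoryFun.mul (HistoryFun.ite (P := fun ω : SPASpace m =>
    Nearby δ (ω.1 u i) (ω.1 v i)) ?_ fun ω ω' h => by rw [h.1 u hu, h.1 v hv])
    ((historyFun_strength hm hq hA₁ hA₂ n u).mul (historyFun_strength hm hq hA₁ hA₂ n v))
  have h3 : Measurable fun ω : SPASpace m => (ω.1 u i, ω.1 v i) := by fun_prop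
  exact h3 (measurableSet_nearby δ)

theorem integrable_closePairs {p : I} (i : Fin m) (δ : ℝ) (n : ℕ) :
    Integrable (closePairs q A₁ A₂ i δ n : SPASpace m → ℝ) (spaMeasure m p) := by
  classical
  exact (HistoryFun.sum _ fun u hu => HistoryFun.sum _ fun v hv =>
    historyFun_near_mul_strength hm hq hA₁ hA₂ i δ (Finset.mem_Icc.1 hu).2
      (Finset.mem_Icc.1 hv).2 : HistoryFun n _).integrable

/-- Equal pairs contribute second moments, the first term. Distinct pairs contribute `δ` times a
product of growth ratios, and each ratio sums to `O(n)`. -/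
theorem integral_closePairs_le {p : I} (hα1 : (p : ℝ) * A₁ < 1) (i : Fin m) {δ : ℝ} (hδ : 0 ≤ δ)
    {n : ℕ} (hn : 1 ≤ n) :
    ∫ ω, closePairs q A₁ A₂ i δ n ω ∂(spaMeasure m p)
      ≤ 4 * ((A₂ + A₁) * A₂) / (1 - p * A₁) * (n : ℝ) ^ (1 + p * A₁)
        + 40 * ((A₂ + 2 * A₁) * A₂) / (1 - p * A₁) ^ 2 * (δ * (n : ℝ) ^ 2) := by
  classical
  have hα : 0 ≤ (p : ℝ) * A₁ := mul_nonneg p.2.1 hA₁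
  have hnR : (0 : ℝ) < n := by exact_mod_cast hn
  set α := (p : ℝ) * A₁ with hαdef
  have hα2 : 0 < 1 - α := by linarith
  set ρ : ℕ → ℝ := fun u => growth α n / growth α u with hρ
  have hρ0 : ∀ u, 0 ≤ ρ u := fun u => div_nonneg (growth_pos hα n).le (growth_pos hα u).le
  have hρle : ∀ u ∈ Finset.Icc 1 n, ρ u ≤ 2 * ((n : ℝ) / u) ^ α := fun u hu =>
    growth_div_growth_le hα hα1.le (Finset.mem_Icc.1 hu).1 hn
  have hρsum : ∑ u ∈ Finset.Icc 1 n, ρ u ≤ 2 * (n / (1 - α)) := by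
    refine (Finset.sum_le_sum hρle).trans ?_
    rw [← Finset.mul_sum]
    exact mul_le_mul_of_nonneg_left (sum_div_rpow_le hα hα1 hn) zero_le_two
  -- Bounding one factor by its largest value `2 n^α` avoids distinguishing whether `2α` exceeds 1.
  have hρsq : ∑ u ∈ Finset.Icc 1 n, ρ u ^ 2 ≤ 4 / (1 - α) * (n : ℝ) ^ (1 + α) := by
    calc _ ≤ ∑ u ∈ Finset.Icc 1 n, 2 * (n : ℝ) ^ α * ρ u := by
          refine Finset.sum_le_sum fun u hu => ?_
          rw [sq]
          refine mul_le_mul_of_nonneg_right ((hρle u hu).trans ?_) (hρ0 u)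
          have hu1 : (1 : ℝ) ≤ u := by exact_mod_cast (Finset.mem_Icc.1 hu).1
          have : (n : ℝ) / u ≤ n := div_le_self hnR.le hu1
          gcongr
      _ ≤ 2 * (n : ℝ) ^ α * (2 * (n / (1 - α))) := by
          rw [← Finset.mul_sum]
          exact mul_le_mul_of_nonneg_left hρsum (by positivity)
      _ = _ := by
          rw [add_comm, Real.rpow_add_one hnR.ne']
          ring
  have hlt : ∀ u v, 1 ≤ u → u < v → v ≤ n →
      ∫ ω, (if Nearby δ (ω.1 u i) (ω.1 v i) then 1 else 0)
        * (strength q A₁ A₂ n u ω * strength q A₁ A₂ n v ω) ∂(spaMeasure m p)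
        ≤ (A₂ + 2 * A₁) * A₂ * (10 * δ) * (ρ u * ρ v) := by
    intro u v hu1 huv hvn
    have hR : MeasurableSet {z : (Fin m → I) × (Fin m → I) | Nearby δ (z.1 i) (z.2 i)} := by
      have h3 : Measurable fun z : (Fin m → I) × (Fin m → I) => (z.1 i, z.2 i) := by fun_prop
      exact h3 (measurableSet_nearby δ)
    exact integral_near_mul_strength_le hm hq hA₁ hA₂ hu1 huv hvn hR (by positivity)
      fun c => volume_nearby_coord_le i c hδ
  have hpair : ∀ u ∈ Finset.Icc 1 n, ∀ v ∈ Finset.Icc 1 n,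
      ∫ ω, (if Nearby δ (ω.1 u i) (ω.1 v i) then 1 else 0)
        * (strength q A₁ A₂ n u ω * strength q A₁ A₂ n v ω) ∂(spaMeasure m p)
        ≤ (if u = v then (A₂ + A₁) * A₂ * ρ u ^ 2 else 0)
          + (A₂ + 2 * A₁) * A₂ * (10 * δ) * (ρ u * ρ v) := by
    intro u hu v hv
    rw [Finset.mem_Icc] at hu hv
    rcases lt_trichotomy u v with h | h | h
    · rw [if_neg h.ne, zero_add]
      exact hlt u v hu.1 h hv.2
    · subst h
      rw [if_pos rfl]
      have hW := historyFun_strength hm hq hA₁ hA₂ (m := m) (q := q) n u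
      have h1 := integral_strength_sq_le (p := p) hm hq hA₁ hA₂ hu.1 hu.2
      have h2 : 0 ≤ (A₂ + 2 * A₁) * A₂ * (10 * δ) * (ρ u * ρ u) := by
        have := hρ0 u
        positivity
      refine le_trans (le_trans (integral_mono (historyFun_near_mul_strength hm hq hA₁ hA₂ i δ
        hu.2 hu.2).integrable (g := fun ω => strength q A₁ A₂ n u ω ^ 2) ?_ fun ω => ?_) h1)
        (le_add_of_nonneg_right h2)
      · simp_rw [sq]; exact (hW.mul hW).integrable
      · have : 0 ≤ strength q A₁ A₂ n u ω := hA₂.trans (le_strength hA₁)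
        simp only
        split_ifs <;> nlinarith
    · rw [if_neg h.ne', zero_add]
      refine le_trans (le_of_eq ?_) ((hlt v u hv.1 h hu.2).trans (le_of_eq (by ring)))
      refine integral_congr_ae (ae_of_all _ fun ω => ?_)
      simp only [show Nearby δ (ω.1 u i) (ω.1 v i) ↔ Nearby δ (ω.1 v i) (ω.1 u i) from
        ⟨Nearby.symm, Nearby.symm⟩]
      ring
  have hsum : ∫ ω, closePairs q A₁ A₂ i δ n ω ∂(spaMeasure m p)
      = ∑ u ∈ Finset.Icc 1 n, ∑ v ∈ Finset.Icc 1 n,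
        ∫ ω, (if Nearby δ (ω.1 u i) (ω.1 v i) then 1 else 0)
          * (strength q A₁ A₂ n u ω * strength q A₁ A₂ n v ω) ∂(spaMeasure m p) := by
    have hh : ∀ u ∈ Finset.Icc 1 n, ∀ v ∈ Finset.Icc 1 n,
        HistoryFun n (fun ω : SPASpace m => (if Nearby δ (ω.1 u i) (ω.1 v i) then 1 else 0)
          * (strength q A₁ A₂ n u ω * strength q A₁ A₂ n v ω)) := fun u hu v hv =>
      historyFun_near_mul_strength hm hq hA₁ hA₂ i δ (Finset.mem_Icc.1 hu).2 (Finset.mem_Icc.1 hv).2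
    unfold closePairs
    rw [integral_finsetSum _ fun u hu => (HistoryFun.sum _ fun v hv => hh u hu v hv).integrable]
    refine Finset.sum_congr rfl fun u hu => ?_
    rw [integral_finsetSum _ fun v hv => (hh u hu v hv).integrable]
  rw [hsum]
  calc _ ≤ ∑ u ∈ Finset.Icc 1 n, ∑ v ∈ Finset.Icc 1 n,
        ((if u = v then (A₂ + A₁) * A₂ * ρ u ^ 2 else 0)
          + (A₂ + 2 * A₁) * A₂ * (10 * δ) * (ρ u * ρ v)) :=
        Finset.sum_le_sum fun u hu => Finset.sum_le_sum fun v hv => hpair u hu v hv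
    _ = (A₂ + A₁) * A₂ * ∑ u ∈ Finset.Icc 1 n, ρ u ^ 2
        + (A₂ + 2 * A₁) * A₂ * (10 * δ)
          * ((∑ u ∈ Finset.Icc 1 n, ρ u) * ∑ u ∈ Finset.Icc 1 n, ρ u) := by
        simp only [Finset.sum_add_distrib, Finset.sum_ite_eq]
        rw [Finset.sum_ite_mem, Finset.inter_self, Finset.sum_mul_sum]
        simp only [Finset.mul_sum]
    _ ≤ (A₂ + A₁) * A₂ * (4 / (1 - α) * (n : ℝ) ^ (1 + α))
        + (A₂ + 2 * A₁) * A₂ * (10 * δ) * ((2 * (n / (1 - α))) * (2 * (n / (1 - α)))) := by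
        have h0 : 0 ≤ ∑ u ∈ Finset.Icc 1 n, ρ u := Finset.sum_nonneg fun u _ => hρ0 u
        gcongr
    _ = _ := by
        field_simp
        ring

end Expectation

/-! ### The modularity of the spatial preferential attachment graph -/

/-- The arcs of the directed graph at time `n`, on the vertex set `{1, …, n}`. -/
def spaArcs {m : ℕ} (q : ℝ≥0∞) (A₁ A₂ : ℝ) (ω : SPASpace m) (n : ℕ) :
    Finset (Finset.Icc 1 n × Finset.Icc 1 n) :=
  Finset.univ.filter fun e => ((e.1 : ℕ), (e.2 : ℕ)) ∈ spaEdges q A₁ A₂ ω.1 ω.2 n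

section Arcs

variable {m : ℕ} {q : ℝ≥0∞} {A₁ A₂ : ℝ} {ω : SPASpace m} {n : ℕ}

theorem mem_spaArcs {e : Finset.Icc 1 n × Finset.Icc 1 n} :
    e ∈ spaArcs q A₁ A₂ ω n ↔ ((e.1 : ℕ), (e.2 : ℕ)) ∈ spaEdges q A₁ A₂ ω.1 ω.2 n := by
  simp [spaArcs]

theorem spaGraph_eq_fromRel :
    spaGraph q A₁ A₂ ω n = SimpleGraph.fromRel (fun u v => (u, v) ∈ spaArcs q A₁ A₂ ω n) := by
  simp only [spaGraph, mem_spaArcs]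

theorem spaEdges_eq_map : spaEdges q A₁ A₂ ω.1 ω.2 n = (spaArcs q A₁ A₂ ω n).map
    ((Function.Embedding.subtype (· ∈ Finset.Icc 1 n)).prodMap
      (Function.Embedding.subtype (· ∈ Finset.Icc 1 n))) := by
  ext ⟨s, u⟩
  rw [Finset.mem_map]
  constructor
  · intro h
    have hb := bounds_of_mem_spaEdges h
    simp only at hb
    exact ⟨(⟨s, Finset.mem_Icc.2 (by omega)⟩, ⟨u, Finset.mem_Icc.2 (by omega)⟩),
      mem_spaArcs.2 h, rfl⟩
  · rintro ⟨e, he, h⟩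
    rw [← h]
    exact mem_spaArcs.1 he

theorem card_spaArcs : (spaArcs q A₁ A₂ ω n).card = (spaEdges q A₁ A₂ ω.1 ω.2 n).card := by
  rw [spaEdges_eq_map, Finset.card_map]

theorem arcsInto_spaArcs (v : Finset.Icc 1 n) :
    arcsInto (spaArcs q A₁ A₂ ω n) v = inDegree (spaEdges q A₁ A₂ ω.1 ω.2 n) v := by
  rw [inDegree, spaEdges_eq_map, Finset.filter_map, Finset.card_map, arcsInto]
  exact congrArg Finset.card (Finset.filter_congr fun e _ => Subtype.ext_iff)

/-- A lower bound for the modularity in terms of edge lengths and pairs of close vertices. -/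
theorem one_sub_modularity_spaGraph_le (hm : 1 ≤ m) (hq : 1 ≤ q) (hA₁ : 0 < A₁) (hA₂ : 0 ≤ A₂)
    (hpos : 0 < (spaEdges q A₁ A₂ ω.1 ω.2 n).card) (i : Fin m) {k : ℕ} (hk : 1 ≤ k) :
    1 - modularity (spaGraph q A₁ A₂ ω n)
      ≤ k * totalLength q A₁ A₂ n ω / (spaEdges q A₁ A₂ ω.1 ω.2 n).card
        + (8 * (closePairs q A₁ A₂ i (1 / k) n ω / A₁ ^ 2)
          + 2 * (k * totalLength q A₁ A₂ n ω) ^ 2)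
            / (4 * ((spaEdges q A₁ A₂ ω.1 ω.2 n).card : ℝ) ^ 2) := by
  classical
  -- A link from `t + 1` was made through the sphere at time `t`, hence the source minus one.
  let F : ℕ × ℕ → ℝ := fun e => m * sphereVolume q A₁ A₂ (e.1 - 1) e.2 ω ^ (1 / (m : ℝ))
  obtain ⟨c, hcut, hc⟩ := exists_stripes (spaArcs q A₁ A₂ ω n) (fun v => ω.1 v i)
    (fun e => F (e.1, e.2)) (fun e he => by
      have h := mem_spaArcs.1 he
      have hb := bounds_of_mem_spaEdges h
      simp only at hb
      obtain ⟨t, ht⟩ : ∃ t, (e.1 : ℕ) = t + 1 := ⟨(e.1 : ℕ) - 1, by omega⟩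
      rw [ht] at h hb
      have h1 : (t + 1, (e.2 : ℕ)) ∈ spaEdges q A₁ A₂ ω.1 ω.2 (t + 1) :=
        (mem_spaEdges_of_le hb.2.2 le_rfl).1 h
      have h2 := ((mem_spaEdges_succ_self hb.1 (by omega)).1 h1).1
      simp only [F, ht, Nat.add_sub_cancel]
      exact nearby_of_mem_ballOfVolume hm hq (influenceVolume_nonneg hA₁.le hA₂ _ _ _)
        (influenceVolume_le_one _ _ _ _ _) h2 i) hk
  have hlen : ∑ e ∈ spaArcs q A₁ A₂ ω n, F (e.1, e.2) = totalLength q A₁ A₂ n ω := by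
    have h1 : ∑ e ∈ spaEdges q A₁ A₂ ω.1 ω.2 n, F e
        = ∑ e ∈ spaArcs q A₁ A₂ ω n, F (e.1, e.2) := by
      rw [spaEdges_eq_map, Finset.sum_map]
      rfl
    rw [← h1, sum_spaEdges]
    simp [totalLength, F]
  rw [hlen] at hcut
  -- A common colour forces nearness within `1/k`, and `A₁` times the in-degree is at most the
  -- strength, whence the division by `A₁²`.
  have hQ : ∑ u, ∑ v, (if c u = c v then (arcsInto (spaArcs q A₁ A₂ ω n) u : ℝ)
      * arcsInto (spaArcs q A₁ A₂ ω n) v else 0) ≤ closePairs q A₁ A₂ i (1 / k) n ω / A₁ ^ 2 := by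
    rw [le_div_iff₀ (by positivity), Finset.sum_mul, closePairs,
      ← Finset.sum_coe_sort (Finset.Icc 1 n)]
    refine Finset.sum_le_sum fun u _ => ?_
    rw [Finset.sum_mul, ← Finset.sum_coe_sort (Finset.Icc 1 n)]
    refine Finset.sum_le_sum fun v _ => ?_
    rw [arcsInto_spaArcs, arcsInto_spaArcs]
    have hW : ∀ w : ℕ, A₁ * (inDegree (spaEdges q A₁ A₂ ω.1 ω.2 n) w : ℝ)
        ≤ strength q A₁ A₂ n w ω := fun w => by unfold strength; linarith
    have hW0 : ∀ w : ℕ, 0 ≤ A₁ * (inDegree (spaEdges q A₁ A₂ ω.1 ω.2 n) w : ℝ) :=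
      fun w => by positivity
    have hmul := mul_le_mul (hW u) (hW v) (hW0 v) ((hW0 u).trans (hW u))
    by_cases h : c u = c v
    · rw [if_pos h, if_pos (hc u v h), one_mul]
      exact le_trans (le_of_eq (by ring)) hmul
    · rw [if_neg h, zero_mul]
      have h0 := (mul_nonneg (hW0 u) (hW0 v)).trans hmul
      split_ifs
      · rwa [one_mul]
      · rw [zero_mul]
  have hE : ∀ u v, (u, v) ∈ spaArcs q A₁ A₂ ω n → (v, u) ∉ spaArcs q A₁ A₂ ω n := by
    intro u v h h'
    have h1 := bounds_of_mem_spaEdges (mem_spaArcs.1 h)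
    have h2 := bounds_of_mem_spaEdges (mem_spaArcs.1 h')
    simp only at h1 h2
    omega
  have hmain := one_sub_modularity_le (spaArcs q A₁ A₂ ω n) hE (by rwa [card_spaArcs]) c
  rw [card_spaArcs] at hmain
  have hcard : (0 : ℝ) < (spaEdges q A₁ A₂ ω.1 ω.2 n).card := by exact_mod_cast hpos
  rw [spaGraph_eq_fromRel]
  refine hmain.trans ?_
  gcongr

end Arcs

/-! ### Asymptotics -/

/-- Only subadditivity is used, so the events need not be known to be measurable. -/
theorem asymptoticallyAlmostSurely_of_compl {Ω : Type*} [MeasurableSpace Ω] {μ : Measure Ω}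
    [IsProbabilityMeasure μ] {event : ℕ → Set Ω} {b : ℕ → ℝ} (hb : Tendsto b atTop (𝓝 0))
    (h : ∀ᶠ n in atTop, μ.real (event n)ᶜ ≤ b n) : AsymptoticallyAlmostSurely μ event := by
  unfold AsymptoticallyAlmostSurely
  rw [← ENNReal.tendsto_toReal_iff (fun n => measure_ne_top _ _) ENNReal.one_ne_top,
    ENNReal.toReal_one]
  have h1 : Tendsto (fun n => 1 - b n) atTop (𝓝 1) := by
    simpa using tendsto_const_nhds.sub hb
  refine tendsto_of_tendsto_of_tendsto_of_le_of_le' h1 tendsto_const_nhds ?_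
    (Eventually.of_forall fun n => measureReal_le_one)
  filter_upwards [h] with n hn
  have h2 := measureReal_union_le (μ := μ) (event n) (event n)ᶜ
  rw [Set.union_compl_self, probReal_univ] at h2
  change 1 - b n ≤ μ.real (event n)
  linarith

theorem AsymptoticallyAlmostSurely.mono {Ω : Type*} [MeasurableSpace Ω] {μ : Measure Ω}
    [IsProbabilityMeasure μ] {event event' : ℕ → Set Ω} (h : AsymptoticallyAlmostSurely μ event)
    (hsub : ∀ᶠ n in atTop, event n ⊆ event' n) : AsymptoticallyAlmostSurely μ event' :=
  tendsto_of_tendsto_of_tendsto_of_le_of_le' h tendsto_const_nhds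
    (hsub.mono fun _ hn => measure_mono hn) (Eventually.of_forall fun _ => prob_le_one)

theorem measureReal_lt_le_of_integral_le {Ω : Type*} [MeasurableSpace Ω] {μ : Measure Ω}
    [IsProbabilityMeasure μ] {X : Ω → ℝ} (hX0 : ∀ ω, 0 ≤ X ω) (hX : Integrable X μ) {C a ℓ : ℝ}
    (ha : 0 < a) (hℓ : 0 < ℓ) (h : ∫ ω, X ω ∂μ ≤ C * a) :
    μ.real {ω | ℓ * a < X ω} ≤ C / ℓ := by
  have h1 := mul_meas_ge_le_integral_of_nonneg (ae_of_all _ hX0) hX (ℓ * a)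
  have h2 : μ.real {ω | ℓ * a < X ω} ≤ μ.real {ω | ℓ * a ≤ X ω} :=
    measureReal_mono fun ω (hω : ℓ * a < X ω) => le_of_lt hω
  rw [le_div_iff₀ hℓ]
  have h3 : a * (μ.real {ω | ℓ * a < X ω} * ℓ) ≤ a * C := by
    calc a * (μ.real {ω | ℓ * a < X ω} * ℓ) = ℓ * a * μ.real {ω | ℓ * a < X ω} := by ring
      _ ≤ ℓ * a * μ.real {ω | ℓ * a ≤ X ω} := mul_le_mul_of_nonneg_left h2 (by positivity)
      _ ≤ a * C := by linarith
  exact le_of_mul_le_mul_left h3 ha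

theorem totalLength_nonneg {m : ℕ} {q : ℝ≥0∞} {A₁ A₂ : ℝ} (hA₁ : 0 ≤ A₁) (hA₂ : 0 ≤ A₂)
    (n : ℕ) (ω : SPASpace m) : 0 ≤ totalLength q A₁ A₂ n ω := by
  refine Finset.sum_nonneg fun t _ => Finset.sum_nonneg fun u _ => ?_
  have h1 : 0 ≤ sphereVolume q A₁ A₂ t u ω := sphereVolume_nonneg hA₁ hA₂
  have h2 : 0 ≤ link q A₁ A₂ t u ω := link_nonneg
  positivity

theorem closePairs_nonneg {m : ℕ} {q : ℝ≥0∞} {A₁ A₂ : ℝ} (hA₁ : 0 ≤ A₁) (hA₂ : 0 ≤ A₂)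
    (i : Fin m) (δ : ℝ) (n : ℕ) (ω : SPASpace m) :
    0 ≤ closePairs q A₁ A₂ i δ n ω := by
  refine Finset.sum_nonneg fun u _ => Finset.sum_nonneg fun v _ => ?_
  have h : ∀ w, 0 ≤ strength q A₁ A₂ n w ω := fun w => hA₂.trans (le_strength hA₁)
  have h1 := h u
  have h2 := h v
  split_ifs <;> positivity

section Main

variable {m : ℕ} (hm : 1 ≤ m) {q : ℝ≥0∞} (hq : 1 ≤ q) {A₁ A₂ : ℝ} (hA₁ : 0 < A₁) (hA₂ : 0 < A₂)
include hm hq hA₁ hA₂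

/-- The deterministic bound when edges are plentiful, and lengths and close pairs are few. -/
theorem abs_one_sub_modularity_spaGraph_le {β c ℓ : ℝ} (hβ0 : 0 ≤ β) (hc : 0 < c) (hℓ : 1 ≤ ℓ)
    {n : ℕ} (hn : 1 ≤ n) (i : Fin m) {ω : SPASpace m}
    (he : c * n ≤ (spaEdges q A₁ A₂ ω.1 ω.2 n).card)
    (hL : totalLength q A₁ A₂ n ω ≤ ℓ * (n : ℝ) ^ (1 - β))
    (hQ : closePairs q A₁ A₂ i (1 / (⌈(n : ℝ) ^ (β / 2)⌉₊ : ℕ)) n ω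
      ≤ ℓ * (n : ℝ) ^ (2 - β / 2)) :
    |1 - modularity (spaGraph q A₁ A₂ ω n)|
      ≤ (2 / c + 2 / (A₁ ^ 2 * c ^ 2) + 2 / c ^ 2) * ((n : ℝ) ^ (-β / 2) * ℓ ^ 2) := by
  have hn1 : (1 : ℝ) ≤ n := by exact_mod_cast hn
  have hn0 : (0 : ℝ) < n := by linarith
  set k := ⌈(n : ℝ) ^ (β / 2)⌉₊ with hk
  have hpow1 : 1 ≤ (n : ℝ) ^ (β / 2) := Real.one_le_rpow hn1 (by positivity)
  have hk1 : 1 ≤ k := Nat.one_le_ceil_iff.2 (by linarith)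
  have hk2 : (k : ℝ) ≤ 2 * (n : ℝ) ^ (β / 2) := by
    have := (Nat.ceil_lt_add_one (by linarith : 0 ≤ (n : ℝ) ^ (β / 2))).le
    linarith
  have hcn : 0 < c * n := by positivity
  have hepos : (0 : ℝ) < (spaEdges q A₁ A₂ ω.1 ω.2 n).card := hcn.trans_le he
  have hb := one_sub_modularity_spaGraph_le (ω := ω) (n := n) hm hq hA₁ hA₂.le
    (by exact_mod_cast hepos) i hk1
  rw [abs_of_nonneg (sub_nonneg.2 (modularity_le_one _))]
  refine hb.trans ?_
  have hL0 := totalLength_nonneg (q := q) hA₁.le hA₂.le n ω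
  have hQ0 := closePairs_nonneg (q := q) hA₁.le hA₂.le i (1 / (k : ℝ)) n ω
  generalize totalLength q A₁ A₂ n ω = L at *
  generalize closePairs q A₁ A₂ i (1 / (k : ℝ)) n ω = Q at *
  generalize ((spaEdges q A₁ A₂ ω.1 ω.2 n).card : ℝ) = e at *
  -- The target rate: relative to `n` and `n²`, both the cut `k L` and the close pairs `Q` are of
  -- order `ℓ x`.
  set x := (n : ℝ) ^ (-β / 2) with hx
  have hx0 : 0 < x := Real.rpow_pos_of_pos hn0 _
  have hx1 : x ≤ 1 := Real.rpow_le_one_of_one_le_of_nonpos hn1 (by linarith)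
  have hkL : k * L ≤ 2 * ℓ * (n * x) := by
    calc k * L ≤ 2 * (n : ℝ) ^ (β / 2) * (ℓ * (n : ℝ) ^ (1 - β)) := by gcongr
      _ = 2 * ℓ * ((n : ℝ) ^ (β / 2) * (n : ℝ) ^ (1 - β)) := by ring
      _ = 2 * ℓ * (n * x) := by
          have h1 : n * x = (n : ℝ) ^ (1 + -β / 2) := by rw [Real.rpow_add hn0, Real.rpow_one]
          rw [h1, ← Real.rpow_add hn0]
          congr 2
          ring
  have hQ' : Q ≤ ℓ * (n ^ 2 * x) := by
    refine hQ.trans (le_of_eq ?_)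
    rw [← Real.rpow_natCast (n : ℝ) 2, hx, ← Real.rpow_add hn0]
    congr 2
    push_cast
    ring
  have hkL0 : 0 ≤ k * L := by positivity
  calc k * L / e + (8 * (Q / A₁ ^ 2) + 2 * (k * L) ^ 2) / (4 * e ^ 2)
      ≤ 2 * ℓ * (n * x) / (c * n) + (8 * (ℓ * (n ^ 2 * x) / A₁ ^ 2)
        + 2 * (2 * ℓ * (n * x)) ^ 2) / (4 * (c * n) ^ 2) := by gcongr
    _ = 2 / c * (x * ℓ) + 2 / (A₁ ^ 2 * c ^ 2) * (x * ℓ) + 2 / c ^ 2 * (x * x * ℓ ^ 2) := by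
        field_simp
        ring
    _ ≤ 2 / c * (x * ℓ ^ 2) + 2 / (A₁ ^ 2 * c ^ 2) * (x * ℓ ^ 2) + 2 / c ^ 2 * (x * 1 * ℓ ^ 2) := by
        -- The squared cut term carries `x² ℓ²`; with `x ≤ 1 ≤ ℓ` every term is at most a multiple
        -- of `x ℓ²`.
        have : ℓ ≤ ℓ ^ 2 := by nlinarith
        gcongr
    _ = _ := by ring

theorem asymptoticallyAlmostSurely_modularity {p : I} (hp : 0 < (p : ℝ))
    (hpA₁ : (p : ℝ) * A₁ < 1) :
    ∃ C : ℝ, AsymptoticallyAlmostSurely (spaMeasure m p) (fun n =>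
      {ω | |1 - modularity (spaGraph q A₁ A₂ ω n)| ≤
        C * ((n : ℝ) ^ (max (-1 / (m : ℝ)) (-1 + (p : ℝ) * A₁) / 2)
          * (Real.log (n : ℝ)) ^ ((9 : ℝ) / 2))}) := by
  have hmR : (1 : ℝ) ≤ m := by exact_mod_cast hm
  set α := (p : ℝ) * A₁ with hα
  have hα0 : 0 < α := by positivity
  set β := min (1 / (m : ℝ)) (1 - α) with hβ
  have hβm : β ≤ 1 / (m : ℝ) := min_le_left _ _
  have hβα : β ≤ 1 - α := min_le_right _ _
  have hβ0 : 0 < β := lt_min (by positivity) (by linarith)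
  -- Strict because `α > 0`, also when `m = 1`.
  have hβ1 : β < 1 := by linarith
  have hexp : max (-1 / (m : ℝ)) (-1 + α) / 2 = -β / 2 := by
    rw [hβ, ← max_neg_neg]
    congr 2
    · ring
    · ring
  -- Indeed `α(1 + β) ≤ α(2 - α) = 1 - (1 - α)²`.
  have hγ : α * (1 + β) < 1 := by nlinarith
  set c := p * A₂ / 8 with hc
  have hc0 : 0 < c := by positivity
  let i : Fin m := ⟨0, hm⟩
  set C₀ := (A₂ + A₂ ^ 2 * (20 * m) ^ m) / c ^ 2 with hC₀
  set C₁ := m * (4 * ((A₂ + A₁) * A₂ + 1)) / (1 - α * (1 + β)) / (1 - β) with hC₁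
  set C₂ := 4 * ((A₂ + A₁) * A₂) / (1 - α) with hC₂
  set C₃ := 40 * ((A₂ + 2 * A₁) * A₂) / (1 - α) ^ 2 with hC₃
  have h1α : 0 < 1 - α := by linarith
  have hC₂0 : 0 ≤ C₂ := by positivity
  have hC₃0 : 0 ≤ C₃ := by positivity
  refine ⟨2 / c + 2 / (A₁ ^ 2 * c ^ 2) + 2 / c ^ 2, asymptoticallyAlmostSurely_of_compl
    (b := fun n => C₀ / n + C₁ / Real.log n + (C₂ + C₃) / Real.log n) ?_ ?_⟩
  · have hlog : Tendsto (fun n : ℕ => Real.log n) atTop atTop :=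
      Real.tendsto_log_atTop.comp tendsto_natCast_atTop_atTop
    have h1 := (tendsto_natCast_atTop_atTop (R := ℝ)).const_div_atTop C₀
    have h2 := hlog.const_div_atTop C₁
    have h3 := hlog.const_div_atTop (C₂ + C₃)
    simpa using (h1.add h2).add h3
  · filter_upwards [eventually_ge_atTop 3, eventually_ge_atTop ⌈A₂⌉₊] with n hn hnA
    have hn1 : 1 ≤ n := by omega
    have hnR1 : (1 : ℝ) ≤ n := by exact_mod_cast hn1
    have hn0 : (0 : ℝ) < n := by linarith
    have hn3 : (3 : ℝ) ≤ n := by exact_mod_cast hn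
    set ℓ := Real.log n with hℓ
    have hℓ1 : 1 ≤ ℓ := by
      rw [hℓ, Real.le_log_iff_exp_le hn0]
      exact Real.exp_one_lt_three.le.trans hn3
    have hℓ0 : 0 < ℓ := by linarith
    set k := ⌈(n : ℝ) ^ (β / 2)⌉₊ with hk
    have hkpos : 0 < (n : ℝ) ^ (β / 2) := Real.rpow_pos_of_pos hn0 _
    have hkle : (n : ℝ) ^ (β / 2) ≤ k := Nat.le_ceil _
    have hP1 := measureReal_card_spaEdges_lt_le (p := p) hm hq hA₁.le hA₂ hp
      (by omega : 2 ≤ n) (Nat.ceil_le.1 hnA)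
    have hP2 := measureReal_lt_le_of_integral_le (totalLength_nonneg (q := q) hA₁.le hA₂.le n)
      (integrable_totalLength (p := p) hm hq hA₁.le hA₂.le n)
      (Real.rpow_pos_of_pos hn0 (1 - β)) hℓ0
      (integral_totalLength_le (p := p) hm hq hA₁.le hA₂.le hβ0.le hβ1 hβm hpA₁.le hγ n)
    have hQint : ∫ ω, closePairs q A₁ A₂ i (1 / (k : ℝ)) n ω ∂(spaMeasure m p)
        ≤ (C₂ + C₃) * (n : ℝ) ^ (2 - β / 2) := by
      refine (integral_closePairs_le (p := p) hm hq hA₁.le hA₂.le hpA₁ i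
        (by positivity) hn1).trans ?_
      -- From `β ≤ 1 - α`: `1 + α ≤ 2 - β ≤ 2 - β/2`.
      have h1 : (n : ℝ) ^ (1 + α) ≤ (n : ℝ) ^ (2 - β / 2) :=
        Real.rpow_le_rpow_of_exponent_le hnR1 (by linarith)
      have h2 : 1 / (k : ℝ) * (n : ℝ) ^ 2 ≤ (n : ℝ) ^ (2 - β / 2) := by
        rw [Real.rpow_sub hn0, Real.rpow_ofNat, one_div, inv_mul_eq_div]
        exact div_le_div_of_nonneg_left (by positivity) hkpos hkle
      rw [add_mul C₂ C₃]
      exact add_le_add (mul_le_mul_of_nonneg_left h1 hC₂0) (mul_le_mul_of_nonneg_left h2 hC₃0)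
    have hP3 := measureReal_lt_le_of_integral_le
      (closePairs_nonneg (q := q) hA₁.le hA₂.le i (1 / (k : ℝ)) n)
      (integrable_closePairs (p := p) hm hq hA₁.le hA₂.le i _ n)
      (Real.rpow_pos_of_pos hn0 (2 - β / 2)) hℓ0 hQint
    refine le_trans (measureReal_mono ?_) ((measureReal_union_le _ _).trans
      (add_le_add ((measureReal_union_le _ _).trans (add_le_add hP1 hP2)) hP3))
    -- Outside the three bad events (few edges, large total length, many close pairs) the
    -- deterministic bound applies.
    intro ω hω
    by_contra hcon
    simp only [Set.mem_union, Set.mem_ofPred_eq, not_or, not_lt] at hcon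
    refine hω ?_
    change |1 - modularity (spaGraph q A₁ A₂ ω n)| ≤ _
    rw [hexp]
    refine (abs_one_sub_modularity_spaGraph_le hm hq hA₁ hA₂ hβ0.le hc0 hℓ1 hn1 i
      hcon.1.1 hcon.1.2 hcon.2).trans ?_
    refine mul_le_mul_of_nonneg_left (mul_le_mul_of_nonneg_left ?_ (by positivity)) (by positivity)
    -- The argument yields `(log n)²`; as `log n ≥ 1`, it is below the claimed power `9/2`.
    rw [← Real.rpow_ofNat]
    exact Real.rpow_le_rpow_of_exponent_le hℓ1 (by norm_num)

end Main

theorem tendsto_rpow_neg_mul_log_rpow {a : ℝ} (ha : a < 0) (b : ℝ) :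
    Tendsto (fun n : ℕ => (n : ℝ) ^ a * Real.log n ^ b) atTop (𝓝 0) := by
  have h := (isLittleO_log_rpow_rpow_atTop b (neg_pos.2 ha)).tendsto_div_nhds_zero
  refine (h.comp tendsto_natCast_atTop_atTop).congr fun n => ?_
  simp only [Function.comp]
  rw [Real.rpow_neg (by positivity), div_inv_eq_mul, mul_comm]

end

theorem mainTheorem1 (m : ℕ) (hm : 1 ≤ m) (q : ℝ≥0∞) (hq : 1 ≤ q)
    (p : I) (A₁ A₂ : ℝ) (hp : 0 < (p : ℝ)) (hA₁ : 0 < A₁) (hA₂ : 0 < A₂)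
    (hpA₁ : (p : ℝ) * A₁ < 1) :
    (∃ C : ℝ, AsymptoticallyAlmostSurely (spaMeasure m p) (fun n =>
      {ω | |1 - modularity (spaGraph q A₁ A₂ ω n)| ≤
        C * ((n : ℝ) ^ (max (-1 / (m : ℝ)) (-1 + (p : ℝ) * A₁) / 2)
          * (Real.log (n : ℝ)) ^ ((9 : ℝ) / 2))})) ∧
    (∀ ε : ℝ, 0 < ε → AsymptoticallyAlmostSurely (spaMeasure m p) (fun n =>
      {ω | |1 - modularity (spaGraph q A₁ A₂ ω n)| ≤ ε})) := by
  obtain ⟨C, hC⟩ := asymptoticallyAlmostSurely_modularity hm hq hA₁ hA₂ hp hpA₁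
  refine ⟨⟨C, hC⟩, fun ε hε => hC.mono ?_⟩
  have hmR : (0 : ℝ) < m := by exact_mod_cast hm
  have hneg : max (-1 / (m : ℝ)) (-1 + (p : ℝ) * A₁) / 2 < 0 := by
    have h1 : -1 / (m : ℝ) < 0 := div_neg_of_neg_of_pos (by norm_num) hmR
    have := max_lt h1 (by linarith : -1 + (p : ℝ) * A₁ < 0)
    linarith
  have h := (tendsto_rpow_neg_mul_log_rpow hneg ((9 : ℝ) / 2)).const_mul C
  rw [mul_zero] at h
  filter_upwards [h.eventually (eventually_le_nhds hε)] with n hn ω hω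
  exact le_trans hω hn
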